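/- Let $\mathbb T=\mathbb R/2\pi\mathbb Z$ and let $L^2=L^2(\mathbb T)$, $H^2=H^2(\mathbb T)$ be the spaces of real functions, with $\|u\|_{H^2}^2=\sum_{k\in\mathbb Z}(1+k^2)^2|\hat u(k)|^2$. For $\varepsilon>0$ consider the fast-reaction system $$\partial_t u=\Delta u+\tfrac1\varepsilon\big[v^2-u(u+1)\big],\qquad \partial_t v=\Delta v \qquad\text{on }\mathbb T, \tag{1}$$ whose strict solutions on $[0,T]$ are the solutions $(u,v)\in C([0,T];H^2\times H^2)\cap C^1([0,T];L^2\times L^2)$, and its attracting critical manifold $$S_0=\{(h^0(v),v)\},\qquad h^0(v)=-\tfrac12+\sqrt{\tfrac14+v^2}.$$ Given $\lambda_0\in(-1,0)$ and $\zeta>0$, let $k_0\ge 0$ be the integer with $-(k_0+1)^2<\zeta^{-1}\lambda_0\le -k_0^2$, let $Y_S^\zeta$ be the space of real functions in $\operatorname{span}\{e^{ikx}:|k|\le k_0\}$ and $Y_F^\zeta$ the closed span in $L^2$ (real functions) of the modes $|k|>k_0$. The reduced slow system is $$u_\zeta^0=h^0(v_\zeta^0),\qquad v_\zeta^0(t)\in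 Y_S^\zeta,\qquad \partial_t v_\zeta^0=\Delta v_\zeta^0 ,$$ and $S_{0,\zeta}=\{(u,v)\in S_0: v\in Y_S^\zeta,\ \|v\|_{H^2}\le\sigma\}$. For every $\lambda_0\in(-1,0)$ there is $\sigma_0>0$ such that for every $\sigma\in(0,\sigma_0]$ there are $\varepsilon_0,\zeta_0,C>0$ such that for all $\varepsilon\in(0,\varepsilon_0]$ and $\zeta\in(0,\zeta_0]$ with $\varepsilon\zeta^{-1}<1$ there is a $C^1$ map $h=(h_X,h_F):(Y_S^\zeta,\|\cdot\|_{H^2})\to H^2\times(Y_F^\zeta\cap H^2)$ for which the slow manifold $$S_{\varepsilon,\zeta}=\{(h_X(v_0),\,v_0+h_F(v_0)):v_0\in Y_S^\zeta,\ \|v_0\|_{H^2}\le\sigma\}$$ satisfies the following. 1. $S_{\varepsilon,\zeta}$ is locally invariant under (1): trajectories of strict solutions can leave or enter $S_{\varepsilon,\zeta}$ only through its boundary (the points with $\|v_0\|_{H^2}=\sigma$). 2. The Hausdorff distance in $H^2\times H^2$ satisfies $\operatorname{dist}(S_{\varepsilon,\zeta},S_{0,\zeta})\le C(\varepsilon+\zeta^{1/2})$.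 3. For every $v_0\in Y_S^\zeta$ with $\|v_0\|_{H^2}\le\sigma$ and every $T>0$, system (1) has a strict solution $(u^\varepsilon,v^\varepsilon)$ on $[0,T]$ starting at the point $(h_X(v_0),v_0+h_F(v_0))$ of $S_{\varepsilon,\zeta}$, the reduced slow system has a strict solution $(u_\zeta^0,v_\zeta^0)$ on $[0,T]$ with $v_\zeta^0(0)=v_0$, and all such solutions satisfy $$\sup_{0\le t\le T}\big(\|u^\varepsilon(t)-u_\zeta^0(t)\|_{H^2}+\|v^\varepsilon(t)-v_\zeta^0(t)\|_{H^2}\big)\le C(\varepsilon+\zeta^{1/2}).$$ -/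

import Mathlib

/-!
The second equation is the linear heat equation and leaves the slow modes invariant, so one can take
`h_F = 0` and look for a manifold that is a graph `u = h_X v` over the slow modes. Near zero the
critical manifold is the graph of a `C¹` map `φ` on `H²` with `φ(v)² + φ(v) = v²`. Write
`h_X = φ + W`. Then `W` is a fixed point of a Lyapunov–Perron map, which integrates the linearised
fast equation over the whole past of the slow flow. The fast semigroup decays at rate `ε⁻¹`, whereas
the backward slow flow grows at rate at most `k₀² ≤ |λ₀| ζ⁻¹ < ε⁻¹`, so the integral converges
together with its derivative in `v`. Its source is the remainder `φ''(v) v_x²` in the Laplacian of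
`φ(v)`, of size `k₀ ‖v‖²`. Hence `W` is of size `ε k₀`, and `ε k₀ ≤ ε ζ^{-1/2} ≤ ζ^{1/2}`.

Trajectories starting on the graph stay on it by forward uniqueness. That they can also enter it
only through the boundary is backward uniqueness for a parabolic equation, which holds because the
Dirichlet quotient of the difference of two solutions stays bounded.
-/

open MeasureTheory Set

namespace FastReaction

noncomputable section

instance fact_zero_lt_two_pi : Fact ((0 : ℝ) < 2 * Real.pi) := ⟨Real.two_pi_pos⟩

/-- The one-dimensional torus `ℝ / 2πℤ`. -/
abbrev Torus : Type := AddCircle (2 * Real.pi)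

/-- The real space `L²(𝕋)` (with respect to the normalized Lebesgue measure on the torus). -/
abbrev L2 : Type := Lp ℝ 2 (AddCircle.haarAddCircle (T := 2 * Real.pi))

/-- The `k`-th Fourier coefficient `(1/2π) ∫ f(x) e^{-ikx} dx` of a real function on the torus. -/
def coeff (f : Torus → ℝ) (k : ℤ) : ℂ := fourierCoeff (fun x => ((f x : ℝ) : ℂ)) k

lemma integrable_ofReal (f : C(Torus, ℝ)) :
    Integrable (fun x => ((f x : ℝ) : ℂ)) (AddCircle.haarAddCircle (T := 2 * Real.pi)) :=
  (Complex.continuous_ofReal.comp f.continuous).integrable_of_hasCompactSupport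
    (HasCompactSupport.of_compactSpace _)

lemma coeff_add (f g : C(Torus, ℝ)) (k : ℤ) : coeff (f + g) k = coeff f k + coeff g k := by
  have h := fourierCoeff.add (integrable_ofReal f) (integrable_ofReal g)
  have h' := congrFun h k
  simp only [Pi.add_apply] at h'
  rw [coeff, coeff, coeff, ← h']
  congr 1
  funext x
  simp

lemma coeff_smul (c : ℝ) (f : C(Torus, ℝ)) (k : ℤ) : coeff (c • f) k = (c : ℂ) * coeff f k := by
  have h := fourierCoeff.const_mul (fun x => ((f x : ℝ) : ℂ)) (c : ℂ) k
  rw [coeff, coeff, ← h]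
  congr 1
  funext x
  simp

lemma coeff_zero (k : ℤ) : coeff (0 : C(Torus, ℝ)) k = 0 := by
  have h := coeff_smul 0 0 k
  simpa using h

/-- The sequence `((1 + k²) û(k))_k` attached to a function `u` on the torus. -/
def weighted (f : Torus → ℝ) (k : ℤ) : ℂ := ((1 + (k : ℝ) ^ 2 : ℝ) : ℂ) * coeff f k

lemma weighted_add (f g : C(Torus, ℝ)) :
    weighted (f + g) = weighted f + weighted g := by
  funext k
  simp only [weighted, Pi.add_apply]
  rw [coeff_add, mul_add]

lemma weighted_smul (c : ℝ) (f : C(Torus, ℝ)) :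
    weighted (c • f) = c • weighted f := by
  funext k
  simp only [weighted, Pi.smul_apply, Complex.real_smul]
  rw [coeff_smul]
  ring

/-- The real functions on the torus whose weighted Fourier coefficients `(1 + k²) û(k)` are square
summable. In dimension one every class of `H²(𝕋)` has exactly one continuous representative, and
the elements of `H²(𝕋)` are these representatives. -/
def h2Submodule : Submodule ℝ C(Torus, ℝ) where
  carrier := {f | Memℓp (weighted f) 2}
  add_mem' := by
    intro f g hf hg
    simp only [mem_ofPred_eq] at *
    have h := weighted_add f g
    rw [ContinuousMap.coe_add, h]
    exact hf.add hg
  zero_mem' := by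
    have h : weighted (0 : C(Torus, ℝ)) = 0 := by
      funext k
      simp only [weighted, Pi.zero_apply]
      rw [coeff_zero, mul_zero]
    simp only [mem_ofPred_eq]
    rw [h]
    exact zero_memℓp
  smul_mem' := by
    intro c f hf
    simp only [mem_ofPred_eq] at *
    have h := weighted_smul c f
    rw [ContinuousMap.coe_smul, h]
    exact hf.const_smul c

/-- The Sobolev space `H²(𝕋)` of real functions on the torus. -/
def H2 : Type := h2Submodule

instance : AddCommGroup H2 := inferInstanceAs (AddCommGroup h2Submodule)

instance : Module ℝ H2 := inferInstanceAs (Module ℝ h2Submodule)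

/-- The continuous function underlying an element of `H²(𝕋)`. -/
def toCont : H2 →ₗ[ℝ] C(Torus, ℝ) := h2Submodule.subtype

lemma toCont_mem (u : H2) : Memℓp (weighted (toCont u)) 2 := Subtype.property u

lemma toCont_injective : Function.Injective toCont := Subtype.val_injective

/-- The map `u ↦ ((1 + k²) û(k))_k` from `H²(𝕋)` to `ℓ²(ℤ)`. -/
def weightedCoeff : H2 →ₗ[ℝ] lp (fun _ : ℤ => ℂ) 2 where
  toFun u := ⟨weighted (toCont u), toCont_mem u⟩
  map_add' := by
    intro u v
    apply Subtype.ext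
    change weighted (toCont (u + v)) = weighted (toCont u) + weighted (toCont v)
    rw [map_add]
    exact weighted_add (toCont u) (toCont v)
  map_smul' := by
    intro c u
    apply Subtype.ext
    change weighted (toCont (c • u)) = c • weighted (toCont u)
    rw [map_smul]
    exact weighted_smul c (toCont u)

lemma weightedCoeff_injective : Function.Injective weightedCoeff := by
  rw [← LinearMap.ker_eq_bot, LinearMap.ker_eq_bot']
  intro u hu
  have hc : ∀ k, coeff (toCont u) k = 0 := by
    intro k
    have h1 : weighted (toCont u) k = 0 := congrFun (congrArg Subtype.val hu) k
    have h2 : ((1 + (k : ℝ) ^ 2 : ℝ) : ℂ) ≠ 0 := by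
      have : (1 + (k : ℝ) ^ 2 : ℝ) ≠ 0 := by positivity
      exact_mod_cast this
    exact (mul_eq_zero.mp h1).resolve_left h2
  apply toCont_injective
  rw [map_zero]
  let F : C(Torus, ℂ) := ⟨fun x => ((toCont u x : ℝ) : ℂ),
    Complex.continuous_ofReal.comp (toCont u).continuous⟩
  have hF : fourierCoeff F = 0 := by
    funext k
    exact hc k
  have hs : Summable (fourierCoeff F) := by
    rw [hF]
    exact summable_zero
  ext x
  have h3 := has_pointwise_sum_fourier_series_of_summable hs x
  rw [hF] at h3
  have h4 : F x = 0 := by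
    refine h3.unique ?_
    simp
  have h5 : ((toCont u x : ℝ) : ℂ) = 0 := h4
  simpa using h5

/-- The norm of `H²(𝕋)`: `‖u‖² = ∑ (1 + k²)² |û(k)|²`. -/
instance : NormedAddCommGroup H2 :=
  NormedAddCommGroup.induced H2 (lp (fun _ : ℤ => ℂ) 2) weightedCoeff weightedCoeff_injective

instance : NormedSpace ℝ H2 := NormedSpace.induced ℝ H2 (lp (fun _ : ℤ => ℂ) 2) weightedCoeff

lemma norm_sq_eq (u : H2) :
    ‖u‖ ^ 2 = ∑' k : ℤ, (1 + (k : ℝ) ^ 2) ^ 2 * ‖coeff (toCont u) k‖ ^ 2 := by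
  have h := lp.norm_rpow_eq_tsum (p := 2) (by norm_num) (weightedCoeff u)
  have h0 : ‖u‖ = ‖weightedCoeff u‖ := rfl
  simp only [ENNReal.toReal_ofNat, Real.rpow_ofNat] at h
  rw [h0, h]
  refine tsum_congr fun k => ?_
  have h1 : (weightedCoeff u : ℤ → ℂ) k = ((1 + (k : ℝ) ^ 2 : ℝ) : ℂ) * coeff (toCont u) k := rfl
  rw [h1, norm_mul, mul_pow, Complex.norm_real, Real.norm_of_nonneg (by positivity)]

/-- The class in `L²(𝕋)` of a continuous function. -/
def toL2 (f : C(Torus, ℝ)) : L2 :=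
  ContinuousMap.toLp 2 (AddCircle.haarAddCircle (T := 2 * Real.pi)) ℝ f

/-- `w = Δu` in `L²(𝕋)`: the Fourier coefficients of `w` are `-k² û(k)`. -/
def IsLaplacian (u : H2) (w : L2) : Prop :=
  ∀ k : ℤ, coeff w k = -(k : ℂ) ^ 2 * coeff (toCont u) k

/-- `(u, v)` is a strict solution on `[0, T]`, i.e. of class
`C([0,T]; H² × H²) ∩ C¹([0,T]; L² × L²)`, of the fast-reaction system
`∂ₜu = Δu + ε⁻¹ (v² - u(u+1))`, `∂ₜv = Δv`. The time derivatives are taken in `L²`; they are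
continuous because the right-hand sides are. -/
structure IsSolution (ε T : ℝ) (u v : ℝ → H2) : Prop where
  continuousOn_u : ContinuousOn u (Icc 0 T)
  continuousOn_v : ContinuousOn v (Icc 0 T)
  eq_u : ∀ t ∈ Icc 0 T, ∃ w : L2, IsLaplacian (u t) w ∧
    HasDerivWithinAt (fun s => toL2 (toCont (u s)))
      (w + ε⁻¹ • toL2 (toCont (v t) ^ 2 - toCont (u t) * (toCont (u t) + 1))) (Icc 0 T) t
  eq_v : ∀ t ∈ Icc 0 T, ∃ w : L2, IsLaplacian (v t) w ∧
    HasDerivWithinAt (fun s => toL2 (toCont (v s))) w (Icc 0 T) t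

/-- The (attracting branch of the) critical manifold, `u = h⁰(v) = -1/2 + √(1/4 + v²)`. -/
def criticalManifold : Set (H2 × H2) :=
  {p | ∀ x, toCont p.1 x = -(1 / 2) + Real.sqrt (1 / 4 + (toCont p.2 x) ^ 2)}

/-- The slow modes: the real functions in the span of `e^{ikx}`, `|k| ≤ k₀`. -/
def slowSpace (k₀ : ℕ) : Submodule ℝ H2 where
  carrier := {v | ∀ k : ℤ, (k₀ : ℤ) < |k| → weightedCoeff v k = 0}
  add_mem' := by
    intro u v hu hv k hk
    rw [map_add, lp.coeFn_add, Pi.add_apply, hu k hk, hv k hk, add_zero]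
  zero_mem' := by
    intro k _
    rw [map_zero]
    rfl
  smul_mem' := by
    intro c u hu k hk
    rw [map_smul, lp.coeFn_smul, Pi.smul_apply, hu k hk, smul_zero]

/-- The fast modes in `H²`: the closed span of `e^{ikx}`, `|k| > k₀`. -/
def fastSpace (k₀ : ℕ) : Submodule ℝ H2 where
  carrier := {v | ∀ k : ℤ, |k| ≤ (k₀ : ℤ) → weightedCoeff v k = 0}
  add_mem' := by
    intro u v hu hv k hk
    rw [map_add, lp.coeFn_add, Pi.add_apply, hu k hk, hv k hk, add_zero]
  zero_mem' := by
    intro k _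
    rw [map_zero]
    rfl
  smul_mem' := by
    intro c u hu k hk
    rw [map_smul, lp.coeFn_smul, Pi.smul_apply, hu k hk, smul_zero]

lemma weightedCoeff_eq_zero_iff (u : H2) (k : ℤ) :
    weightedCoeff u k = 0 ↔ coeff (toCont u) k = 0 := by
  have h1 : weightedCoeff u k = ((1 + (k : ℝ) ^ 2 : ℝ) : ℂ) * coeff (toCont u) k := rfl
  have h2 : ((1 + (k : ℝ) ^ 2 : ℝ) : ℂ) ≠ 0 := by
    have : (1 + (k : ℝ) ^ 2 : ℝ) ≠ 0 := by positivity
    exact_mod_cast this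
  rw [h1, mul_eq_zero, or_iff_right h2]

/-- `(u, v)` is a strict solution on `[0, T]` of the reduced slow system
`u = h⁰(v)`, `pr_F v = 0`, `∂ₜv = Δv` (the slow equation has no reaction term). -/
structure IsReducedSolution (k₀ : ℕ) (T : ℝ) (u v : ℝ → H2) : Prop where
  continuousOn_v : ContinuousOn v (Icc 0 T)
  mem_critical : ∀ t ∈ Icc 0 T, (u t, v t) ∈ criticalManifold
  mem_slow : ∀ t ∈ Icc 0 T, v t ∈ slowSpace k₀
  eq_v : ∀ t ∈ Icc 0 T, ∃ w : L2, IsLaplacian (v t) w ∧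
    HasDerivWithinAt (fun s => toL2 (toCont (v s))) w (Icc 0 T) t

/-- The part `S_{0,ζ}` of the critical manifold over the closed ball of radius `σ` of the slow
space, in the `H²` norm. -/
def reducedCritical (k₀ : ℕ) (σ : ℝ) : Set (H2 × H2) :=
  {p | p ∈ criticalManifold ∧ p.2 ∈ slowSpace k₀ ∧ ‖p.2‖ ≤ σ}

/-- The point `(h_X(v₀), v₀ + h_F(v₀))` of phase space over `v₀`. -/
def graphPoint {k₀ : ℕ} (h : slowSpace k₀ → H2 × fastSpace k₀) (v₀ : slowSpace k₀) : H2 × H2 :=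
  ((h v₀).1, (v₀ : H2) + ((h v₀).2 : H2))

/-- The graph of `h` over the closed ball of radius `σ` of the slow space. -/
def graphManifold {k₀ : ℕ} (h : slowSpace k₀ → H2 × fastSpace k₀) (σ : ℝ) : Set (H2 × H2) :=
  graphPoint h '' Metric.closedBall 0 σ

/-- The boundary of the manifold `graphManifold h σ`. -/
def graphBoundary {k₀ : ℕ} (h : slowSpace k₀ → H2 × fastSpace k₀) (σ : ℝ) : Set (H2 × H2) :=
  graphPoint h '' Metric.sphere 0 σ

/-- A manifold `S` with boundary `∂S` is locally invariant under the fast-reaction system if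
trajectories leave and enter `S` only through `∂S`. -/
def IsLocallyInvariant (ε : ℝ) (S bdS : Set (H2 × H2)) : Prop :=
  ∀ (T : ℝ) (u v : ℝ → H2), IsSolution ε T u v →
    ∀ s t, 0 ≤ s → s < t → t ≤ T →
      ((u s, v s) ∈ S → (u t, v t) ∉ S → ∃ r ∈ Ico s t, (u r, v r) ∈ bdS) ∧
      ((u s, v s) ∉ S → (u t, v t) ∈ S → ∃ r ∈ Ioc s t, (u r, v r) ∈ bdS)

end

end FastReaction

open FastReaction

namespace FastReaction

noncomputable section

/-! ### Square summable families -/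

section SquareSummable

variable {ι : Type*} {E F : ι → Type*} [∀ i, NormedAddCommGroup (E i)]
  [∀ i, NormedAddCommGroup (F i)]

lemma memℓp_two_iff_summable_sq {f : ∀ i, E i} : Memℓp f 2 ↔ Summable fun i => ‖f i‖ ^ 2 := by
  simpa using memℓp_gen_iff (p := 2) (f := f) (by norm_num)

lemma summable_sq_norm_lp_two (a : lp E 2) : Summable fun i => ‖a i‖ ^ 2 :=
  memℓp_two_iff_summable_sq.mp a.2

lemma sq_norm_lp_two_eq_tsum (a : lp E 2) : ‖a‖ ^ 2 = ∑' i, ‖a i‖ ^ 2 := by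
  simpa using lp.norm_rpow_eq_tsum (p := 2) (by norm_num) a

lemma memℓp_two_of_norm_le {f : ∀ i, E i} (b : lp F 2) (h : ∀ i, ‖f i‖ ≤ ‖b i‖) :
    Memℓp f 2 :=
  memℓp_two_iff_summable_sq.mpr <| (summable_sq_norm_lp_two b).of_nonneg_of_le
    (fun _ => by positivity) fun i => pow_le_pow_left₀ (norm_nonneg _) (h i) 2

lemma norm_lp_two_le_of_norm_le {a : lp E 2} {b : lp F 2} (h : ∀ i, ‖a i‖ ≤ ‖b i‖) :
    ‖a‖ ≤ ‖b‖ := by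
  rw [← sq_le_sq₀ (norm_nonneg _) (norm_nonneg _), sq_norm_lp_two_eq_tsum, sq_norm_lp_two_eq_tsum]
  exact (summable_sq_norm_lp_two a).tsum_le_tsum
    (fun i => pow_le_pow_left₀ (norm_nonneg _) (h i) 2) (summable_sq_norm_lp_two b)

lemma norm_lp_two_le_mul_of_norm_le {a : lp E 2} {b : lp F 2} {M : ℝ} (hM : 0 ≤ M)
    (h : ∀ i, ‖a i‖ ≤ M * ‖b i‖) : ‖a‖ ≤ M * ‖b‖ := by
  rw [← sq_le_sq₀ (norm_nonneg _) (by positivity), mul_pow, sq_norm_lp_two_eq_tsum,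
    sq_norm_lp_two_eq_tsum, ← tsum_mul_left]
  refine (summable_sq_norm_lp_two a).tsum_le_tsum (fun i => ?_)
    ((summable_sq_norm_lp_two b).mul_left _)
  rw [← mul_pow]
  exact pow_le_pow_left₀ (norm_nonneg _) (h i) 2

lemma summable_mul_norm_lp_two {w : ι → ℝ} (hw₀ : ∀ i, 0 ≤ w i) (hw : Summable fun i => w i ^ 2)
    (a : lp E 2) : Summable fun i => w i * ‖a i‖ :=
  Real.summable_mul_of_Lp_Lq_of_nonneg Real.HolderConjugate.two_two hw₀ (fun _ => norm_nonneg _)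
    (by simpa using hw) (by simpa using summable_sq_norm_lp_two a)

lemma tsum_mul_norm_lp_two_le {w : ι → ℝ} (hw₀ : ∀ i, 0 ≤ w i) (hw : Summable fun i => w i ^ 2)
    (a : lp E 2) : ∑' i, w i * ‖a i‖ ≤ √(∑' i, w i ^ 2) * ‖a‖ := by
  have holder := Real.inner_le_Lp_mul_Lq_tsum_of_nonneg Real.HolderConjugate.two_two hw₀
    (fun i => norm_nonneg (a i)) (by simpa using hw) (by simpa using summable_sq_norm_lp_two a)
  simp only [Real.rpow_two, ← Real.sqrt_eq_rpow, ← sq_norm_lp_two_eq_tsum,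
    Real.sqrt_sq (norm_nonneg a)] at holder
  exact holder

lemma tendsto_lp_two_of_dominated {α : Type*} {l : Filter α} {a : α → lp E 2} {a₀ : lp E 2}
    (b : lp F 2) (hb : ∀ᶠ t in l, ∀ i, ‖a t i - a₀ i‖ ≤ ‖b i‖)
    (ha : ∀ i, Filter.Tendsto (fun t => a t i) l (nhds (a₀ i))) :
    Filter.Tendsto a l (nhds a₀) := by
  have sum_sq : Filter.Tendsto (fun t => ∑' i, ‖(a t - a₀) i‖ ^ 2) l
      (nhds (∑' _ : ι, (0 : ℝ))) := by
    refine tendsto_tsum_of_dominated_convergence (summable_sq_norm_lp_two b) (fun i => ?_) ?_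
    · simpa using ((ha i).sub_const (a₀ i)).norm.pow 2
    · filter_upwards [hb] with t ht i
      rw [norm_pow, norm_norm]
      exact pow_le_pow_left₀ (norm_nonneg _) (ht i) 2
  rw [tendsto_iff_norm_sub_tendsto_zero]
  have norm_sub := (Real.continuous_sqrt.tendsto _).comp sum_sq
  rw [tsum_zero, Real.sqrt_zero] at norm_sub
  refine norm_sub.congr fun t => ?_
  rw [Function.comp, ← sq_norm_lp_two_eq_tsum, Real.sqrt_sq (norm_nonneg _)]

end SquareSummable

lemma hasDerivAt_lp_of_forall {ι : Type*} {E : ι → Type*} [∀ i, NormedAddCommGroup (E i)]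
    [∀ i, NormedSpace ℝ (E i)] [∀ i, CompleteSpace (E i)] {p : ENNReal} [Fact (1 ≤ p)]
    {z g : ℝ → lp E p} (hg : Continuous g) (h : ∀ i t, HasDerivAt (fun s => z s i) (g t i) t)
    (t : ℝ) : HasDerivAt z (g t) t := by
  have z_eq : z = fun t => z 0 + ∫ s in (0 : ℝ)..t, g s := by
    funext t
    ext i
    have eval_integral : (∫ s in (0 : ℝ)..t, g s : lp E p) i = ∫ s in (0 : ℝ)..t, g s i :=
      ((lp.evalCLM ℝ E p i).intervalIntegral_comp_comm
        (hg.intervalIntegrable (μ := volume) 0 t)).symm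
    rw [lp.coeFn_add, Pi.add_apply, eval_integral,
      intervalIntegral.integral_eq_sub_of_hasDerivAt (fun s _ => h i s)
        (((lp.evalCLM ℝ E p i).continuous.comp hg).intervalIntegrable _ _),
      add_sub_cancel]
  rw [z_eq]
  exact (intervalIntegral.integral_hasDerivAt_right (hg.intervalIntegrable _ _)
    hg.stronglyMeasurable.stronglyMeasurableAtFilter hg.continuousAt).const_add _

section Convolution

variable {G E : Type*} [AddCommGroup G] [NormedAddCommGroup E]

/-- The translate `k ↦ b (k - j)` of a square summable family. -/
def lpTranslate (b : lp (fun _ : G => E) 2) (j : G) : lp (fun _ : G => E) 2 :=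
  ⟨fun k => b (k - j), memℓp_two_iff_summable_sq.mpr <| by
    simpa [Function.comp_def] using
      (summable_sq_norm_lp_two b).comp_injective (sub_left_injective (b := j))⟩

lemma norm_lpTranslate (b : lp (fun _ : G => E) 2) (j : G) : ‖lpTranslate b j‖ = ‖b‖ := by
  rw [← sq_eq_sq₀ (norm_nonneg _) (norm_nonneg _), sq_norm_lp_two_eq_tsum, sq_norm_lp_two_eq_tsum]
  exact (Equiv.subRight j).tsum_eq fun k => ‖b k‖ ^ 2

lemma exists_lp_two_hasSum_convolution [NormedSpace ℝ E] [CompleteSpace E] {α : G → ℝ}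
    (hα : Summable fun j => ‖α j‖) (b : lp (fun _ : G => E) 2) :
    ∃ A : lp (fun _ : G => E) 2, ‖A‖ ≤ (∑' j, ‖α j‖) * ‖b‖ ∧
      ∀ k, HasSum (fun j => α j • b (k - j)) (A k) := by
  have norm_term (j : G) : ‖α j • lpTranslate b j‖ = ‖α j‖ * ‖b‖ := by
    rw [norm_smul, norm_lpTranslate]
  have summable_term : Summable fun j => α j • lpTranslate b j :=
    .of_norm <| by simpa only [norm_term] using hα.mul_right _
  obtain ⟨A, hA⟩ := summable_term
  refine ⟨A, hA.norm_le_of_bounded (hα.hasSum.mul_right _) fun j => (norm_term j).le, fun k => ?_⟩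
  exact (hA.mapL (lp.evalCLM ℝ (fun _ : G => E) 2 k)).congr_fun fun _ => rfl

end Convolution

/-! ### Fourier coefficients on a circle -/

section Circle

variable {T : ℝ} [hT : Fact (0 < T)]

lemma fourierCoeff_star (f : AddCircle T → ℂ) (k : ℤ) :
    fourierCoeff (fun x => star (f x)) k = star (fourierCoeff f (-k)) := by
  simp only [fourierCoeff, RCLike.star_def, ← integral_conj, smul_eq_mul, map_mul, fourier_neg,
    neg_neg]

lemma fourierCoeff_ofReal_re {f : AddCircle T → ℂ} (hf : Integrable f AddCircle.haarAddCircle)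
    (k : ℤ) : fourierCoeff (fun x => ((f x).re : ℂ)) k =
      (fourierCoeff f k + star (fourierCoeff f (-k))) / 2 := by
  have hf_star : Integrable (fun x => star (f x)) AddCircle.haarAddCircle :=
    Complex.conjCLE.toContinuousLinearMap.integrable_comp hf
  have re_eq : (fun x => ((f x).re : ℂ)) = fun x => 2⁻¹ * (f + fun y => star (f y)) x := by
    funext x
    rw [Pi.add_apply, RCLike.star_def, Complex.add_conj]
    push_cast
    ring
  rw [re_eq, fourierCoeff.const_mul, fourierCoeff.add hf hf_star, Pi.add_apply, fourierCoeff_star,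
    div_eq_inv_mul]

/-- The `k`-th Fourier coefficient as a functional on continuous functions. -/
def fourierCoeffCLM (k : ℤ) : C(AddCircle T, ℂ) →L[ℂ] ℂ :=
  (lp.evalCLM ℂ (fun _ : ℤ => ℂ) 2 k).comp
    ((fourierBasis (T := T)).repr.toContinuousLinearEquiv.toContinuousLinearMap.comp
      (ContinuousMap.toLp 2 AddCircle.haarAddCircle ℂ))

lemma fourierCoeffCLM_apply (k : ℤ) (f : C(AddCircle T, ℂ)) :
    fourierCoeffCLM k f = fourierCoeff f k := by
  rw [← fourierCoeff_toLp, ← fourierBasis_repr]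
  rfl

lemma fourierCoeff_tsum_smul_fourier {c : ℤ → ℂ} (hc : Summable c) (k : ℤ) :
    fourierCoeff (∑' j, c j • fourier j : C(AddCircle T, ℂ)) k = c k := by
  have summable_modes : Summable fun j => (c j • fourier j : C(AddCircle T, ℂ)) :=
    .of_norm <| by simpa only [norm_smul, fourier_norm, mul_one] using hc.norm
  have coeff_hasSum := (fourierCoeffCLM k).hasSum summable_modes.hasSum
  rw [fourierCoeffCLM_apply] at coeff_hasSum
  refine coeff_hasSum.unique ?_
  convert hasSum_ite_eq k (c k) using 2 with j
  rw [map_smul, fourierCoeffCLM_apply, fourierCoeff_fourier]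
  by_cases hjk : j = k
  · subst hjk
    simp
  · simp [hjk, Ne.symm hjk]

lemma fourierCoeff_fourier_mul (j k : ℤ) (f : AddCircle T → ℂ) :
    fourierCoeff (fun x => fourier j x * f x) k = fourierCoeff f (k - j) := by
  simp only [fourierCoeff, smul_eq_mul]
  refine integral_congr_ae (.of_forall fun x => ?_)
  have fourier_split : (fourier (-(k - j)) x : ℂ) = fourier (-k) x * fourier j x := by
    rw [← fourier_add, neg_sub, neg_add_eq_sub]
  simp only [fourier_split, mul_assoc]

lemma hasSum_fourierCoeff_mul {f : C(AddCircle T, ℂ)} (hf : Summable (fourierCoeff f))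
    (g : C(AddCircle T, ℂ)) (k : ℤ) :
    HasSum (fun j => fourierCoeff f j * fourierCoeff g (k - j)) (fourierCoeff (f * g) k) := by
  have := (fourierCoeffCLM k).hasSum ((hasSum_fourier_series_of_summable hf).mul_right g)
  rw [fourierCoeffCLM_apply] at this
  refine this.congr_fun fun j => ?_
  rw [smul_mul_assoc, map_smul, smul_eq_mul, fourierCoeffCLM_apply,
    ← fourierCoeff_fourier_mul]
  rfl

lemma fourierCoeff_of_hasDerivAt {f f' : C(AddCircle T, ℂ)}
    (h : ∀ x : ℝ, HasDerivAt (fun y : ℝ => f (y : AddCircle T)) (f' (x : AddCircle T)) x) (k : ℤ) :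
    fourierCoeff f' k = 2 * Real.pi * Complex.I * k / T * fourierCoeff f k := by
  have continuous_coe : Continuous fun x : ℝ => (x : AddCircle T) := AddCircle.continuous_mk' _
  have by_parts := intervalIntegral.integral_mul_deriv_eq_deriv_mul (a := 0) (b := 0 + T)
    (fun x _ => hasDerivAt_fourier T (-k) x) (fun x _ => h x)
    ((continuous_const.mul ((fourier (-k)).continuous.comp continuous_coe)).intervalIntegrable _ _)
    ((f'.continuous.comp continuous_coe).intervalIntegrable _ _)
  have periodic : ((0 + T : ℝ) : AddCircle T) = ((0 : ℝ) : AddCircle T) := by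
    rw [zero_add, AddCircle.coe_period, QuotientAddGroup.mk_zero]
  rw [periodic, sub_self, zero_sub] at by_parts
  rw [fourierCoeff_eq_intervalIntegral _ k 0, fourierCoeff_eq_intervalIntegral _ k 0]
  simp only [smul_eq_mul]
  rw [by_parts, mul_smul_comm, ← intervalIntegral.integral_const_mul,
    ← intervalIntegral.integral_neg]
  congr 1
  refine intervalIntegral.integral_congr fun x _ => ?_
  push_cast
  ring

end Circle

/-! ### Linear differential equations -/

section LinearODE

variable {E : Type*} [NormedAddCommGroup E] [NormedSpace ℝ E]

lemma hasDerivAt_of_linearIsometry {F : Type*} [NormedAddCommGroup F] [NormedSpace ℝ F]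
    (J : E →ₗᵢ[ℝ] F) {f : ℝ → E} {f' : E} {t : ℝ} (h : HasDerivAt (fun s => J (f s)) (J f') t) :
    HasDerivAt f f' t := by
  rw [hasDerivAt_iff_isLittleO] at h ⊢
  refine (Asymptotics.isLittleO_norm_left.mpr h).congr_left (fun s => ?_) |>.of_norm_left
  rw [← map_sub, ← map_smul, ← map_sub, J.norm_map]

lemma eq_exp_mul_of_hasDerivWithinAt {f : ℝ → ℂ} {c : ℂ} {S : Set ℝ} (hS : Convex ℝ S)
    (hf : ∀ r ∈ S, HasDerivWithinAt f (c * f r) S r) {s t : ℝ} (hs : s ∈ S) (ht : t ∈ S) :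
    f t = Complex.exp (c * (t - s)) * f s := by
  have deriv_eq_zero : ∀ r ∈ S,
      HasDerivWithinAt (fun r : ℝ => Complex.exp (-(c * (r - s))) * f r) 0 S r := fun r hr => by
    have deriv_exponent : HasDerivAt (fun r : ℝ => -(c * ((r : ℂ) - s))) (-c) r := by
      simpa using (((hasDerivAt_id r).ofReal_comp.sub_const (s : ℂ)).const_mul c).fun_neg
    exact (deriv_exponent.cexp.hasDerivWithinAt.mul (hf r hr)).congr_deriv (by ring)
  have eq_const := hS.norm_image_sub_le_of_norm_hasDerivWithin_le deriv_eq_zero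
    (fun _ _ => norm_zero.le) hs ht
  rw [zero_mul, norm_le_zero_iff, sub_eq_zero] at eq_const
  have eq_const : Complex.exp (-(c * (t - s))) * f t = f s := by
    simpa using eq_const
  rw [← eq_const, ← mul_assoc, ← Complex.exp_add, add_neg_cancel, Complex.exp_zero, one_mul]

/-- The linear flow `t ↦ exp (t L)`. -/
def expFlow (L : E →L[ℝ] E) (t : ℝ) : E →L[ℝ] E := NormedSpace.exp (t • L)

lemma expFlow_zero (L : E →L[ℝ] E) : expFlow L 0 = 1 := by
  rw [expFlow, zero_smul, NormedSpace.exp_zero]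

variable [CompleteSpace E]

lemma hasDerivAt_expFlow (L : E →L[ℝ] E) (v : E) (t : ℝ) :
    HasDerivAt (fun s : ℝ => expFlow L s v) (L (expFlow L t v)) t :=
  (ContinuousLinearMap.apply ℝ E v).hasFDerivAt.comp_hasDerivAt t (hasDerivAt_exp_smul_const' L t)

lemma expFlow_add (L : E →L[ℝ] E) (v : E) (s t : ℝ) :
    expFlow L (s + t) v = expFlow L s (expFlow L t v) := by
  let _ : NormedAlgebra ℚ (E →L[ℝ] E) := .restrictScalars ℚ ℝ _
  rw [expFlow, add_smul, NormedSpace.exp_add_of_commute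
    (((Commute.refl L).smul_left s).smul_right t)]
  rfl

lemma eigenfunctional_expFlow (L : E →L[ℝ] E) (l : E →L[ℝ] ℂ) {c : ℂ}
    (h : ∀ v, l (L v) = c * l v) (v : E) (t : ℝ) :
    l (expFlow L t v) = Complex.exp (c * t) * l v := by
  have hasDerivAt_l (s : ℝ) : HasDerivAt (fun s : ℝ => l (expFlow L s v))
      (c * l (expFlow L s v)) s := by
    rw [← h]
    exact l.hasFDerivAt.comp_hasDerivAt s (hasDerivAt_expFlow L v s)
  simpa [expFlow_zero] using eq_exp_mul_of_hasDerivWithinAt convex_univ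
    (fun s _ => (hasDerivAt_l s).hasDerivWithinAt) (mem_univ 0) (mem_univ t)

end LinearODE

section PastIntegral

variable {E : Type*} [NormedAddCommGroup E] [NormedSpace ℝ E]

lemma setIntegral_Ioi_zero_comp_sub_left (f : ℝ → E) (t : ℝ) :
    ∫ s in Ioi (0 : ℝ), f (t - s) = ∫ s in Iic t, f s := by
  have hpre : (fun s => t - s) ⁻¹' Iio t = Ioi (0 : ℝ) := by
    rw [preimage_const_sub_Iio, sub_self]
  rw [integral_Iic_eq_integral_Iio, ← hpre]
  exact (Measure.measurePreserving_sub_left volume t).setIntegral_preimage_emb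
    (MeasurableEquiv.subLeft t).measurableEmbedding f (Iio t)

lemma hasDerivAt_setIntegral_Iic [CompleteSpace E] {f : ℝ → E} (hf : Continuous f)
    (hint : ∀ t, IntegrableOn f (Iic t)) (t : ℝ) :
    HasDerivAt (fun t => ∫ s in Iic t, f s) (f t) t := by
  have hsplit (t : ℝ) : ∫ s in Iic t, f s = (∫ s in Iic (0 : ℝ), f s) + ∫ s in (0 : ℝ)..t, f s := by
    rw [← intervalIntegral.integral_Iic_sub_Iic (hint 0) (hint t), add_sub_cancel]
  rw [funext hsplit]
  exact (intervalIntegral.integral_hasDerivAt_right (hf.intervalIntegrable _ _)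
    hf.stronglyMeasurable.stronglyMeasurableAtFilter hf.continuousAt).const_add _

lemma integrableOn_Iic_exp_smul {μ M : ℝ} (hμ : 0 < μ) {f : ℝ → E} (hf : Continuous f)
    (hM : ∀ t, ‖f t‖ ≤ M) (t : ℝ) : IntegrableOn (fun s => Real.exp (μ * s) • f s) (Iic t) := by
  have hcont : Continuous fun s => Real.exp (μ * s) • f s := by fun_prop
  refine Integrable.mono' ((integrableOn_exp_mul_Iic hμ t).const_mul M)
    hcont.aestronglyMeasurable (Filter.Eventually.of_forall fun s => ?_)
  rw [norm_smul, Real.norm_of_nonneg (Real.exp_pos _).le, mul_comm]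
  exact mul_le_mul_of_nonneg_right (hM s) (Real.exp_pos _).le

lemma hasDerivAt_setIntegral_Ioi_exp_smul [CompleteSpace E] {μ M : ℝ} (hμ : 0 < μ) {f : ℝ → E}
    (hf : Continuous f) (hM : ∀ t, ‖f t‖ ≤ M) (t : ℝ) :
    HasDerivAt (fun t => ∫ s in Ioi (0 : ℝ), Real.exp (-μ * s) • f (t - s))
      (-μ • (∫ s in Ioi (0 : ℝ), Real.exp (-μ * s) • f (t - s)) + f t) t := by
  have hconv (t : ℝ) : ∫ s in Ioi (0 : ℝ), Real.exp (-μ * s) • f (t - s) =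
      Real.exp (-μ * t) • ∫ s in Iic t, Real.exp (μ * s) • f s := by
    rw [← setIntegral_Ioi_zero_comp_sub_left, ← integral_smul]
    refine integral_congr_ae (Filter.Eventually.of_forall fun s => ?_)
    simp only [smul_smul, ← Real.exp_add]
    congr 2
    ring
  have hexp : HasDerivAt (fun t => Real.exp (-μ * t)) (Real.exp (-μ * t) * -μ) t := by
    simpa using ((hasDerivAt_id t).const_mul (-μ)).exp
  have hpast := hasDerivAt_setIntegral_Iic (by fun_prop) (integrableOn_Iic_exp_smul hμ hf hM) t
  rw [funext hconv]
  refine (hexp.smul hpast).congr_deriv ?_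
  rw [smul_smul, ← Real.exp_add, show -μ * t + μ * t = 0 by ring, Real.exp_zero, one_smul, hconv,
    smul_smul, mul_comm (-μ) (Real.exp _), add_comm]

end PastIntegral

/-! ### The Lyapunov–Perron method -/

lemma integrableOn_Ioi_of_norm_le_exp {Z : Type*} [NormedAddCommGroup Z] {f : ℝ → Z} {M μ : ℝ}
    (hμ : 0 < μ) (hf : Continuous f) (h : ∀ s, 0 ≤ s → ‖f s‖ ≤ M * Real.exp (-μ * s)) :
    IntegrableOn f (Ioi 0) :=
  ((exp_neg_integrableOn_Ioi 0 hμ).const_mul M).mono' hf.aestronglyMeasurable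
    ((ae_restrict_iff' measurableSet_Ioi).mpr (.of_forall fun s hs => h s hs.le))

lemma norm_setIntegral_Ioi_le_of_norm_le_exp {Z : Type*} [NormedAddCommGroup Z] [NormedSpace ℝ Z]
    {f : ℝ → Z} {M μ : ℝ} (hμ : 0 < μ) (h : ∀ s, 0 ≤ s → ‖f s‖ ≤ M * Real.exp (-μ * s)) :
    ‖∫ s in Ioi (0 : ℝ), f s‖ ≤ M / μ := by
  calc ‖∫ s in Ioi (0 : ℝ), f s‖ ≤ ∫ s in Ioi (0 : ℝ), M * Real.exp (-μ * s) :=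
        norm_integral_le_of_norm_le ((exp_neg_integrableOn_Ioi 0 hμ).const_mul M)
          ((ae_restrict_iff' measurableSet_Ioi).mpr (.of_forall fun s hs => h s (le_of_lt hs)))
    _ = M / μ := by
        rw [integral_const_mul, integral_exp_mul_Ioi (neg_lt_zero.mpr hμ), mul_zero,
          Real.exp_zero, neg_div_neg_eq, mul_one_div]

section LyapunovPerron

variable {X Y : Type*} [NormedAddCommGroup X] [NormedSpace ℝ X]
  [NormedAddCommGroup Y] [NormedSpace ℝ Y]

/-- A family `K s` of operators decaying at rate `b` together with a family `E s` growing at a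
rate at most `ℓ < b`; in a slow–fast system `K` is the fast semigroup and `E` the slow flow run
backward in time. -/
structure IsDichotomy (K : ℝ → X →L[ℝ] X) (E : ℝ → Y →L[ℝ] Y) (b ℓ : ℝ) : Prop where
  nonneg : 0 ≤ ℓ
  lt : ℓ < b
  continuous_left : Continuous fun p : ℝ × X => K p.1 p.2
  norm_left_le : ∀ s, 0 ≤ s → ‖K s‖ ≤ Real.exp (-b * s)
  continuous_right : ∀ y, Continuous fun s => E s y
  norm_right_le : ∀ s, 0 ≤ s → ‖E s‖ ≤ Real.exp (ℓ * s)

variable {K : ℝ → X →L[ℝ] X} {E : ℝ → Y →L[ℝ] Y} {b ℓ : ℝ}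

/-- The Duhamel integral over the whole past of the source `G` along the backward orbit of `v`. -/
def duhamel (K : ℝ → X →L[ℝ] X) (E : ℝ → Y →L[ℝ] Y) (G : Y → X) (v : Y) : X :=
  ∫ s in Ioi (0 : ℝ), K s (G (E s v))

/-- The derivative of `duhamel K E G`, when `G'` is the derivative of `G`. -/
def duhamelDeriv (K : ℝ → X →L[ℝ] X) (E : ℝ → Y →L[ℝ] Y) (G' : Y → Y →L[ℝ] X) (v : Y) :
    Y →L[ℝ] X :=
  ∫ s in Ioi (0 : ℝ), (K s).comp ((G' (E s v)).comp (E s))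

namespace IsDichotomy

lemma pos (h : IsDichotomy K E b ℓ) : 0 < b := h.nonneg.trans_lt h.lt

lemma sub_pos (h : IsDichotomy K E b ℓ) : 0 < b - ℓ := _root_.sub_pos.mpr h.lt

lemma norm_left_apply_le (h : IsDichotomy K E b ℓ) {x : X} {M : ℝ} (hx : ‖x‖ ≤ M) {s : ℝ}
    (hs : 0 ≤ s) : ‖K s x‖ ≤ M * Real.exp (-b * s) := by
  rw [mul_comm]
  exact ((K s).le_opNorm x).trans
    (mul_le_mul (h.norm_left_le s hs) hx (norm_nonneg _) (Real.exp_pos _).le)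

lemma norm_comp_comp_le (h : IsDichotomy K E b ℓ) {P : Y →L[ℝ] X} {M : ℝ} (hP : ‖P‖ ≤ M) {s : ℝ}
    (hs : 0 ≤ s) : ‖(K s).comp (P.comp (E s))‖ ≤ M * Real.exp (-(b - ℓ) * s) :=
  calc ‖(K s).comp (P.comp (E s))‖ ≤ Real.exp (-b * s) * (M * Real.exp (ℓ * s)) := by
        refine (ContinuousLinearMap.opNorm_comp_le _ _).trans (mul_le_mul (h.norm_left_le s hs)
          ((ContinuousLinearMap.opNorm_comp_le _ _).trans ?_) (norm_nonneg _) (Real.exp_pos _).le)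
        exact mul_le_mul hP (h.norm_right_le s hs) (norm_nonneg _) ((norm_nonneg _).trans hP)
    _ = M * Real.exp (-(b - ℓ) * s) := by
        rw [mul_left_comm, ← Real.exp_add]
        ring_nf

lemma continuous_integrand (h : IsDichotomy K E b ℓ) {G : Y → X} (hG : Continuous G) (v : Y) :
    Continuous fun s => K s (G (E s v)) :=
  h.continuous_left.comp (continuous_id.prodMk (hG.comp (h.continuous_right v)))

lemma integrableOn (h : IsDichotomy K E b ℓ) {G : Y → X} (hG : Continuous G) {M : ℝ}
    (hM : ∀ y, ‖G y‖ ≤ M) (v : Y) : IntegrableOn (fun s => K s (G (E s v))) (Ioi 0) :=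
  integrableOn_Ioi_of_norm_le_exp h.pos (h.continuous_integrand hG v)
    fun _ hs => h.norm_left_apply_le (hM _) hs

lemma norm_duhamel_le (h : IsDichotomy K E b ℓ) {G : Y → X} {M : ℝ} (hM : ∀ y, ‖G y‖ ≤ M)
    (v : Y) : ‖duhamel K E G v‖ ≤ M / b :=
  norm_setIntegral_Ioi_le_of_norm_le_exp h.pos fun _ hs => h.norm_left_apply_le (hM _) hs

lemma norm_duhamel_sub_le (h : IsDichotomy K E b ℓ) {G₁ G₂ : Y → X} (hG₁ : Continuous G₁)
    (hG₂ : Continuous G₂) {M₁ M₂ M : ℝ} (hM₁ : ∀ y, ‖G₁ y‖ ≤ M₁) (hM₂ : ∀ y, ‖G₂ y‖ ≤ M₂)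
    (hM : ∀ y, ‖G₁ y - G₂ y‖ ≤ M) (v : Y) : ‖duhamel K E G₁ v - duhamel K E G₂ v‖ ≤ M / b := by
  rw [duhamel, duhamel, ← integral_sub (h.integrableOn hG₁ hM₁ v) (h.integrableOn hG₂ hM₂ v)]
  simp only [← map_sub]
  exact h.norm_duhamel_le (G := fun y => G₁ y - G₂ y) hM v

lemma norm_duhamelDeriv_le (h : IsDichotomy K E b ℓ) {G' : Y → Y →L[ℝ] X} {M : ℝ}
    (hM : ∀ y, ‖G' y‖ ≤ M) (v : Y) : ‖duhamelDeriv K E G' v‖ ≤ M / (b - ℓ) :=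
  norm_setIntegral_Ioi_le_of_norm_le_exp h.sub_pos fun _ hs => h.norm_comp_comp_le (hM _) hs

variable [FiniteDimensional ℝ Y]

lemma continuous_integrand_deriv (h : IsDichotomy K E b ℓ) {G' : Y → Y →L[ℝ] X}
    (hG' : Continuous G') (v : Y) : Continuous fun s => (K s).comp ((G' (E s v)).comp (E s)) :=
  continuous_clm_apply.mpr fun y => h.continuous_left.comp (continuous_id.prodMk
    ((hG'.comp (h.continuous_right v)).clm_apply (h.continuous_right y)))

lemma integrableOn_deriv (h : IsDichotomy K E b ℓ) {G' : Y → Y →L[ℝ] X} (hG' : Continuous G')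
    {M : ℝ} (hM : ∀ y, ‖G' y‖ ≤ M) (v : Y) :
    IntegrableOn (fun s => (K s).comp ((G' (E s v)).comp (E s))) (Ioi 0) :=
  integrableOn_Ioi_of_norm_le_exp h.sub_pos (h.continuous_integrand_deriv hG' v)
    fun _ hs => h.norm_comp_comp_le (hM _) hs

lemma norm_duhamelDeriv_sub_le (h : IsDichotomy K E b ℓ) {G₁ G₂ : Y → Y →L[ℝ] X}
    (hG₁ : Continuous G₁) (hG₂ : Continuous G₂) {M₁ M₂ M : ℝ} (hM₁ : ∀ y, ‖G₁ y‖ ≤ M₁)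
    (hM₂ : ∀ y, ‖G₂ y‖ ≤ M₂) (hM : ∀ y, ‖G₁ y - G₂ y‖ ≤ M) (v : Y) :
    ‖duhamelDeriv K E G₁ v - duhamelDeriv K E G₂ v‖ ≤ M / (b - ℓ) := by
  rw [duhamelDeriv, duhamelDeriv,
    ← integral_sub (h.integrableOn_deriv hG₁ hM₁ v) (h.integrableOn_deriv hG₂ hM₂ v)]
  simp only [← ContinuousLinearMap.comp_sub, ← ContinuousLinearMap.sub_comp]
  exact h.norm_duhamelDeriv_le (G' := fun y => G₁ y - G₂ y) hM v

lemma continuous_duhamelDeriv (h : IsDichotomy K E b ℓ) {G' : Y → Y →L[ℝ] X}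
    (hG' : Continuous G') {M : ℝ} (hM : ∀ y, ‖G' y‖ ≤ M) : Continuous (duhamelDeriv K E G') := by
  refine continuous_of_dominated (bound := fun s => M * Real.exp (-(b - ℓ) * s))
    (fun v => (h.continuous_integrand_deriv hG' v).aestronglyMeasurable)
    (fun v => (ae_restrict_iff' measurableSet_Ioi).mpr
      (.of_forall fun s hs => h.norm_comp_comp_le (hM _) (le_of_lt hs)))
    ((exp_neg_integrableOn_Ioi 0 h.sub_pos).const_mul M) (.of_forall fun s => ?_)
  exact continuous_const.clm_comp ((hG'.comp (E s).continuous).clm_comp continuous_const)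

lemma hasFDerivAt_duhamel (h : IsDichotomy K E b ℓ) {G : Y → X} {G' : Y → Y →L[ℝ] X} {M M' : ℝ}
    (hG : ∀ y, HasFDerivAt G (G' y) y) (hG' : Continuous G') (hM : ∀ y, ‖G y‖ ≤ M)
    (hM' : ∀ y, ‖G' y‖ ≤ M') (v : Y) :
    HasFDerivAt (duhamel K E G) (duhamelDeriv K E G' v) v := by
  have continuous_G : Continuous G := continuous_iff_continuousAt.mpr fun y => (hG y).continuousAt
  refine hasFDerivAt_integral_of_dominated_of_fderiv_le (F := fun v s => K s (G (E s v)))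
    (F' := fun v s => (K s).comp ((G' (E s v)).comp (E s)))
    (bound := fun s => M' * Real.exp (-(b - ℓ) * s)) Filter.univ_mem
    (.of_forall fun y => (h.continuous_integrand continuous_G y).aestronglyMeasurable)
    (h.integrableOn continuous_G hM v)
    (h.continuous_integrand_deriv hG' v).aestronglyMeasurable
    ((ae_restrict_iff' measurableSet_Ioi).mpr
      (.of_forall fun s hs y _ => h.norm_comp_comp_le (hM' _) (le_of_lt hs)))
    ((exp_neg_integrableOn_Ioi 0 h.sub_pos).const_mul M') (.of_forall fun s y _ => ?_)
  exact (K s).hasFDerivAt.comp y ((hG (E s y)).comp y (E s).hasFDerivAt)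

end IsDichotomy

/-- A `C¹` nonlinearity `N (y, x)` which maps the ball `‖x‖ ≤ r` into the ball of radius `b r`,
whose derivative in `y` is bounded, whose derivative in `x` is small compared with the gap `b - ℓ`,
and whose derivative is Lipschitz in `x`. -/
structure IsSmallNonlinearity (N : Y × X → X) (b ℓ r M : ℝ) (A : NNReal) : Prop where
  contDiff : ContDiff ℝ 1 N
  norm_le : ∀ y x, ‖x‖ ≤ r → ‖N (y, x)‖ ≤ b * r
  norm_fderiv_inl_le : ∀ y x, ‖x‖ ≤ r → ‖(fderiv ℝ N (y, x)).comp (.inl ℝ Y X)‖ ≤ M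
  norm_fderiv_inr_le : ∀ y x, ‖x‖ ≤ r →
    ‖(fderiv ℝ N (y, x)).comp (.inr ℝ Y X)‖ ≤ (b - ℓ) / 4
  lipschitzOnWith_fderiv : ∀ y,
    LipschitzOnWith A (fun x => fderiv ℝ N (y, x)) (Metric.closedBall 0 r)

/-- The nonlinearity along the graph of `W`. -/
def alongGraph (N : Y × X → X) (W : Y → X) (y : Y) : X := N (y, W y)

/-- The derivative of `alongGraph N W`, when `P` is the derivative of `W`. -/
def alongGraphDeriv (N : Y × X → X) (W : Y → X) (P : Y → Y →L[ℝ] X) (y : Y) : Y →L[ℝ] X :=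
  (fderiv ℝ N (y, W y)).comp ((ContinuousLinearMap.id ℝ Y).prod (P y))

namespace IsSmallNonlinearity

variable {N : Y × X → X} {r M L : ℝ} {A : NNReal} {W W₁ W₂ : Y → X} {P P₁ P₂ : Y → Y →L[ℝ] X}

lemma continuous_alongGraph (h : IsSmallNonlinearity N b ℓ r M A) (hW : Continuous W) :
    Continuous (alongGraph N W) :=
  h.contDiff.continuous.comp (continuous_id.prodMk hW)

lemma continuous_alongGraphDeriv (h : IsSmallNonlinearity N b ℓ r M A) (hW : Continuous W)
    (hP : Continuous P) : Continuous (alongGraphDeriv N W P) :=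
  ((h.contDiff.continuous_fderiv one_ne_zero).comp (continuous_id.prodMk hW)).clm_comp
    ((ContinuousLinearMap.prodₗᵢ ℝ).continuous.comp (continuous_const.prodMk hP))

lemma hasFDerivAt_alongGraph (h : IsSmallNonlinearity N b ℓ r M A) {y : Y}
    (hW : HasFDerivAt W (P y) y) :
    HasFDerivAt (alongGraph N W) (alongGraphDeriv N W P y) y :=
  ((h.contDiff.differentiable one_ne_zero (y, W y)).hasFDerivAt).comp y
    ((hasFDerivAt_id y).prodMk hW)

lemma nonneg (h : IsSmallNonlinearity N b ℓ r M A) (hr : 0 ≤ r) : 0 ≤ M :=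
  (norm_nonneg _).trans (h.norm_fderiv_inl_le 0 0 (norm_zero.trans_le hr))

lemma norm_alongGraph_sub_le (h : IsSmallNonlinearity N b ℓ r M A) {y : Y} (hW₁ : ‖W₁ y‖ ≤ r)
    (hW₂ : ‖W₂ y‖ ≤ r) :
    ‖alongGraph N W₁ y - alongGraph N W₂ y‖ ≤ (b - ℓ) / 4 * ‖W₁ y - W₂ y‖ :=
  (convex_closedBall (0 : X) r).norm_image_sub_le_of_norm_hasFDerivWithin_le
    (f := fun x => N (y, x)) (f' := fun x => (fderiv ℝ N (y, x)).comp (.inr ℝ Y X))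
    (fun x _ => ((h.contDiff.differentiable one_ne_zero (y, x)).hasFDerivAt.comp x
      (hasFDerivAt_prodMk_right y x)).hasFDerivWithinAt)
    (fun x hx => h.norm_fderiv_inr_le y x (mem_closedBall_zero_iff.mp hx))
    (mem_closedBall_zero_iff.mpr hW₂) (mem_closedBall_zero_iff.mpr hW₁)

lemma norm_fderiv_comp_inr_comp_le (h : IsSmallNonlinearity N b ℓ r M A) (y : Y) {x : X}
    (hx : ‖x‖ ≤ r) (S : Y →L[ℝ] X) :
    ‖(fderiv ℝ N (y, x)).comp ((ContinuousLinearMap.inr ℝ Y X).comp S)‖ ≤ (b - ℓ) / 4 * ‖S‖ :=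
  (ContinuousLinearMap.opNorm_comp_le ((fderiv ℝ N (y, x)).comp (.inr ℝ Y X)) S).trans
    (mul_le_mul_of_nonneg_right (h.norm_fderiv_inr_le y x hx) (norm_nonneg _))

lemma norm_alongGraphDeriv_le (h : IsSmallNonlinearity N b ℓ r M A) {y : Y} (hW : ‖W y‖ ≤ r) :
    ‖alongGraphDeriv N W P y‖ ≤ M + (b - ℓ) / 4 * ‖P y‖ := by
  have split_prod : alongGraphDeriv N W P y = (fderiv ℝ N (y, W y)).comp (.inl ℝ Y X) +
      (fderiv ℝ N (y, W y)).comp ((ContinuousLinearMap.inr ℝ Y X).comp (P y)) := by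
    rw [alongGraphDeriv, ← ContinuousLinearMap.comp_add]
    congr 1
    ext η <;> simp
  rw [split_prod]
  exact (norm_add_le _ _).trans
    (add_le_add (h.norm_fderiv_inl_le y _ hW) (h.norm_fderiv_comp_inr_comp_le y hW (P y)))

lemma norm_alongGraphDeriv_sub_le (h : IsSmallNonlinearity N b ℓ r M A) {y : Y}
    (hW₁ : ‖W₁ y‖ ≤ r) (hW₂ : ‖W₂ y‖ ≤ r) (hP₂ : ‖P₂ y‖ ≤ L) :
    ‖alongGraphDeriv N W₁ P₁ y - alongGraphDeriv N W₂ P₂ y‖ ≤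
      A * (1 + L) * ‖W₁ y - W₂ y‖ + (b - ℓ) / 4 * ‖P₁ y - P₂ y‖ := by
  have split_sub : alongGraphDeriv N W₁ P₁ y - alongGraphDeriv N W₂ P₂ y =
      (fderiv ℝ N (y, W₁ y) - fderiv ℝ N (y, W₂ y)).comp ((ContinuousLinearMap.id ℝ Y).prod (P₂ y))
        + (fderiv ℝ N (y, W₁ y)).comp
          ((ContinuousLinearMap.inr ℝ Y X).comp (P₁ y - P₂ y)) := by
    have prod_eq : (ContinuousLinearMap.id ℝ Y).prod (P₁ y) =
        (ContinuousLinearMap.id ℝ Y).prod (P₂ y) +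
          (ContinuousLinearMap.inr ℝ Y X).comp (P₁ y - P₂ y) := by
      ext η <;> simp
    rw [alongGraphDeriv, alongGraphDeriv, prod_eq, ContinuousLinearMap.comp_add,
      ContinuousLinearMap.sub_comp]
    abel
  have lipschitz_part : ‖fderiv ℝ N (y, W₁ y) - fderiv ℝ N (y, W₂ y)‖ ≤ A * ‖W₁ y - W₂ y‖ :=
    (h.lipschitzOnWith_fderiv y).norm_sub_le (mem_closedBall_zero_iff.mpr hW₁)
      (mem_closedBall_zero_iff.mpr hW₂)
  have norm_graph : ‖(ContinuousLinearMap.id ℝ Y).prod (P₂ y)‖ ≤ 1 + L := by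
    rw [ContinuousLinearMap.opNorm_prod]
    exact (max_le_add_of_nonneg (norm_nonneg _) (norm_nonneg _)).trans
      (add_le_add ContinuousLinearMap.norm_id_le hP₂)
  rw [split_sub, mul_right_comm]
  exact (norm_add_le _ _).trans (add_le_add ((ContinuousLinearMap.opNorm_comp_le _ _).trans
    (mul_le_mul lipschitz_part norm_graph (norm_nonneg _) (by positivity)))
    (h.norm_fderiv_comp_inr_comp_le y hW₁ _))

end IsSmallNonlinearity

open scoped BoundedContinuousFunction

/-- Pairs of a function bounded by `r` and `κ` times its derivative, the derivative being bounded by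
`L`. The weight `κ` makes the Lyapunov–Perron map a contraction for the maximum of the two norms. -/
def c1Pairs (X Y : Type*) [NormedAddCommGroup X] [NormedSpace ℝ X] [NormedAddCommGroup Y]
    [NormedSpace ℝ Y] (r L κ : ℝ) : Set ((Y →ᵇ X) × (Y →ᵇ (Y →L[ℝ] X))) :=
  {z | (∀ y, ‖z.1 y‖ ≤ r) ∧ (∀ y, ‖κ⁻¹ • z.2 y‖ ≤ L) ∧ ∀ y, HasFDerivAt z.1 (κ⁻¹ • z.2 y) y}

set_option synthInstance.maxHeartbeats 200000 in
-- instance search on products of spaces of bounded continuous operator-valued functions is slow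
lemma isClosed_c1Pairs (r L κ : ℝ) : IsClosed (c1Pairs X Y r L κ) := by
  refine isSeqClosed_iff_isClosed.mp fun z z₀ hz hlim => ?_
  have tendsto_fst : TendstoUniformly (fun n y => (z n).1 y) z₀.1 Filter.atTop :=
    BoundedContinuousFunction.tendsto_iff_tendstoUniformly.mp
      ((continuous_fst.tendsto z₀).comp hlim)
  have tendsto_deriv : TendstoUniformly (fun n y => κ⁻¹ • (z n).2 y) (fun y => κ⁻¹ • z₀.2 y)
      Filter.atTop :=
    BoundedContinuousFunction.tendsto_iff_tendstoUniformly.mp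
      (((continuous_snd.tendsto z₀).comp hlim).const_smul κ⁻¹ :
        Filter.Tendsto (fun n => κ⁻¹ • (z n).2) Filter.atTop (nhds (κ⁻¹ • z₀.2)))
  refine ⟨fun y => le_of_tendsto (tendsto_fst.tendsto_at y).norm (.of_forall fun n => (hz n).1 y),
    fun y => le_of_tendsto (tendsto_deriv.tendsto_at y).norm (.of_forall fun n => (hz n).2.1 y),
    fun y => hasFDerivAt_of_tendstoUniformlyOn isOpen_univ tendsto_deriv.tendstoUniformlyOn
      (fun n x _ => (hz n).2.2 x) (fun x _ => tendsto_fst.tendsto_at x) (mem_univ y)⟩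

lemma zero_mem_c1Pairs {r L : ℝ} (hr : 0 ≤ r) (hL : 0 ≤ L) (κ : ℝ) : 0 ∈ c1Pairs X Y r L κ := by
  refine ⟨fun _ => norm_zero.trans_le hr, fun _ => ?_, fun y => ?_⟩
  · simpa using hL
  · change HasFDerivAt (fun _ : Y => (0 : X)) (κ⁻¹ • (0 : Y →L[ℝ] X)) y
    rw [smul_zero]
    exact hasFDerivAt_const 0 y

variable {N : Y × X → X} {r M L κ : ℝ} {A : NNReal} {W W₁ W₂ : Y → X}
  {P P₁ P₂ : Y → Y →L[ℝ] X} {z z₁ z₂ w₁ w₂ : (Y →ᵇ X) × (Y →ᵇ (Y →L[ℝ] X))}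

/-- `w` is the image of `z` under the Lyapunov–Perron map, which acts on a pair (function,
derivative) by the Duhamel integral and its derivative. -/
structure IsLyapunovPerronStep (K : ℝ → X →L[ℝ] X) (E : ℝ → Y →L[ℝ] Y) (N : Y × X → X) (κ : ℝ)
    (z w : (Y →ᵇ X) × (Y →ᵇ (Y →L[ℝ] X))) : Prop where
  fst_eq : ∀ v, w.1 v = duhamel K E (alongGraph N z.1) v
  snd_eq : ∀ v, w.2 v = κ • duhamelDeriv K E (alongGraphDeriv N z.1 fun y => κ⁻¹ • z.2 y) v

namespace IsSmallNonlinearity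

lemma norm_alongGraphDeriv_le_mul (h : IsSmallNonlinearity N b ℓ r M A) (hbℓ : ℓ ≤ b)
    (hL : M + (b - ℓ) / 4 * L ≤ L * (b - ℓ)) {y : Y} (hW : ‖W y‖ ≤ r) (hP : ‖P y‖ ≤ L) :
    ‖alongGraphDeriv N W P y‖ ≤ L * (b - ℓ) := by
  refine (h.norm_alongGraphDeriv_le hW).trans (le_trans ?_ hL)
  gcongr

lemma norm_duhamel_alongGraph_sub_le (hN : IsSmallNonlinearity N b ℓ r M A)
    (h : IsDichotomy K E b ℓ) (continuous_W₁ : Continuous W₁) (continuous_W₂ : Continuous W₂)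
    (hW₁ : ∀ y, ‖W₁ y‖ ≤ r) (hW₂ : ∀ y, ‖W₂ y‖ ≤ r) {d : ℝ} (hd : ∀ y, ‖W₁ y - W₂ y‖ ≤ d) (v : Y) :
    ‖duhamel K E (alongGraph N W₁) v - duhamel K E (alongGraph N W₂) v‖ ≤ 1 / 2 * d := by
  have norm_source_sub_le : ∀ y, ‖alongGraph N W₁ y - alongGraph N W₂ y‖ ≤ b / 2 * d := fun y =>
    (hN.norm_alongGraph_sub_le (hW₁ y) (hW₂ y)).trans
      (mul_le_mul (by linarith [h.nonneg, h.pos]) (hd y) (norm_nonneg _) (half_pos h.pos).le)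
  refine (h.norm_duhamel_sub_le (hN.continuous_alongGraph continuous_W₁)
    (hN.continuous_alongGraph continuous_W₂) (fun y => hN.norm_le y _ (hW₁ y))
    (fun y => hN.norm_le y _ (hW₂ y)) norm_source_sub_le v).trans_eq ?_
  have := h.pos.ne'
  field_simp

variable [FiniteDimensional ℝ Y]

lemma exists_lyapunovPerronStep (hN : IsSmallNonlinearity N b ℓ r M A) (h : IsDichotomy K E b ℓ)
    (hL : M + (b - ℓ) / 4 * L ≤ L * (b - ℓ)) (hκ : κ ≠ 0) (hz : z ∈ c1Pairs X Y r L κ) :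
    ∃ w ∈ c1Pairs X Y r L κ, IsLyapunovPerronStep K E N κ z w := by
  set G := alongGraph N z.1
  set G' := alongGraphDeriv N z.1 fun y => κ⁻¹ • z.2 y
  have norm_G_le : ∀ y, ‖G y‖ ≤ b * r := fun y => hN.norm_le y _ (hz.1 y)
  have norm_G'_le : ∀ y, ‖G' y‖ ≤ L * (b - ℓ) := fun y =>
    hN.norm_alongGraphDeriv_le_mul h.lt.le hL (hz.1 y) (hz.2.1 y)
  have continuous_G' : Continuous G' :=
    hN.continuous_alongGraphDeriv z.1.continuous (z.2.continuous.const_smul κ⁻¹)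
  have deriv_step : ∀ v, HasFDerivAt (duhamel K E G) (duhamelDeriv K E G' v) v :=
    h.hasFDerivAt_duhamel (fun y => hN.hasFDerivAt_alongGraph (hz.2.2 y)) continuous_G' norm_G_le
      norm_G'_le
  have norm_step : ∀ v, ‖duhamel K E G v‖ ≤ r := fun v =>
    (h.norm_duhamel_le norm_G_le v).trans_eq (mul_div_cancel_left₀ r h.pos.ne')
  have norm_deriv_step : ∀ v, ‖duhamelDeriv K E G' v‖ ≤ L := fun v =>
    (h.norm_duhamelDeriv_le norm_G'_le v).trans_eq (mul_div_cancel_right₀ L h.sub_pos.ne')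
  let W : Y →ᵇ X := .ofNormedAddCommGroup (duhamel K E G)
    (continuous_iff_continuousAt.mpr fun v => (deriv_step v).continuousAt) r norm_step
  let P : Y →ᵇ (Y →L[ℝ] X) := .ofNormedAddCommGroup (fun v => κ • duhamelDeriv K E G' v)
    ((h.continuous_duhamelDeriv continuous_G' norm_G'_le).const_smul κ) (‖κ‖ * L) fun v => by
      rw [norm_smul]
      exact mul_le_mul_of_nonneg_left (norm_deriv_step v) (norm_nonneg _)
  have inv_smul_P : ∀ v, κ⁻¹ • P v = duhamelDeriv K E G' v := fun v => inv_smul_smul₀ hκ _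
  exact ⟨(W, P), ⟨norm_step, fun v => (inv_smul_P v).symm ▸ norm_deriv_step v,
    fun v => (inv_smul_P v).symm ▸ deriv_step v⟩, fun _ => rfl, fun _ => rfl⟩

lemma norm_duhamelDeriv_alongGraphDeriv_sub_le (hN : IsSmallNonlinearity N b ℓ r M A)
    (h : IsDichotomy K E b ℓ) (hL : M + (b - ℓ) / 4 * L ≤ L * (b - ℓ)) (hL₀ : 0 ≤ L)
    (continuous_W₁ : Continuous W₁) (continuous_W₂ : Continuous W₂) (continuous_P₁ : Continuous P₁)
    (continuous_P₂ : Continuous P₂) (hW₁ : ∀ y, ‖W₁ y‖ ≤ r) (hW₂ : ∀ y, ‖W₂ y‖ ≤ r)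
    (hP₁ : ∀ y, ‖P₁ y‖ ≤ L) (hP₂ : ∀ y, ‖P₂ y‖ ≤ L) {d e : ℝ} (hd : ∀ y, ‖W₁ y - W₂ y‖ ≤ d)
    (he : ∀ y, ‖P₁ y - P₂ y‖ ≤ e) (hA : A * (1 + L) * d ≤ (b - ℓ) / 4 * e) (v : Y) :
    ‖duhamelDeriv K E (alongGraphDeriv N W₁ P₁) v - duhamelDeriv K E (alongGraphDeriv N W₂ P₂) v‖ ≤
      1 / 2 * e := by
  have gap_pos := h.sub_pos
  have norm_source_sub_le : ∀ y, ‖alongGraphDeriv N W₁ P₁ y - alongGraphDeriv N W₂ P₂ y‖ ≤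
      (b - ℓ) / 2 * e := fun y =>
    calc ‖alongGraphDeriv N W₁ P₁ y - alongGraphDeriv N W₂ P₂ y‖
        ≤ A * (1 + L) * ‖W₁ y - W₂ y‖ + (b - ℓ) / 4 * ‖P₁ y - P₂ y‖ :=
          hN.norm_alongGraphDeriv_sub_le (hW₁ y) (hW₂ y) (hP₂ y)
      _ ≤ A * (1 + L) * d + (b - ℓ) / 4 * e :=
          add_le_add (mul_le_mul_of_nonneg_left (hd y) (by positivity))
            (mul_le_mul_of_nonneg_left (he y) (by positivity))
      _ ≤ (b - ℓ) / 2 * e := by linarith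
  refine (h.norm_duhamelDeriv_sub_le (hN.continuous_alongGraphDeriv continuous_W₁ continuous_P₁)
    (hN.continuous_alongGraphDeriv continuous_W₂ continuous_P₂)
    (fun y => hN.norm_alongGraphDeriv_le_mul h.lt.le hL (hW₁ y) (hP₁ y))
    (fun y => hN.norm_alongGraphDeriv_le_mul h.lt.le hL (hW₂ y) (hP₂ y))
    norm_source_sub_le v).trans_eq ?_
  field_simp

lemma dist_lyapunovPerronStep_le (hN : IsSmallNonlinearity N b ℓ r M A)
    (h : IsDichotomy K E b ℓ) (hL : M + (b - ℓ) / 4 * L ≤ L * (b - ℓ)) (hL₀ : 0 ≤ L) (hκ : 0 < κ)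
    (hκA : κ * (A * (1 + L)) ≤ (b - ℓ) / 4) (hz₁ : z₁ ∈ c1Pairs X Y r L κ)
    (hz₂ : z₂ ∈ c1Pairs X Y r L κ) (hw₁ : IsLyapunovPerronStep K E N κ z₁ w₁)
    (hw₂ : IsLyapunovPerronStep K E N κ z₂ w₂) : dist w₁ w₂ ≤ 1 / 2 * dist z₁ z₂ := by
  have dist_fst : ∀ y, ‖z₁.1 y - z₂.1 y‖ ≤ dist z₁ z₂ := fun y =>
    (dist_eq_norm _ _).symm.trans_le
      ((BoundedContinuousFunction.dist_coe_le_dist y).trans (le_max_left _ _))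
  have dist_snd : ∀ y, ‖κ⁻¹ • z₁.2 y - κ⁻¹ • z₂.2 y‖ ≤ κ⁻¹ * dist z₁ z₂ := fun y => by
    rw [← smul_sub, norm_smul, Real.norm_of_nonneg (inv_pos.mpr hκ).le, ← dist_eq_norm]
    exact mul_le_mul_of_nonneg_left ((BoundedContinuousFunction.dist_coe_le_dist y).trans
      (le_max_right _ _)) (inv_pos.mpr hκ).le
  have lipschitz_le : A * (1 + L) * dist z₁ z₂ ≤ (b - ℓ) / 4 * (κ⁻¹ * dist z₁ z₂) := by
    rw [mul_left_comm, ← mul_assoc]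
    exact mul_le_mul_of_nonneg_right ((le_inv_mul_iff₀ hκ).mpr hκA) dist_nonneg
  refine max_le ((BoundedContinuousFunction.dist_le (by positivity)).mpr fun v => ?_)
    ((BoundedContinuousFunction.dist_le (by positivity)).mpr fun v => ?_)
  · rw [hw₁.fst_eq, hw₂.fst_eq, dist_eq_norm]
    exact hN.norm_duhamel_alongGraph_sub_le h z₁.1.continuous z₂.1.continuous hz₁.1 hz₂.1 dist_fst v
  · rw [hw₁.snd_eq, hw₂.snd_eq, dist_eq_norm, ← smul_sub, norm_smul, Real.norm_of_nonneg hκ.le,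
      ← le_inv_mul_iff₀ hκ, mul_left_comm]
    exact hN.norm_duhamelDeriv_alongGraphDeriv_sub_le h hL hL₀ z₁.1.continuous z₂.1.continuous
      (z₁.2.continuous.const_smul κ⁻¹) (z₂.2.continuous.const_smul κ⁻¹) hz₁.1 hz₂.1 hz₁.2.1 hz₂.2.1
      dist_fst dist_snd lipschitz_le v

theorem exists_duhamel_fixedPoint [CompleteSpace X] (hN : IsSmallNonlinearity N b ℓ r M A)
    (h : IsDichotomy K E b ℓ) (hr : 0 ≤ r) :
    ∃ W : Y → X, ContDiff ℝ 1 W ∧ (∀ y, ‖W y‖ ≤ r) ∧ ∀ v, W v = duhamel K E (alongGraph N W) v := by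
  have gap_pos := h.sub_pos
  have M_nonneg := hN.nonneg hr
  set L := 2 * M / (b - ℓ) with L_def
  have L_nonneg : 0 ≤ L := by positivity
  have hL : M + (b - ℓ) / 4 * L ≤ L * (b - ℓ) := by
    rw [L_def]
    field_simp
    linarith
  set κ := (b - ℓ) / (4 * (A * (1 + L) + 1)) with κ_def
  have κ_pos : 0 < κ := by positivity
  have hκA : κ * (A * (1 + L)) ≤ (b - ℓ) / 4 := by
    rw [κ_def, div_mul_eq_mul_div, div_le_iff₀ (by positivity)]
    nlinarith
  have exists_step (z : c1Pairs X Y r L κ) :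
      ∃ w : c1Pairs X Y r L κ, IsLyapunovPerronStep K E N κ z.1 w.1 :=
    let ⟨w, hw, step⟩ := hN.exists_lyapunovPerronStep h hL κ_pos.ne' z.2
    ⟨⟨w, hw⟩, step⟩
  choose Φ isStep_Φ using exists_step
  have contracting : ContractingWith (1 / 2 : NNReal) Φ := by
    refine ⟨by norm_num, LipschitzWith.of_dist_le_mul fun z₁ z₂ => ?_⟩
    simpa only [NNReal.coe_div, NNReal.coe_one, NNReal.coe_ofNat] using!
      hN.dist_lyapunovPerronStep_le h hL L_nonneg κ_pos hκA z₁.2 z₂.2 (isStep_Φ z₁) (isStep_Φ z₂)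
  have : CompleteSpace (c1Pairs X Y r L κ) := (isClosed_c1Pairs r L κ).completeSpace_coe
  obtain ⟨z, Φ_z : Φ z = z, -⟩ := contracting.exists_fixedPoint
    ⟨0, zero_mem_c1Pairs hr L_nonneg κ⟩ (edist_ne_top _ _)
  have contDiff_z : ContDiff ℝ 1 z.1.1 := contDiff_one_iff_hasFDerivAt.mpr
    ⟨fun y => κ⁻¹ • z.1.2 y, z.1.2.continuous.const_smul κ⁻¹, z.2.2.2⟩
  exact ⟨z.1.1, contDiff_z, z.2.1, fun v => by simpa only [Φ_z] using (isStep_Φ z).fst_eq v⟩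

end IsSmallNonlinearity

end LyapunovPerron

section QuadraticNonlinearity

variable {X Y : Type*} [NormedAddCommGroup X] [NormedSpace ℝ X]
  {m : X →L[ℝ] X →L[ℝ] X} {F B : Y → X} {b ℓ f f' β β' r : ℝ}

/-- The nonlinearity `F(y) - b (2 B(y) x + x²)`, the product being given by the bilinear map `m`. -/
def quadraticNonlinearity (m : X →L[ℝ] X →L[ℝ] X) (F B : Y → X) (b : ℝ) (p : Y × X) : X :=
  F p.1 - b • ((2 : ℝ) • m (B p.1) p.2 + m p.2 p.2)

lemma norm_quadraticNonlinearity_le (hb : 0 ≤ b) {p : Y × X} (hf : ‖F p.1‖ ≤ f)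
    (hβ : ‖B p.1‖ ≤ β) (hr : ‖p.2‖ ≤ r) :
    ‖quadraticNonlinearity m F B b p‖ ≤ f + b * (‖m‖ * (2 * β + r)) * r := by
  have norm_cross_le : ‖m (B p.1) p.2‖ ≤ ‖m‖ * β * r := m.le_of_opNorm₂_le_of_le le_rfl hβ hr
  have norm_square_le : ‖m p.2 p.2‖ ≤ ‖m‖ * r * r := m.le_of_opNorm₂_le_of_le le_rfl hr hr
  calc ‖quadraticNonlinearity m F B b p‖
      ≤ ‖F p.1‖ + ‖b • ((2 : ℝ) • m (B p.1) p.2 + m p.2 p.2)‖ := norm_sub_le _ _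
    _ ≤ f + b * (2 * (‖m‖ * β * r) + ‖m‖ * r * r) := by
        rw [norm_smul, Real.norm_of_nonneg hb]
        refine add_le_add hf (mul_le_mul_of_nonneg_left ((norm_add_le _ _).trans ?_) hb)
        rw [norm_smul, Real.norm_two]
        gcongr
    _ = f + b * (‖m‖ * (2 * β + r)) * r := by ring

variable [NormedAddCommGroup Y] [NormedSpace ℝ Y]

lemma hasFDerivAt_quadraticNonlinearity {F' B' : Y →L[ℝ] X} {p : Y × X}
    (hF : HasFDerivAt F F' p.1) (hB : HasFDerivAt B B' p.1) :
    HasFDerivAt (quadraticNonlinearity m F B b)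
      (F'.comp (.fst ℝ Y X) - b • ((2 : ℝ) • ((m (B p.1)).comp (.snd ℝ Y X) +
        (m.flip p.2).comp (B'.comp (.fst ℝ Y X))) +
        ((m p.2).comp (.snd ℝ Y X) + (m.flip p.2).comp (.snd ℝ Y X)))) p := by
  have deriv_fst : HasFDerivAt Prod.fst (ContinuousLinearMap.fst ℝ Y X) p := hasFDerivAt_fst
  have deriv_snd : HasFDerivAt Prod.snd (ContinuousLinearMap.snd ℝ Y X) p := hasFDerivAt_snd
  exact (hF.comp p deriv_fst).sub
    ((((m.hasFDerivAt_of_bilinear (hB.comp p deriv_fst) deriv_snd).const_smul (2 : ℝ)).add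
      (m.hasFDerivAt_of_bilinear deriv_snd deriv_snd)).const_smul b)

lemma contDiff_quadraticNonlinearity (hF : ContDiff ℝ 1 F) (hB : ContDiff ℝ 1 B) :
    ContDiff ℝ 1 (quadraticNonlinearity m F B b) :=
  (hF.comp contDiff_fst).sub ((((m.contDiff.comp (hB.comp contDiff_fst)).clm_apply
    contDiff_snd).const_smul (2 : ℝ)).add
      ((m.contDiff.comp contDiff_snd).clm_apply contDiff_snd) |>.const_smul b)

lemma norm_flip_apply_le (m : X →L[ℝ] X →L[ℝ] X) (x : X) : ‖m.flip x‖ ≤ ‖m‖ * ‖x‖ :=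
  (m.flip.le_opNorm x).trans_eq (by rw [m.opNorm_flip])

lemma norm_quadraticNonlinearity_fderiv_inl_le {p : Y × X} (hF : DifferentiableAt ℝ F p.1)
    (hB : DifferentiableAt ℝ B p.1) (hb : 0 ≤ b) (hf' : ‖fderiv ℝ F p.1‖ ≤ f')
    (hβ' : ‖fderiv ℝ B p.1‖ ≤ β') (hr : ‖p.2‖ ≤ r) :
    ‖(fderiv ℝ (quadraticNonlinearity m F B b) p).comp (.inl ℝ Y X)‖ ≤
      f' + b * (2 * (‖m‖ * r * β')) := by
  have fderiv_comp_inl : (fderiv ℝ (quadraticNonlinearity m F B b) p).comp (.inl ℝ Y X) =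
      fderiv ℝ F p.1 - b • (2 : ℝ) • (m.flip p.2).comp (fderiv ℝ B p.1) := by
    rw [(hasFDerivAt_quadraticNonlinearity hF.hasFDerivAt hB.hasFDerivAt).fderiv]
    ext η
    simp
  rw [fderiv_comp_inl]
  refine (norm_sub_le _ _).trans (add_le_add hf' ?_)
  rw [norm_smul, norm_smul, Real.norm_of_nonneg hb, Real.norm_two]
  have norm_flip_comp_le := (ContinuousLinearMap.opNorm_comp_le (m.flip p.2) (fderiv ℝ B p.1)).trans
    (mul_le_mul_of_nonneg_right (norm_flip_apply_le m p.2) (norm_nonneg _))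
  exact mul_le_mul_of_nonneg_left (mul_le_mul_of_nonneg_left (norm_flip_comp_le.trans
    (mul_le_mul (mul_le_mul_of_nonneg_left hr (norm_nonneg m)) hβ' (norm_nonneg _)
      (mul_nonneg (norm_nonneg m) ((norm_nonneg _).trans hr)))) zero_le_two) hb

lemma norm_quadraticNonlinearity_fderiv_inr_le {p : Y × X} (hF : DifferentiableAt ℝ F p.1)
    (hB : DifferentiableAt ℝ B p.1) (hb : 0 ≤ b) (hβ : ‖B p.1‖ ≤ β) (hr : ‖p.2‖ ≤ r) :
    ‖(fderiv ℝ (quadraticNonlinearity m F B b) p).comp (.inr ℝ Y X)‖ ≤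
      b * (‖m‖ * (2 * β + 2 * r)) := by
  have fderiv_comp_inr : (fderiv ℝ (quadraticNonlinearity m F B b) p).comp (.inr ℝ Y X) =
      -(b • ((2 : ℝ) • m (B p.1) + (m p.2 + m.flip p.2))) := by
    rw [(hasFDerivAt_quadraticNonlinearity hF.hasFDerivAt hB.hasFDerivAt).fderiv]
    ext ξ
    simp
  rw [fderiv_comp_inr, norm_neg, norm_smul, Real.norm_of_nonneg hb]
  refine mul_le_mul_of_nonneg_left ?_ hb
  calc ‖(2 : ℝ) • m (B p.1) + (m p.2 + m.flip p.2)‖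
      ≤ ‖(2 : ℝ) • m (B p.1)‖ + (‖m p.2‖ + ‖m.flip p.2‖) :=
        (norm_add_le _ _).trans (add_le_add_right (norm_add_le _ _) _)
    _ ≤ 2 * (‖m‖ * β) + (‖m‖ * r + ‖m‖ * r) := by
        rw [norm_smul, Real.norm_two]
        gcongr
        · exact m.le_opNorm_of_le hβ
        · exact m.le_opNorm_of_le hr
        · exact (norm_flip_apply_le m p.2).trans (mul_le_mul_of_nonneg_left hr (norm_nonneg m))
    _ = ‖m‖ * (2 * β + 2 * r) := by ring

lemma norm_fderiv_quadraticNonlinearity_sub_le {y : Y} (hF : DifferentiableAt ℝ F y)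
    (hB : DifferentiableAt ℝ B y) (hb : 0 ≤ b) (hβ' : ‖fderiv ℝ B y‖ ≤ β') (x₁ x₂ : X) :
    ‖fderiv ℝ (quadraticNonlinearity m F B b) (y, x₁) -
      fderiv ℝ (quadraticNonlinearity m F B b) (y, x₂)‖ ≤
        b * (‖m‖ * (2 * β' + 2)) * ‖x₁ - x₂‖ := by
  have fderiv_sub_apply (p : Y × X) : (fderiv ℝ (quadraticNonlinearity m F B b) (y, x₁) -
      fderiv ℝ (quadraticNonlinearity m F B b) (y, x₂)) p =
      -(b • ((2 : ℝ) • m (fderiv ℝ B y p.1) (x₁ - x₂) +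
        (m (x₁ - x₂) p.2 + m p.2 (x₁ - x₂)))) := by
    rw [(hasFDerivAt_quadraticNonlinearity hF.hasFDerivAt hB.hasFDerivAt).fderiv,
      (hasFDerivAt_quadraticNonlinearity hF.hasFDerivAt hB.hasFDerivAt).fderiv]
    simp only [sub_apply, add_apply, smul_apply, ContinuousLinearMap.comp_apply,
      ContinuousLinearMap.flip_apply, ContinuousLinearMap.coe_fst', ContinuousLinearMap.coe_snd',
      map_sub]
    module
  have β'_nonneg : 0 ≤ β' := (norm_nonneg _).trans hβ'
  refine ContinuousLinearMap.opNorm_le_bound _ (by positivity) fun p => ?_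
  have norm_deriv_le : ‖m (fderiv ℝ B y p.1) (x₁ - x₂)‖ ≤ ‖m‖ * (β' * ‖p‖) * ‖x₁ - x₂‖ :=
    m.le_of_opNorm₂_le_of_le le_rfl ((fderiv ℝ B y).le_of_opNorm_le_of_le hβ' (norm_fst_le p))
      le_rfl
  have norm_left_le : ‖m (x₁ - x₂) p.2‖ ≤ ‖m‖ * ‖x₁ - x₂‖ * ‖p‖ :=
    m.le_of_opNorm₂_le_of_le le_rfl le_rfl (norm_snd_le p)
  have norm_right_le : ‖m p.2 (x₁ - x₂)‖ ≤ ‖m‖ * ‖p‖ * ‖x₁ - x₂‖ :=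
    m.le_of_opNorm₂_le_of_le le_rfl (norm_snd_le p) le_rfl
  rw [fderiv_sub_apply, norm_neg, norm_smul, Real.norm_of_nonneg hb]
  calc b * ‖(2 : ℝ) • m (fderiv ℝ B y p.1) (x₁ - x₂) + (m (x₁ - x₂) p.2 + m p.2 (x₁ - x₂))‖
      ≤ b * (2 * (‖m‖ * (β' * ‖p‖) * ‖x₁ - x₂‖) +
          (‖m‖ * ‖x₁ - x₂‖ * ‖p‖ + ‖m‖ * ‖p‖ * ‖x₁ - x₂‖)) := by
        refine mul_le_mul_of_nonneg_left (norm_add_le_of_le ?_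
          (norm_add_le_of_le norm_left_le norm_right_le)) hb
        rw [norm_smul, Real.norm_two]
        exact mul_le_mul_of_nonneg_left norm_deriv_le zero_le_two
    _ = b * (‖m‖ * (2 * β' + 2)) * ‖x₁ - x₂‖ * ‖p‖ := by ring

theorem isSmallNonlinearity_quadratic (hF : ContDiff ℝ 1 F) (hB : ContDiff ℝ 1 B)
    (hf : ∀ y, ‖F y‖ ≤ f) (hβ : ∀ y, ‖B y‖ ≤ β) (hf' : ∀ y, ‖fderiv ℝ F y‖ ≤ f')
    (hβ' : ∀ y, ‖fderiv ℝ B y‖ ≤ β') (hℓ : 0 ≤ ℓ) (hb : 0 ≤ b) (hr : 0 ≤ r) (hfr : 2 * f ≤ b * r)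
    (hsmall : b * (‖m‖ * (2 * β + 2 * r)) ≤ (b - ℓ) / 4) :
    IsSmallNonlinearity (quadraticNonlinearity m F B b) b ℓ r (f' + b * (2 * (‖m‖ * r * β')))
      (b * (‖m‖ * (2 * β' + 2))).toNNReal where
  contDiff := contDiff_quadraticNonlinearity hF hB
  norm_le y x hx := by
    have coeff_le : b * (‖m‖ * (2 * β + r)) ≤ b / 2 :=
      calc b * (‖m‖ * (2 * β + r)) ≤ b * (‖m‖ * (2 * β + 2 * r)) := by
            gcongr
            linarith
        _ ≤ b / 2 := by linarith
    have := mul_le_mul_of_nonneg_right coeff_le hr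
    linarith [norm_quadraticNonlinearity_le (m := m) (p := (y, x)) hb (hf y) (hβ y) hx]
  norm_fderiv_inl_le y _ hx := norm_quadraticNonlinearity_fderiv_inl_le
    (hF.differentiable one_ne_zero y) (hB.differentiable one_ne_zero y) hb (hf' y) (hβ' y) hx
  norm_fderiv_inr_le y _ hx := (norm_quadraticNonlinearity_fderiv_inr_le
    (hF.differentiable one_ne_zero y) (hB.differentiable one_ne_zero y) hb (hβ y) hx).trans hsmall
  lipschitzOnWith_fderiv y := (LipschitzWith.of_dist_le_mul fun x₁ x₂ => by
    have β'_nonneg : 0 ≤ β' := (norm_nonneg _).trans (hβ' 0)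
    rw [dist_eq_norm, dist_eq_norm, Real.coe_toNNReal _ (by positivity)]
    exact norm_fderiv_quadraticNonlinearity_sub_le (hF.differentiable one_ne_zero y)
      (hB.differentiable one_ne_zero y) hb (hβ' y) x₁ x₂).lipschitzOnWith

end QuadraticNonlinearity

/-! ### Cutoff functions -/

lemma exists_forall_norm_fderiv_le {E F : Type*} [NormedAddCommGroup E] [NormedSpace ℝ E]
    [NormedAddCommGroup F] [NormedSpace ℝ F] {f : E → F} (hf : ContDiff ℝ 1 f)
    (hs : HasCompactSupport f) : ∃ M, ∀ v, ‖fderiv ℝ f v‖ ≤ M :=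
  (hf.continuous_fderiv one_ne_zero).bounded_above_of_compact_support (hs.fderiv ℝ)

section Bump

variable {E F : Type*} [NormedAddCommGroup E] [NormedSpace ℝ E] [HasContDiffBump E]
  [NormedAddCommGroup F] [NormedSpace ℝ F] {c : E} (χ : ContDiffBump c) {G : E → F}

lemma contDiff_bump_smul [FiniteDimensional ℝ E] {n : ℕ∞} {ρ : ℝ} (hχ : χ.rOut < ρ)
    (hG : ∀ v ∈ Metric.ball c ρ, ContDiffAt ℝ n G v) : ContDiff ℝ n fun v => χ v • G v := by
  refine contDiff_iff_contDiffAt.mpr fun v => ?_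
  by_cases hv : v ∈ Metric.ball c ρ
  · exact χ.contDiff.contDiffAt.smul (hG v hv)
  · have notMem : v ∉ tsupport χ := by
      rw [χ.tsupport_eq]
      exact fun hmem => hv (Metric.closedBall_subset_ball hχ hmem)
    refine (contDiffAt_const (c := 0)).congr_of_eventuallyEq ?_
    filter_upwards [notMem_tsupport_iff_eventuallyEq.mp notMem] with w hw
    rw [hw, Pi.zero_apply, zero_smul]

lemma norm_bump_smul_le {M : ℝ} (hM₀ : 0 ≤ M) (hM : ∀ v ∈ Metric.ball c χ.rOut, ‖G v‖ ≤ M)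
    (v : E) : ‖χ v • G v‖ ≤ M := by
  rw [norm_smul, Real.norm_of_nonneg χ.nonneg]
  by_cases hv : v ∈ Metric.ball c χ.rOut
  · exact (mul_le_of_le_one_left (norm_nonneg _) χ.le_one).trans (hM v hv)
  · rw [χ.zero_of_le_dist (not_lt.mp hv), zero_mul]
    exact hM₀

lemma exists_contDiff_eqOn_ball [FiniteDimensional ℝ E] {s r M : ℝ} (hs : 0 < s) (hsr : s < r)
    (hG : ∀ v ∈ Metric.ball c r, ContDiffAt ℝ 1 G v) (hM : ∀ v ∈ Metric.ball c r, ‖G v‖ ≤ M) :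
    ∃ g : E → F, ContDiff ℝ 1 g ∧ (∀ v, ‖g v‖ ≤ M) ∧ (∃ M', ∀ v, ‖fderiv ℝ g v‖ ≤ M') ∧
      EqOn g G (Metric.ball c s) := by
  obtain ⟨ρ, hsρ, hρr⟩ := exists_between hsr
  let χ : ContDiffBump c := ⟨s, ρ, hs, hsρ⟩
  have contDiff_g : ContDiff ℝ 1 fun v => χ v • G v := contDiff_bump_smul χ hρr hG
  refine ⟨_, contDiff_g, norm_bump_smul_le χ ?_ fun v hv =>
    hM v (Metric.ball_subset_ball hρr.le hv),
    exists_forall_norm_fderiv_le contDiff_g χ.hasCompactSupport.smul_right, fun v hv => ?_⟩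
  · exact (norm_nonneg _).trans (hM c (Metric.mem_ball_self (hs.trans hsr)))
  · exact (congrArg (· • G v) (χ.one_of_mem_closedBall (Metric.ball_subset_closedBall hv))).trans
      (one_smul ℝ _)

end Bump

/-! ### Forward and backward uniqueness -/

section Uniqueness

variable {H : Type*} [NormedAddCommGroup H] [InnerProductSpace ℝ H]

/-- `z' = A + g` on `[a, b]`, where `A = 𝒜 z` for a symmetric nonpositive operator `𝒜` and `g` is
bounded by a multiple of `z`. Only the values `A t = 𝒜 (z t)` enter, so `𝒜` may be unbounded. -/
structure IsPerturbedFlow (z A g : ℝ → H) (a b M : ℝ) : Prop where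
  hasDeriv : ∀ t ∈ Icc a b, HasDerivWithinAt z (A t + g t) (Icc a b) t
  continuousOn : ContinuousOn A (Icc a b)
  symm : ∀ s t, inner ℝ (A s) (z t) = inner ℝ (z s) (A t)
  nonpos : ∀ t, inner ℝ (A t) (z t) ≤ 0
  bound : ∀ t ∈ Icc a b, ‖g t‖ ≤ M * ‖z t‖

-- The left side is the derivative of the Dirichlet quotient `-⟪x, y⟫ / ‖y‖²` along `y' = x + g`.
-- With `w` the component of `x` orthogonal to `y`, it equals `-2 ⟪w, w + g⟫ / ‖y‖²`.
lemma dirichletQuotient_deriv_le {x y g : H} {M : ℝ} (hy : y ≠ 0) (hg : ‖g‖ ≤ M * ‖y‖) :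
    (-(2 * inner ℝ x (x + g)) * ‖y‖ ^ 2 - -inner ℝ x y * (2 * inner ℝ y (x + g))) /
      (‖y‖ ^ 2) ^ 2 ≤ M ^ 2 / 2 := by
  have normSq_pos : 0 < ‖y‖ ^ 2 := by positivity
  set q : ℝ := -inner ℝ x y / ‖y‖ ^ 2 with q_def
  set w : H := x + q • y with w_def
  have inner_w_y : inner ℝ w y = 0 := by
    rw [w_def, inner_add_left, inner_smul_left, real_inner_self_eq_norm_sq, conj_trivial, q_def]
    field_simp
    ring
  have inner_w_x : inner ℝ w (x + g) = ‖w‖ ^ 2 + inner ℝ w g := by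
    rw [inner_add_right, ← real_inner_self_eq_norm_sq]
    nth_rw 3 [w_def]
    rw [inner_add_right w x, inner_smul_right, inner_w_y, mul_zero, add_zero]
  have quotient_eq : (-(2 * inner ℝ x (x + g)) * ‖y‖ ^ 2 -
      -inner ℝ x y * (2 * inner ℝ y (x + g))) / (‖y‖ ^ 2) ^ 2 =
      -2 * inner ℝ w (x + g) / ‖y‖ ^ 2 := by
    rw [w_def, inner_add_left, inner_smul_left, conj_trivial, q_def]
    field_simp
    ring
  have inner_w_g : -(‖w‖ * ‖g‖) ≤ inner ℝ w g := (abs_le.mp (abs_real_inner_le_norm _ _)).1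
  have normSq_g : ‖g‖ ^ 2 ≤ M ^ 2 * ‖y‖ ^ 2 :=
    (pow_le_pow_left₀ (norm_nonneg g) hg 2).trans_eq (mul_pow _ _ 2)
  rw [quotient_eq, inner_w_x, div_le_iff₀ normSq_pos]
  nlinarith [sq_nonneg (2 * ‖w‖ - ‖g‖)]

namespace IsPerturbedFlow

variable {z A g : ℝ → H} {a b M : ℝ}

lemma restrict (h : IsPerturbedFlow z A g a b M) {c : ℝ} (hc : c ≤ b) :
    IsPerturbedFlow z A g a c M where
  hasDeriv t ht := (h.hasDeriv t (Icc_subset_Icc_right hc ht)).mono (Icc_subset_Icc_right hc)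
  continuousOn := h.continuousOn.mono (Icc_subset_Icc_right hc)
  symm := h.symm
  nonpos := h.nonpos
  bound t ht := h.bound t (Icc_subset_Icc_right hc ht)

lemma continuousOn_left (h : IsPerturbedFlow z A g a b M) : ContinuousOn z (Icc a b) :=
  fun t ht => (h.hasDeriv t ht).continuousWithinAt

-- The derivative of `A` is not needed: by symmetry the difference quotient of `⟪A, z⟫` is the inner
-- product of `A s + A t` with the difference quotient of `z`.
lemma hasDerivWithinAt_energy (h : IsPerturbedFlow z A g a b M) {t : ℝ} (ht : t ∈ Icc a b) :
    HasDerivWithinAt (fun s => -inner ℝ (A s) (z s)) (-(2 * inner ℝ (A t) (A t + g t)))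
      (Icc a b) t := by
  have slope_tendsto := hasDerivWithinAt_iff_tendsto_slope.mp (h.hasDeriv t ht)
  have sum_tendsto : Filter.Tendsto (fun s => A s + A t) (nhdsWithin t (Icc a b \ {t}))
      (nhds (A t + A t)) :=
    (((h.continuousOn t ht).mono sdiff_subset).tendsto).add_const _
  have deriv_eq : -(2 * inner ℝ (A t) (A t + g t)) = -inner ℝ (A t + A t) (A t + g t) := by
    rw [inner_add_left (A t) (A t), two_mul]
  rw [hasDerivWithinAt_iff_tendsto_slope, deriv_eq]
  refine (sum_tendsto.inner (𝕜 := ℝ) slope_tendsto).neg.congr fun s => ?_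
  rw [slope_def_module, slope_def_module, inner_smul_right, smul_eq_mul, inner_sub_right,
    inner_add_left, inner_add_left, h.symm s t, real_inner_comm (A t) (z s)]
  ring

lemma abs_inner_le (h : IsPerturbedFlow z A g a b M) {t : ℝ} (ht : t ∈ Icc a b) :
    |inner ℝ (z t) (g t)| ≤ M * ‖z t‖ ^ 2 :=
  (abs_real_inner_le_norm _ _).trans
    ((mul_le_mul_of_nonneg_left (h.bound t ht) (norm_nonneg _)).trans_eq (by ring))

lemma hasDerivWithinAt_exp_mul_normSq (h : IsPerturbedFlow z A g a b M) (c : ℝ) {t : ℝ}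
    (ht : t ∈ Icc a b) :
    HasDerivWithinAt (fun s => Real.exp (c * s) * ‖z s‖ ^ 2)
      (Real.exp (c * t) * (c * ‖z t‖ ^ 2 + 2 * (inner ℝ (A t) (z t) + inner ℝ (z t) (g t))))
      (Icc a b) t := by
  have deriv_exp : HasDerivAt (fun s => Real.exp (c * s)) (Real.exp (c * t) * c) t := by
    simpa only [id_eq, mul_one] using ((hasDerivAt_id t).const_mul c).exp
  refine (deriv_exp.hasDerivWithinAt.mul (h.hasDeriv t ht).norm_sq).congr_deriv ?_
  rw [inner_add_right, real_inner_comm (z t) (A t)]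
  ring

lemma eq_zero_of_left_eq_zero (h : IsPerturbedFlow z A g a b M) (ha : z a = 0) :
    ∀ t ∈ Icc a b, z t = 0 := by
  have antitone : AntitoneOn (fun s => Real.exp (-(2 * M) * s) * ‖z s‖ ^ 2) (Icc a b) := by
    refine antitoneOn_of_hasDerivWithinAt_nonpos (convex_Icc a b)
      (fun t ht => (h.hasDerivWithinAt_exp_mul_normSq _ ht).continuousWithinAt)
      (fun t ht => (h.hasDerivWithinAt_exp_mul_normSq _ (interior_subset ht)).mono interior_subset)
      fun t ht => mul_nonpos_of_nonneg_of_nonpos (Real.exp_pos _).le ?_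
    linarith [h.nonpos t, (abs_le.mp (h.abs_inner_le (interior_subset ht))).2]
  intro t ht
  have weighted_le := antitone (left_mem_Icc.mpr (ht.1.trans ht.2)) ht ht.1
  simp only [ha, norm_zero, ne_eq, OfNat.ofNat_ne_zero, not_false_eq_true, zero_pow, mul_zero]
    at weighted_le
  by_contra hz
  have : 0 < Real.exp (-(2 * M) * t) * ‖z t‖ ^ 2 := by positivity
  exact this.not_ge weighted_le

lemma antitoneOn_dirichletQuotient (h : IsPerturbedFlow z A g a b M)
    (hz : ∀ t ∈ Ico a b, z t ≠ 0) :
    AntitoneOn (fun t => -inner ℝ (A t) (z t) / ‖z t‖ ^ 2 - M ^ 2 / 2 * t) (Ico a b) := by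
  have deriv_quotient (t : ℝ) (ht : t ∈ Ico a b) :=
    ((h.hasDerivWithinAt_energy (Ico_subset_Icc_self ht)).fun_div
      (h.hasDeriv t (Ico_subset_Icc_self ht)).norm_sq (pow_ne_zero 2 (norm_ne_zero_iff.mpr
        (hz t ht)))).fun_sub ((hasDerivAt_id' t).const_mul (M ^ 2 / 2)).hasDerivWithinAt
  refine antitoneOn_of_hasDerivWithinAt_nonpos (convex_Ico a b)
    (fun t ht => (deriv_quotient t ht).continuousWithinAt.mono Ico_subset_Icc_self)
    (fun t ht => (deriv_quotient t (interior_subset ht)).mono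
      (interior_subset.trans Ico_subset_Icc_self)) fun t ht => ?_
  rw [mul_one]
  exact sub_nonpos.mpr (dirichletQuotient_deriv_le (hz t (interior_subset ht))
    (h.bound t (Ico_subset_Icc_self (interior_subset ht))))

lemma left_eq_zero_of_energy_le (h : IsPerturbedFlow z A g a b M) (hab : a ≤ b) {k : ℝ}
    (hk : ∀ t ∈ Ioo a b, -inner ℝ (A t) (z t) ≤ k * ‖z t‖ ^ 2) (hb : z b = 0) : z a = 0 := by
  have monotone : MonotoneOn (fun s => Real.exp (2 * (k + M) * s) * ‖z s‖ ^ 2) (Icc a b) := by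
    refine monotoneOn_of_hasDerivWithinAt_nonneg (convex_Icc a b)
      (fun t ht => (h.hasDerivWithinAt_exp_mul_normSq _ ht).continuousWithinAt)
      (fun t ht => (h.hasDerivWithinAt_exp_mul_normSq _ (interior_subset ht)).mono interior_subset)
      fun t ht => mul_nonneg (Real.exp_pos _).le ?_
    rw [interior_Icc] at ht
    linarith [hk t ht, (abs_le.mp (h.abs_inner_le (Ioo_subset_Icc_self ht))).1]
  have weighted_le := monotone (left_mem_Icc.mpr hab) (right_mem_Icc.mpr hab) hab
  simp only [hb, norm_zero, ne_eq, OfNat.ofNat_ne_zero, not_false_eq_true, zero_pow, mul_zero]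
    at weighted_le
  by_contra ha
  have : 0 < Real.exp (2 * (k + M) * a) * ‖z a‖ ^ 2 := by positivity
  exact this.not_ge weighted_le

-- Before the first zero the Dirichlet quotient is bounded, so `z` cannot decay faster than
-- exponentially.
lemma left_eq_zero_of_right_eq_zero (h : IsPerturbedFlow z A g a b M) (hab : a ≤ b)
    (hb : z b = 0) : z a = 0 := by
  have isCompact_zeros : IsCompact (Icc a b ∩ z ⁻¹' {0}) :=
    isCompact_Icc.of_isClosed_subset
      (h.continuousOn_left.preimage_isClosed_of_isClosed isClosed_Icc isClosed_singleton)
      inter_subset_left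
  obtain ⟨c, ⟨hc, z_c : z c = 0⟩, least⟩ :=
    isCompact_zeros.exists_isLeast ⟨b, right_mem_Icc.mpr hab, hb⟩
  rcases hc.1.eq_or_lt with rfl | hac
  · exact z_c
  have ne_zero : ∀ t ∈ Ico a c, z t ≠ 0 := fun t ht z_t =>
    (least ⟨⟨ht.1, ht.2.le.trans hc.2⟩, z_t⟩).not_gt ht.2
  refine (h.restrict hc.2).left_eq_zero_of_energy_le hac.le
    (k := -inner ℝ (A a) (z a) / ‖z a‖ ^ 2 - M ^ 2 / 2 * a + M ^ 2 / 2 * c) (fun t ht => ?_) z_c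
  have quotient_le := (h.restrict hc.2).antitoneOn_dirichletQuotient ne_zero
    (left_mem_Ico.mpr hac) (Ioo_subset_Ico_self ht) ht.1.le
  have z_t := ne_zero t (Ioo_subset_Ico_self ht)
  have := mul_le_mul_of_nonneg_left ht.2.le (show 0 ≤ M ^ 2 / 2 by positivity)
  rw [← div_le_iff₀ (by positivity)]
  linarith

end IsPerturbedFlow

end Uniqueness

/-! ### The spaces `L²(𝕋)` and `H²(𝕋)` -/

/-- The Hilbert space `ℓ²(ℤ; ℂ)` of Fourier coefficients. -/
abbrev EllTwo : Type := lp (fun _ : ℤ => ℂ) 2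

/-- The normalized Haar measure on the torus. -/
abbrev haar : Measure Torus := AddCircle.haarAddCircle (T := 2 * Real.pi)

/-- The square summable sequences with `a (-k) = star (a k)`, which are the sequences of Fourier
coefficients of the real functions in `L²(𝕋)`. -/
def hermitian : Submodule ℝ EllTwo where
  carrier := {a | ∀ k, a (-k) = star (a k)}
  add_mem' {a b} ha hb k := by
    rw [lp.coeFn_add, Pi.add_apply, ha k, hb k, Pi.add_apply, star_add]
  zero_mem' _ := (star_zero ℂ).symm
  smul_mem' c a ha k := by
    change c • a (-k) = star (c • a k)
    rw [ha k]
    simp only [Complex.real_smul, star_mul', RCLike.star_def, Complex.conj_ofReal]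

lemma coeff_neg (f : Torus → ℝ) (k : ℤ) : coeff f (-k) = star (coeff f k) := by
  have := fourierCoeff_star (fun x => (f x : ℂ)) (-k)
  rw [neg_neg] at this
  simp only [RCLike.star_def, Complex.conj_ofReal] at this
  exact this

/-- The inclusion of real into complex square integrable functions. -/
def complexify : L2 →ₗᵢ[ℝ] Lp ℂ 2 haar where
  toLinearMap := (Complex.ofRealCLM.compLpL 2 haar).toLinearMap
  norm_map' f := by
    refine congrArg ENNReal.toReal (eLpNorm_congr_norm_ae ?_)
    filter_upwards [Complex.ofRealCLM.coeFn_compLpL (𝕜' := ℝ) f] with x hx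
    simp [hx]

lemma fourierCoeff_complexify (f : L2) (k : ℤ) : fourierCoeff (complexify f) k = coeff f k :=
  congrFun (fourierCoeff_congr_ae (Complex.ofRealCLM.coeFn_compLpL (𝕜' := ℝ) f)) k

/-- The isometry taking a real square integrable function to its Fourier coefficients. -/
def coeffL2 : L2 →ₗᵢ[ℝ] EllTwo where
  toFun f := fourierBasis.repr (complexify f)
  map_add' f g := by rw [map_add, map_add]
  map_smul' c f := by
    have coe_smul : c • complexify f = (c : ℂ) • complexify f := (Complex.coe_smul c _).symm
    rw [map_smul, RingHom.id_apply, coe_smul, map_smul]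
    exact Complex.coe_smul c _
  norm_map' f := (fourierBasis.repr.norm_map _).trans (complexify.norm_map f)

lemma coeffL2_apply (f : L2) (k : ℤ) : coeffL2 f k = coeff f k := by
  rw [← fourierCoeff_complexify, ← fourierBasis_repr]
  rfl

lemma exists_coeffL2_eq {a : EllTwo} (ha : a ∈ hermitian) : ∃ f : L2, coeffL2 f = a := by
  set F : Lp ℂ 2 haar := fourierBasis.repr.symm a with hF
  have coeff_F (k : ℤ) : fourierCoeff F k = a k := by
    rw [← fourierBasis_repr, hF, LinearIsometryEquiv.apply_symm_apply]
  have re_ae : Complex.reCLM.compLpL 2 haar F =ᵐ[haar] fun x => (F x).re :=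
    Complex.reCLM.coeFn_compLpL (𝕜' := ℝ) F
  refine ⟨Complex.reCLM.compLpL 2 haar F, ?_⟩
  ext k
  rw [coeffL2_apply, coeff, fourierCoeff_congr_ae (re_ae.mono fun x hx => congrArg _ hx),
    fourierCoeff_ofReal_re ((Lp.memLp F).integrable one_le_two), coeff_F, coeff_F, ha k, star_star,
    add_self_div_two]

lemma range_coeffL2 : LinearMap.range coeffL2.toLinearMap = hermitian := by
  refine le_antisymm ?_ fun a ha => exists_coeffL2_eq ha
  rintro - ⟨f, rfl⟩ k
  exact (coeffL2_apply f (-k)).trans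
    ((coeff_neg f k).trans (congrArg star (coeffL2_apply f k).symm))

lemma weightedCoeff_apply (u : H2) (k : ℤ) :
    weightedCoeff u k = ((1 + (k : ℝ) ^ 2 : ℝ) : ℂ) * coeff (toCont u) k := rfl

lemma weight_pos (k : ℤ) : (0 : ℝ) < 1 + (k : ℝ) ^ 2 := by positivity

lemma weight_ne_zero (k : ℤ) : ((1 + (k : ℝ) ^ 2 : ℝ) : ℂ) ≠ 0 :=
  Complex.ofReal_ne_zero.mpr (weight_pos k).ne'

lemma norm_weightedCoeff (u : H2) : ‖weightedCoeff u‖ = ‖u‖ := rfl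

lemma norm_weightedCoeff_apply (u : H2) (k : ℤ) :
    ‖weightedCoeff u k‖ = (1 + (k : ℝ) ^ 2) * ‖coeff (toCont u) k‖ := by
  rw [weightedCoeff_apply, norm_mul, Complex.norm_real, Real.norm_of_nonneg (weight_pos k).le]

lemma coeff_injective {u v : H2} (h : ∀ k, coeff (toCont u) k = coeff (toCont v) k) : u = v := by
  apply weightedCoeff_injective
  ext k
  rw [weightedCoeff_apply, weightedCoeff_apply, h k]

/-- `weightedCoeff` as a linear isometry. -/
def weightedIsometry : H2 →ₗᵢ[ℝ] EllTwo := ⟨weightedCoeff, norm_weightedCoeff⟩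

lemma summable_inv_weight_sq : Summable fun k : ℤ => ((1 + (k : ℝ) ^ 2)⁻¹) ^ 2 := by
  refine (Real.summable_one_div_int_pow.mpr one_lt_two).of_norm_bounded_eventually ?_
  filter_upwards [(finite_singleton (0 : ℤ)).compl_mem_cofinite] with k hk
  have sq_pos : 0 < (k : ℝ) ^ 2 := by
    have : (k : ℝ) ≠ 0 := Int.cast_ne_zero.mpr hk
    positivity
  rw [Real.norm_of_nonneg (by positivity), inv_pow, one_div]
  exact inv_anti₀ sq_pos (by nlinarith)

lemma summable_inv_weight_mul_norm (a : EllTwo) :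
    Summable fun k : ℤ => (1 + (k : ℝ) ^ 2)⁻¹ * ‖a k‖ :=
  summable_mul_norm_lp_two (fun k => (inv_pos.mpr (weight_pos k)).le) summable_inv_weight_sq a

lemma exists_weightedCoeff_eq {a : EllTwo} (ha : a ∈ hermitian) :
    ∃ u : H2, weightedCoeff u = a := by
  set c : ℤ → ℂ := fun k => ((1 + (k : ℝ) ^ 2 : ℝ) : ℂ)⁻¹ * a k with hc
  have summable_c : Summable c := by
    refine .of_norm ((summable_inv_weight_mul_norm a).congr fun k => ?_)
    rw [hc, norm_mul, norm_inv, Complex.norm_real, Real.norm_of_nonneg (weight_pos k).le]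
  have star_c (k : ℤ) : star (c (-k)) = c k := by
    simp only [hc, star_mul', ha k, Int.cast_neg, neg_sq, RCLike.star_def, map_inv₀,
      Complex.conj_ofReal, Complex.conj_conj]
  set F : C(Torus, ℂ) := ∑' k, c k • fourier k
  let f : C(Torus, ℝ) := ⟨fun x => (F x).re, Complex.continuous_re.comp F.continuous⟩
  have coeff_f (k : ℤ) : coeff f k = c k :=
    calc coeff f k = (fourierCoeff F k + star (fourierCoeff F (-k))) / 2 :=
          fourierCoeff_ofReal_re (F.continuous.integrable_of_hasCompactSupport
            (HasCompactSupport.of_compactSpace _)) k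
      _ = c k := by
          rw [fourierCoeff_tsum_smul_fourier summable_c, fourierCoeff_tsum_smul_fourier summable_c,
            star_c, add_self_div_two]
  have weighted_f : weighted f = a := by
    funext k
    rw [weighted, coeff_f, hc, mul_inv_cancel_left₀ (weight_ne_zero k)]
  exact ⟨⟨f, show Memℓp (weighted f) 2 from weighted_f ▸ a.2⟩, Subtype.ext weighted_f⟩

lemma range_weightedIsometry : LinearMap.range weightedIsometry.toLinearMap = hermitian := by
  refine le_antisymm ?_ fun a ha => exists_weightedCoeff_eq ha
  rintro - ⟨u, rfl⟩ k
  change weightedCoeff u (-k) = star (weightedCoeff u k)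
  rw [weightedCoeff_apply, weightedCoeff_apply, coeff_neg, star_mul', Int.cast_neg, neg_sq,
    RCLike.star_def, Complex.conj_ofReal]

/-- The real functions in `L²(𝕋)` correspond to the Hermitian sequences. -/
def coeffEquiv : L2 ≃ₗᵢ[ℝ] hermitian :=
  coeffL2.equivRange.trans (.ofEq _ _ range_coeffL2)

lemma coe_coeffEquiv (f : L2) : (coeffEquiv f : EllTwo) = coeffL2 f := rfl

/-- `weightedCoeff` as an isometry of `H²(𝕋)` onto the Hermitian sequences. -/
def weightedEquiv : H2 ≃ₗᵢ[ℝ] hermitian :=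
  weightedIsometry.equivRange.trans (.ofEq _ _ range_weightedIsometry)

lemma coe_weightedEquiv (u : H2) : (weightedEquiv u : EllTwo) = weightedCoeff u := rfl

/-- `1 - Δ` as an isometry of `H²(𝕋)` onto `L²(𝕋)`. -/
def oneSubLap : H2 ≃ₗᵢ[ℝ] L2 := weightedEquiv.trans coeffEquiv.symm

lemma coeffL2_oneSubLap (u : H2) : coeffL2 (oneSubLap u) = weightedCoeff u := by
  rw [← coe_coeffEquiv, ← coe_weightedEquiv]
  exact congrArg Subtype.val (coeffEquiv.apply_symm_apply _)

instance : CompleteSpace H2 :=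
  (completeSpace_congr (e := oneSubLap.toEquiv) oneSubLap.isometry.isUniformEmbedding).mpr
    inferInstance

/-- The norm `∑ |û(k)|` of the Wiener algebra. -/
def wienerNorm (u : H2) : ℝ := ∑' k : ℤ, ‖coeff (toCont u) k‖

/-- The constant of the embedding of `H²` into the Wiener algebra. -/
def embConst : ℝ := √(∑' k : ℤ, ((1 + (k : ℝ) ^ 2)⁻¹) ^ 2)

lemma norm_coeff_eq (u : H2) (k : ℤ) :
    ‖coeff (toCont u) k‖ = (1 + (k : ℝ) ^ 2)⁻¹ * ‖weightedCoeff u k‖ := by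
  rw [norm_weightedCoeff_apply, inv_mul_cancel_left₀ (weight_pos k).ne']

lemma summable_norm_coeff (u : H2) : Summable fun k : ℤ => ‖coeff (toCont u) k‖ := by
  simpa only [norm_coeff_eq] using summable_inv_weight_mul_norm (weightedCoeff u)

lemma wienerNorm_nonneg (u : H2) : 0 ≤ wienerNorm u := tsum_nonneg fun _ => norm_nonneg _

lemma wienerNorm_le (u : H2) : wienerNorm u ≤ embConst * ‖u‖ := by
  simp only [wienerNorm, norm_coeff_eq]
  exact tsum_mul_norm_lp_two_le (fun k => (inv_pos.mpr (weight_pos k)).le) summable_inv_weight_sq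
    (weightedCoeff u)

/-- The inclusion of real into complex continuous functions. -/
def toComplex (f : C(Torus, ℝ)) : C(Torus, ℂ) :=
  ⟨fun x => ((f x : ℝ) : ℂ), Complex.continuous_ofReal.comp f.continuous⟩

lemma fourierCoeff_toComplex (f : C(Torus, ℝ)) (k : ℤ) :
    fourierCoeff (toComplex f) k = coeff f k := rfl

lemma hasSum_coeff_smul_fourier (u : H2) :
    HasSum (fun k => coeff (toCont u) k • fourier k) (toComplex (toCont u)) :=
  hasSum_fourier_series_of_summable (f := toComplex (toCont u)) (summable_norm_coeff u).of_norm

lemma norm_toCont_le_wienerNorm (u : H2) : ‖toCont u‖ ≤ wienerNorm u := by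
  have norm_toComplex : ‖toComplex (toCont u)‖ ≤ wienerNorm u :=
    (hasSum_coeff_smul_fourier u).norm_le_of_bounded (summable_norm_coeff u).hasSum fun k => by
      rw [norm_smul, fourier_norm, mul_one]
  refine (ContinuousMap.norm_le _ (wienerNorm_nonneg u)).mpr fun x => ?_
  rw [← Complex.norm_real]
  exact ((toComplex (toCont u)).norm_coe_le_norm x).trans norm_toComplex

/-- `toCont` as a continuous linear map. -/
def toContL : H2 →L[ℝ] C(Torus, ℝ) :=
  toCont.mkContinuous embConst fun u => (norm_toCont_le_wienerNorm u).trans (wienerNorm_le u)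

/-- `toL2` as a continuous linear map. -/
def toL2L : C(Torus, ℝ) →L[ℝ] L2 := ContinuousMap.toLp 2 haar ℝ

lemma coeff_toL2 (f : C(Torus, ℝ)) (k : ℤ) : coeff (toL2 f) k = coeff f k :=
  congrFun (fourierCoeff_congr_ae ((ContinuousMap.coeFn_toLp haar f).mono
    fun _ hx => congrArg _ hx)) k

/-- The embedding of `H²` into `L²`. -/
def embL2 : H2 →L[ℝ] L2 := toL2L.comp toContL

lemma embL2_apply (u : H2) : embL2 u = toL2 (toCont u) := rfl

lemma coeffL2_embL2 (u : H2) (k : ℤ) : coeffL2 (embL2 u) k = coeff (toCont u) k := by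
  rw [coeffL2_apply, embL2_apply, coeff_toL2]

lemma embL2_injective : Function.Injective embL2 := fun u v h => coeff_injective fun k => by
  rw [← coeffL2_embL2, ← coeffL2_embL2, h]

/-! ### Products in `H²(𝕋)` -/

lemma hasSum_coeff_mul (u v : H2) (k : ℤ) :
    HasSum (fun j => coeff (toCont u) j * coeff (toCont v) (k - j))
      (coeff (toCont u * toCont v) k) := by
  have toComplex_mul :
      toComplex (toCont u) * toComplex (toCont v) = toComplex (toCont u * toCont v) :=
    ContinuousMap.ext fun x => (Complex.ofReal_mul _ _).symm
  have hasSum_mul := hasSum_fourierCoeff_mul (f := toComplex (toCont u))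
    (summable_norm_coeff u).of_norm (toComplex (toCont v)) k
  rwa [toComplex_mul] at hasSum_mul

lemma weight_le (j k : ℤ) :
    1 + (k : ℝ) ^ 2 ≤ 2 * ((1 + (j : ℝ) ^ 2) + (1 + ((k - j : ℤ) : ℝ) ^ 2)) := by
  push_cast
  nlinarith [sq_nonneg ((k : ℝ) - 2 * j)]

/-- The sequence of absolute values of the weighted Fourier coefficients. -/
def absWeightedCoeff (u : H2) : lp (fun _ : ℤ => ℝ) 2 :=
  ⟨fun k => ‖weightedCoeff u k‖, memℓp_two_of_norm_le (weightedCoeff u) fun _ => (norm_norm _).le⟩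

lemma absWeightedCoeff_apply (u : H2) (k : ℤ) :
    absWeightedCoeff u k = (1 + (k : ℝ) ^ 2) * ‖coeff (toCont u) k‖ :=
  norm_weightedCoeff_apply u k

lemma norm_absWeightedCoeff_le (u : H2) : ‖absWeightedCoeff u‖ ≤ ‖u‖ :=
  norm_lp_two_le_of_norm_le (b := weightedCoeff u) fun _ => (norm_norm _).le

/-- The weight `1 + k²` is at most twice the sum of the weights at `j` and `k - j`, which bounds
the weighted coefficients of a product by two convolutions `ℓ¹ * ℓ²`. -/
lemma exists_weighted_mul_le (u v : H2) :
    ∃ G : lp (fun _ : ℤ => ℝ) 2, (∀ k, ‖weighted (toCont u * toCont v) k‖ ≤ ‖G k‖) ∧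
      ‖G‖ ≤ 2 * (wienerNorm u * ‖v‖ + wienerNorm v * ‖u‖) := by
  have convolution (u v : H2) : ∃ A : lp (fun _ : ℤ => ℝ) 2, ‖A‖ ≤ wienerNorm u * ‖v‖ ∧
      ∀ k, HasSum (fun j => ‖coeff (toCont u) j‖ * absWeightedCoeff v (k - j)) (A k) := by
    obtain ⟨A, norm_A, hasSum_A⟩ :=
      exists_lp_two_hasSum_convolution (summable_norm_coeff u).norm (absWeightedCoeff v)
    simp only [norm_norm] at norm_A
    exact ⟨A, norm_A.trans (mul_le_mul_of_nonneg_left (norm_absWeightedCoeff_le v)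
      (wienerNorm_nonneg u)), hasSum_A⟩
  obtain ⟨A, norm_A, hasSum_A⟩ := convolution u v
  obtain ⟨B, norm_B, hasSum_B⟩ := convolution v u
  refine ⟨(2 : ℝ) • (A + B), fun k => ?_, ?_⟩
  · refine le_trans ?_ (le_abs_self (2 * (A k + B k)))
    refine ((hasSum_coeff_mul u v k).mul_left _).norm_le_of_bounded
      (((hasSum_A k).add ((Equiv.subLeft k).hasSum_iff.mpr (hasSum_B k))).mul_left 2) fun j => ?_
    simp only [Function.comp, Equiv.subLeft_apply, sub_sub_cancel]
    rw [norm_mul, norm_mul, Complex.norm_real, Real.norm_of_nonneg (weight_pos k).le,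
      absWeightedCoeff_apply, absWeightedCoeff_apply]
    have := mul_le_mul_of_nonneg_right (weight_le j k)
      (mul_nonneg (norm_nonneg (coeff (toCont u) j)) (norm_nonneg (coeff (toCont v) (k - j))))
    linarith
  · rw [norm_smul, Real.norm_two]
    linarith [norm_add_le A B]

lemma mul_mem_h2Submodule (u v : H2) : toCont u * toCont v ∈ h2Submodule := by
  obtain ⟨G, hG, -⟩ := exists_weighted_mul_le u v
  exact memℓp_two_of_norm_le G hG

/-- The pointwise product of elements of `H²`, as a bilinear map. -/
def mulₗ : H2 →ₗ[ℝ] H2 →ₗ[ℝ] H2 :=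
  LinearMap.mk₂ ℝ (fun u v => (⟨toCont u * toCont v, mul_mem_h2Submodule u v⟩ : h2Submodule))
    (fun _ _ _ => toCont_injective (add_mul _ _ _))
    (fun _ _ _ => toCont_injective (smul_mul_assoc _ _ _))
    (fun _ _ _ => toCont_injective (mul_add _ _ _))
    (fun _ _ _ => toCont_injective (mul_smul_comm _ _ _))

lemma norm_mulₗ_le (u v : H2) :
    ‖mulₗ u v‖ ≤ 2 * (wienerNorm u * ‖v‖ + wienerNorm v * ‖u‖) := by
  obtain ⟨G, hG, norm_G⟩ := exists_weighted_mul_le u v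
  exact (norm_lp_two_le_of_norm_le (a := weightedCoeff (mulₗ u v)) hG).trans norm_G

/-- The pointwise product of elements of `H²`, as a continuous bilinear map. -/
def mul : H2 →L[ℝ] H2 →L[ℝ] H2 :=
  mulₗ.mkContinuous₂ (4 * embConst) fun u v => (norm_mulₗ_le u v).trans <| by
    linarith [mul_le_mul_of_nonneg_right (wienerNorm_le u) (norm_nonneg v),
      mul_le_mul_of_nonneg_right (wienerNorm_le v) (norm_nonneg u)]

lemma toCont_mul (u v : H2) : toCont (mul u v) = toCont u * toCont v := rfl

lemma norm_mul_le_wienerNorm (u v : H2) :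
    ‖mul u v‖ ≤ 2 * (wienerNorm u * ‖v‖ + wienerNorm v * ‖u‖) :=
  norm_mulₗ_le u v

lemma mul_swap (u v : H2) : mul u v = mul v u :=
  toCont_injective (mul_comm (toCont u) (toCont v))

/-! ### Fourier multipliers -/

/-- A symbol `m`, bounded by `M`, whose Fourier multiplier preserves real functions. -/
structure IsRealMultiplier (m : ℤ → ℂ) (M : ℝ) : Prop where
  neg : ∀ k, m (-k) = star (m k)
  norm_le : ∀ k, ‖m k‖ ≤ M

namespace IsRealMultiplier

variable {m : ℤ → ℂ} {M : ℝ}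

lemma nonneg (hm : IsRealMultiplier m M) : 0 ≤ M := (norm_nonneg _).trans (hm.norm_le 0)

lemma norm_mul_le (hm : IsRealMultiplier m M) (a : EllTwo) (k : ℤ) :
    ‖m k * a k‖ ≤ M * ‖a k‖ :=
  (norm_mul _ _).trans_le (mul_le_mul_of_nonneg_right (hm.norm_le k) (norm_nonneg _))

lemma memℓp_mul (hm : IsRealMultiplier m M) (a : EllTwo) : Memℓp (fun k => m k * a k) 2 :=
  memℓp_two_of_norm_le (M • a) fun k => (hm.norm_mul_le a k).trans <| by
    rw [lp.coeFn_smul, Pi.smul_apply, norm_smul, Real.norm_of_nonneg hm.nonneg]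

/-- The multiplication of the Hermitian sequences by a symbol. -/
def mulHermitian (hm : IsRealMultiplier m M) : hermitian →ₗ[ℝ] hermitian where
  toFun a := ⟨⟨fun k => m k * a.1 k, hm.memℓp_mul a⟩, fun k => by
    change m (-k) * a.1 (-k) = star (m k * a.1 k)
    rw [hm.neg, a.2 k, star_mul']⟩
  map_add' a b := Subtype.ext <| Subtype.ext <| funext fun k => mul_add (m k) (a.1 k) (b.1 k)
  map_smul' c a := Subtype.ext <| Subtype.ext <| funext fun k => mul_smul_comm c (m k) (a.1 k)

/-- The Fourier multiplier with symbol `m` on `H²`. -/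
def toCLM (hm : IsRealMultiplier m M) : H2 →L[ℝ] H2 :=
  LinearMap.mkContinuous (weightedEquiv.symm.toLinearMap ∘ₗ hm.mulHermitian ∘ₗ
    weightedEquiv.toLinearMap) M fun u => by
      rw [LinearMap.comp_apply]
      exact (weightedEquiv.symm.norm_map _).trans_le
        (norm_lp_two_le_mul_of_norm_le hm.nonneg (hm.norm_mul_le (weightedCoeff u)))

lemma norm_toCLM_le (hm : IsRealMultiplier m M) : ‖hm.toCLM‖ ≤ M :=
  LinearMap.mkContinuous_norm_le _ hm.nonneg _

lemma weightedCoeff_toCLM (hm : IsRealMultiplier m M) (u : H2) (k : ℤ) :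
    weightedCoeff (hm.toCLM u) k = m k * weightedCoeff u k := by
  have : weightedEquiv (hm.toCLM u) = hm.mulHermitian (weightedEquiv u) :=
    weightedEquiv.apply_symm_apply _
  rw [← coe_weightedEquiv, this]
  rfl

lemma coeff_toCLM (hm : IsRealMultiplier m M) (u : H2) (k : ℤ) :
    coeff (toCont (hm.toCLM u)) k = m k * coeff (toCont u) k := by
  have := hm.weightedCoeff_toCLM u k
  rw [weightedCoeff_apply, weightedCoeff_apply, mul_left_comm] at this
  exact mul_left_cancel₀ (weight_ne_zero k) this

end IsRealMultiplier

/-! ### The Laplacian and the heat semigroup -/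

lemma norm_le_mul_of_coeff_le {u v : H2} {M : ℝ} (hM : 0 ≤ M)
    (h : ∀ k, ‖coeff (toCont u) k‖ ≤ M * ‖coeff (toCont v) k‖) : ‖u‖ ≤ M * ‖v‖ := by
  rw [← norm_weightedCoeff, ← norm_weightedCoeff]
  refine norm_lp_two_le_mul_of_norm_le hM fun k => ?_
  rw [norm_weightedCoeff_apply, norm_weightedCoeff_apply, mul_left_comm]
  exact mul_le_mul_of_nonneg_left (h k) (weight_pos k).le

/-- The `k`-th Fourier coefficient as a functional on `L²`. -/
def coeffL2CLM (k : ℤ) : L2 →L[ℝ] ℂ :=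
  (lp.evalCLM ℝ (fun _ : ℤ => ℂ) 2 k).comp coeffL2.toContinuousLinearMap

/-- The `k`-th Fourier coefficient as a functional on `H²`. -/
def coeffCLM (k : ℤ) : H2 →L[ℝ] ℂ := (coeffL2CLM k).comp embL2

lemma coeffCLM_apply (k : ℤ) (u : H2) : coeffCLM k u = coeff (toCont u) k := coeffL2_embL2 u k

/-- The Laplacian from `H²` to `L²`. -/
def lap : H2 →L[ℝ] L2 := embL2 - (oneSubLap : H2 →L[ℝ] L2)

lemma coeffL2_lap (u : H2) (k : ℤ) :
    coeffL2 (lap u) k = -(k : ℂ) ^ 2 * coeff (toCont u) k := by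
  change coeffL2 (embL2 u - oneSubLap u) k = _
  rw [map_sub, lp.coeFn_sub, Pi.sub_apply, coeffL2_embL2, coeffL2_oneSubLap,
    weightedCoeff_apply]
  push_cast
  ring

lemma isLaplacian_iff {u : H2} {w : L2} : IsLaplacian u w ↔ w = lap u := by
  constructor
  · intro h
    apply coeffL2.injective
    ext k
    rw [coeffL2_lap, coeffL2_apply, h k]
  · rintro rfl k
    rw [← coeffL2_apply, coeffL2_lap]

lemma isRealMultiplier_heat (s : ℝ) :
    IsRealMultiplier (fun k => ((Real.exp (-(k : ℝ) ^ 2 * max s 0) : ℝ) : ℂ)) 1 where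
  neg k := by rw [RCLike.star_def, Complex.conj_ofReal, Int.cast_neg, neg_sq]
  norm_le k := by
    rw [Complex.norm_real, Real.norm_of_nonneg (Real.exp_pos _).le, Real.exp_le_one_iff]
    exact mul_nonpos_of_nonpos_of_nonneg (neg_nonpos.mpr (sq_nonneg _)) (le_max_right s 0)

/-- The heat semigroup on `H²` at time `max s 0`. -/
def heat (s : ℝ) : H2 →L[ℝ] H2 := (isRealMultiplier_heat s).toCLM

lemma coeff_heat (s : ℝ) (u : H2) (k : ℤ) : coeff (toCont (heat s u)) k =
    ((Real.exp (-(k : ℝ) ^ 2 * max s 0) : ℝ) : ℂ) * coeff (toCont u) k :=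
  (isRealMultiplier_heat s).coeff_toCLM u k

lemma norm_heat_le (s : ℝ) : ‖heat s‖ ≤ 1 := (isRealMultiplier_heat s).norm_toCLM_le

lemma continuous_heat_apply (u : H2) : Continuous fun s => heat s u := by
  refine weightedIsometry.isometry.isUniformInducing.isInducing.continuous_iff.mpr
    (continuous_iff_continuousAt.mpr fun s₀ => ?_)
  have weightedCoeff_heat (s : ℝ) (k : ℤ) : weightedCoeff (heat s u) k =
      ((Real.exp (-(k : ℝ) ^ 2 * max s 0) : ℝ) : ℂ) * weightedCoeff u k :=
    (isRealMultiplier_heat s).weightedCoeff_toCLM u k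
  have norm_le (s : ℝ) (k : ℤ) : ‖weightedCoeff (heat s u) k‖ ≤ ‖weightedCoeff u k‖ := by
    simpa only [weightedCoeff_heat, one_mul] using
      (isRealMultiplier_heat s).norm_mul_le (weightedCoeff u) k
  refine tendsto_lp_two_of_dominated ((2 : ℝ) • weightedCoeff u)
    (Filter.Eventually.of_forall fun s k => ?_) fun k => ?_
  · rw [lp.coeFn_smul, Pi.smul_apply, norm_smul, Real.norm_two, two_mul]
    exact (norm_sub_le _ _).trans (add_le_add (norm_le s k) (norm_le s₀ k))
  · change Filter.Tendsto (fun s => weightedCoeff (heat s u) k) _ (nhds (weightedCoeff _ k))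
    simp only [weightedCoeff_heat]
    exact Continuous.tendsto (by fun_prop) s₀

lemma continuous_heat : Continuous fun p : ℝ × H2 => heat p.1 p.2 :=
  continuous_prod_of_continuous_lipschitzWith' _ 1
    (fun s => (heat s).lipschitzWith_of_opNorm_le (norm_heat_le s)) continuous_heat_apply

/-! ### The slow modes and their heat flow -/

section SlowModes

variable {k₀ : ℕ}

lemma mem_slowSpace_iff {v : H2} :
    v ∈ slowSpace k₀ ↔ ∀ k : ℤ, (k₀ : ℤ) < |k| → coeff (toCont v) k = 0 :=
  forall₂_congr fun k _ => weightedCoeff_eq_zero_iff v k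

lemma coeff_eq_zero_of_slow (v : slowSpace k₀) {k : ℤ} (hk : (k₀ : ℤ) < |k|) :
    coeff (toCont (v : H2)) k = 0 :=
  mem_slowSpace_iff.mp v.2 k hk

lemma slow_ext {u v : slowSpace k₀}
    (h : ∀ k, coeff (toCont (u : H2)) k = coeff (toCont (v : H2)) k) : u = v :=
  Subtype.ext (coeff_injective h)

instance : FiniteDimensional ℝ (slowSpace k₀) := by
  let coeffs : slowSpace k₀ →ₗ[ℝ] (Finset.Icc (-(k₀ : ℤ)) k₀ → ℂ) :=
    LinearMap.pi fun k => (coeffCLM k).toLinearMap ∘ₗ (slowSpace k₀).subtype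
  refine Module.Finite.of_injective coeffs fun u v h => slow_ext fun k => ?_
  by_cases hk : (k₀ : ℤ) < |k|
  · rw [coeff_eq_zero_of_slow u hk, coeff_eq_zero_of_slow v hk]
  · rw [← coeffCLM_apply, ← coeffCLM_apply]
    exact congrFun h ⟨k, Finset.mem_Icc.mpr (abs_le.mp (not_lt.mp hk))⟩

instance : CompleteSpace (slowSpace k₀) := FiniteDimensional.complete ℝ _

variable (k₀) in
lemma isRealMultiplier_slowDeriv :
    IsRealMultiplier (fun k => if |k| ≤ (k₀ : ℤ) then Complex.I * k else 0) k₀ where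
  neg k := by
    rw [abs_neg]
    split_ifs <;> simp
  norm_le k := by
    split_ifs with hk
    · rw [norm_mul, Complex.norm_I, one_mul, Complex.norm_intCast]
      exact_mod_cast hk
    · rw [norm_zero]
      positivity

variable (k₀) in
/-- The derivative `∂ₓ` on the slow modes. -/
def slowDeriv : slowSpace k₀ →L[ℝ] slowSpace k₀ :=
  ((isRealMultiplier_slowDeriv k₀).toCLM.comp (slowSpace k₀).subtypeL).codRestrict _ fun v =>
    mem_slowSpace_iff.mpr fun k hk => by
      change coeff (toCont ((isRealMultiplier_slowDeriv k₀).toCLM v)) k = 0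
      rw [IsRealMultiplier.coeff_toCLM, coeff_eq_zero_of_slow v hk, mul_zero]

lemma coeff_slowDeriv (v : slowSpace k₀) (k : ℤ) :
    coeff (toCont (slowDeriv k₀ v : H2)) k = Complex.I * k * coeff (toCont (v : H2)) k := by
  refine ((isRealMultiplier_slowDeriv k₀).coeff_toCLM v k).trans ?_
  split_ifs with hk
  · rfl
  · rw [coeff_eq_zero_of_slow v (not_le.mp hk), mul_zero, mul_zero]

lemma norm_slowDeriv_apply_le (v : slowSpace k₀) : ‖(slowDeriv k₀ v : H2)‖ ≤ k₀ * ‖v‖ :=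
  (isRealMultiplier_slowDeriv k₀).toCLM.le_of_opNorm_le
    (isRealMultiplier_slowDeriv k₀).norm_toCLM_le v

variable (k₀) in
/-- The Laplacian on the slow modes. -/
def slowLap : slowSpace k₀ →L[ℝ] slowSpace k₀ := (slowDeriv k₀).comp (slowDeriv k₀)

lemma coeff_slowLap (v : slowSpace k₀) (k : ℤ) :
    coeff (toCont (slowLap k₀ v : H2)) k = -(k : ℂ) ^ 2 * coeff (toCont (v : H2)) k := by
  change coeff (toCont (slowDeriv k₀ (slowDeriv k₀ v) : H2)) k = _
  rw [coeff_slowDeriv, coeff_slowDeriv, ← mul_assoc, mul_mul_mul_comm, Complex.I_mul_I, ← sq,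
    neg_one_mul]

lemma embL2_slowLap (v : slowSpace k₀) : embL2 (slowLap k₀ v : H2) = lap (v : H2) := by
  apply coeffL2.injective
  ext k
  rw [coeffL2_embL2, coeffL2_lap, coeff_slowLap]

variable (k₀) in
/-- The heat flow on the slow modes, at positive and negative times. -/
def flow (t : ℝ) : slowSpace k₀ →L[ℝ] slowSpace k₀ := expFlow (slowLap k₀) t

lemma coeff_flow (t : ℝ) (v : slowSpace k₀) (k : ℤ) : coeff (toCont (flow k₀ t v : H2)) k =
    ((Real.exp (-(k : ℝ) ^ 2 * t) : ℝ) : ℂ) * coeff (toCont (v : H2)) k := by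
  have := eigenfunctional_expFlow (slowLap k₀) ((coeffCLM k).comp (slowSpace k₀).subtypeL)
    (c := -(k : ℂ) ^ 2) (fun v => by
      change coeffCLM k (slowLap k₀ v : H2) = _ * coeffCLM k (v : H2)
      rw [coeffCLM_apply, coeffCLM_apply, coeff_slowLap]) v t
  change coeffCLM k (flow k₀ t v : H2) = _ * coeffCLM k (v : H2) at this
  rw [coeffCLM_apply, coeffCLM_apply] at this
  rw [this]
  push_cast
  rfl

lemma flow_zero (v : slowSpace k₀) : flow k₀ 0 v = v := by
  rw [flow, expFlow_zero]
  rfl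

lemma flow_add (s t : ℝ) (v : slowSpace k₀) : flow k₀ (s + t) v = flow k₀ s (flow k₀ t v) :=
  expFlow_add (slowLap k₀) v s t

lemma hasDerivAt_flow (v : slowSpace k₀) (t : ℝ) :
    HasDerivAt (fun s => flow k₀ s v) (slowLap k₀ (flow k₀ t v)) t :=
  hasDerivAt_expFlow (slowLap k₀) v t

lemma continuous_flow_apply (v : slowSpace k₀) : Continuous fun t => flow k₀ t v :=
  continuous_iff_continuousAt.mpr fun t => (hasDerivAt_flow v t).continuousAt

lemma norm_flow_le (t : ℝ) : ‖flow k₀ t‖ ≤ Real.exp ((k₀ : ℝ) ^ 2 * |t|) := by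
  refine ContinuousLinearMap.opNorm_le_bound _ (Real.exp_pos _).le fun v =>
    norm_le_mul_of_coeff_le (u := (flow k₀ t v : H2)) (v := v) (Real.exp_pos _).le fun k => ?_
  rw [coeff_flow, norm_mul, Complex.norm_real, Real.norm_of_nonneg (Real.exp_pos _).le]
  by_cases hk : (k₀ : ℤ) < |k|
  · rw [coeff_eq_zero_of_slow v hk, norm_zero, mul_zero, mul_zero]
  refine mul_le_mul_of_nonneg_right (Real.exp_le_exp.mpr ?_) (norm_nonneg _)
  have sq_le : (k : ℝ) ^ 2 ≤ (k₀ : ℝ) ^ 2 := by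
    exact_mod_cast sq_le_sq.mpr ((not_lt.mp hk).trans_eq (Nat.abs_cast k₀).symm)
  calc -(k : ℝ) ^ 2 * t ≤ (k : ℝ) ^ 2 * |t| := by
        rw [neg_mul, ← mul_neg]
        exact mul_le_mul_of_nonneg_left (neg_le_abs t) (sq_nonneg _)
    _ ≤ (k₀ : ℝ) ^ 2 * |t| := mul_le_mul_of_nonneg_right sq_le (abs_nonneg t)

lemma norm_flow_apply_le {t : ℝ} (ht : 0 ≤ t) (v : slowSpace k₀) : ‖flow k₀ t v‖ ≤ ‖v‖ := by
  refine (norm_le_mul_of_coeff_le (u := (flow k₀ t v : H2)) (v := v) zero_le_one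
    fun k => ?_).trans_eq (one_mul _)
  rw [coeff_flow, norm_mul, Complex.norm_real, Real.norm_of_nonneg (Real.exp_pos _).le]
  exact mul_le_mul_of_nonneg_right (Real.exp_le_one_iff.mpr
    (mul_nonpos_of_nonpos_of_nonneg (neg_nonpos.mpr (sq_nonneg _)) ht)) (norm_nonneg _)

lemma antitone_norm_flow (v : slowSpace k₀) : Antitone fun t => ‖flow k₀ t v‖ := by
  intro s t hst
  have := norm_flow_apply_le (sub_nonneg.mpr hst) (flow k₀ s v)
  rwa [← flow_add, sub_add_cancel] at this

lemma hasDerivAt_flow_coe (v : slowSpace k₀) (t : ℝ) :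
    HasDerivAt (fun s => (flow k₀ s v : H2)) (slowLap k₀ (flow k₀ t v) : H2) t :=
  (slowSpace k₀).subtypeL.hasFDerivAt.comp_hasDerivAt t (hasDerivAt_flow v t)

lemma hasDerivAt_embL2_flow (v : slowSpace k₀) (t : ℝ) :
    HasDerivAt (fun s => embL2 (flow k₀ s v : H2)) (lap (flow k₀ t v : H2)) t := by
  rw [← embL2_slowLap]
  exact embL2.hasFDerivAt.comp_hasDerivAt t (hasDerivAt_flow_coe v t)

/-! ### The heat equation -/

lemma coeff_eq_of_heat {S : Set ℝ} (hS : Convex ℝ S) {v : ℝ → H2}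
    (h : ∀ t ∈ S, HasDerivWithinAt (fun s => embL2 (v s)) (lap (v t)) S t)
    {s t : ℝ} (hs : s ∈ S) (ht : t ∈ S) (k : ℤ) :
    coeff (toCont (v t)) k =
      ((Real.exp (-(k : ℝ) ^ 2 * (t - s)) : ℝ) : ℂ) * coeff (toCont (v s)) k := by
  have coeff_ode : ∀ t ∈ S,
      HasDerivWithinAt (fun s => coeffCLM k (v s)) (-(k : ℂ) ^ 2 * coeffCLM k (v t)) S t := by
    intro t ht
    rw [coeffCLM_apply, ← coeffL2_lap]
    exact (coeffL2CLM k).hasFDerivAt.comp_hasDerivWithinAt t (h t ht)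
  rw [← coeffCLM_apply, ← coeffCLM_apply, eq_exp_mul_of_hasDerivWithinAt hS coeff_ode hs ht]
  push_cast
  rfl

lemma exists_flow_of_heat {S : Set ℝ} (hS : Convex ℝ S) {v : ℝ → H2}
    (h : ∀ t ∈ S, HasDerivWithinAt (fun s => embL2 (v s)) (lap (v t)) S t)
    {s : ℝ} (hs : s ∈ S) (hv : v s ∈ slowSpace k₀) :
    ∃ v₀ : slowSpace k₀, ∀ t ∈ S, v t = flow k₀ t v₀ := by
  refine ⟨flow k₀ (-s) ⟨v s, hv⟩, fun t ht => coeff_injective fun k => ?_⟩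
  rw [← flow_add, coeff_flow, coeff_eq_of_heat hS h hs ht, ← sub_eq_add_neg]

/-! ### The quadratic derivative term -/

lemma abs_mul_inv_weight_nonneg (k : ℤ) : 0 ≤ |(k : ℝ)| * (1 + (k : ℝ) ^ 2)⁻¹ := by
  positivity

lemma summable_abs_mul_inv_weight_sq :
    Summable fun k : ℤ => (|(k : ℝ)| * (1 + (k : ℝ) ^ 2)⁻¹) ^ 2 := by
  refine (Real.summable_one_div_int_pow.mpr one_lt_two).of_norm_bounded_eventually ?_
  filter_upwards [(finite_singleton (0 : ℤ)).compl_mem_cofinite] with k hk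
  have sq_pos : 0 < (k : ℝ) ^ 2 := by
    have : (k : ℝ) ≠ 0 := Int.cast_ne_zero.mpr hk
    positivity
  rw [Real.norm_of_nonneg (by positivity), mul_pow, sq_abs, inv_pow, ← div_eq_mul_inv,
    div_le_div_iff₀ (by positivity) sq_pos]
  nlinarith

/-- The constant in the bound of `v_x` in the Wiener norm by `v` in `H²`. -/
def derivConst : ℝ := √(∑' k : ℤ, (|(k : ℝ)| * (1 + (k : ℝ) ^ 2)⁻¹) ^ 2)

lemma derivConst_nonneg : 0 ≤ derivConst := Real.sqrt_nonneg _

lemma wienerNorm_slowDeriv_le (v : slowSpace k₀) :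
    wienerNorm (slowDeriv k₀ v : H2) ≤ derivConst * ‖v‖ := by
  refine le_of_eq_of_le (tsum_congr fun k => ?_) (tsum_mul_norm_lp_two_le
    abs_mul_inv_weight_nonneg summable_abs_mul_inv_weight_sq (weightedCoeff (v : H2)))
  rw [coeff_slowDeriv, norm_mul, norm_mul, Complex.norm_I, one_mul, Complex.norm_intCast,
    norm_coeff_eq, mul_assoc]

/-- The bound is linear in `k₀`, although `v_x` is estimated twice: the Wiener norm of `v_x` is
bounded by `‖v‖` uniformly in `k₀`. -/
lemma norm_mul_slowDeriv_le (v : slowSpace k₀) :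
    ‖mul (slowDeriv k₀ v : H2) (slowDeriv k₀ v : H2)‖ ≤ 4 * derivConst * k₀ * ‖v‖ ^ 2 :=
  calc ‖mul (slowDeriv k₀ v : H2) (slowDeriv k₀ v : H2)‖
      ≤ 4 * (wienerNorm (slowDeriv k₀ v : H2) * ‖(slowDeriv k₀ v : H2)‖) := by
        linarith [norm_mul_le_wienerNorm (slowDeriv k₀ v : H2) (slowDeriv k₀ v : H2)]
    _ ≤ 4 * (derivConst * ‖v‖ * (k₀ * ‖v‖)) :=
        mul_le_mul_of_nonneg_left (mul_le_mul (wienerNorm_slowDeriv_le v)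
          (norm_slowDeriv_apply_le v) (norm_nonneg _)
          (mul_nonneg derivConst_nonneg (norm_nonneg _))) zero_le_four
    _ = 4 * derivConst * k₀ * ‖v‖ ^ 2 := by ring

end SlowModes

/-! ### The critical manifold as a graph near zero -/

lemma exists_quadratic_inverse {E : Type*} [NormedAddCommGroup E] [NormedSpace ℝ E]
    [CompleteSpace E] (B : E →L[ℝ] E →L[ℝ] E) :
    ∃ ψ : E → E, ContDiffAt ℝ 1 ψ 0 ∧ ψ 0 = 0 ∧ ∀ᶠ p in nhds 0, B (ψ p) (ψ p) + ψ p = p := by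
  set g : E → E := fun u => B u u + u
  have contDiff_g : ContDiffAt ℝ 1 g 0 :=
    ((B.contDiff.clm_apply contDiff_id).add contDiff_id).contDiffAt
  have hasFDerivAt_g : HasFDerivAt g (ContinuousLinearEquiv.refl ℝ E : E →L[ℝ] E) 0 := by
    refine ((B.hasFDerivAt.clm_apply (hasFDerivAt_id (0 : E))).add
      (hasFDerivAt_id (0 : E))).congr_fderiv ?_
    ext w
    simp
  have g_zero : g 0 = 0 := by simp only [g, map_zero, add_zero]
  refine ⟨contDiff_g.localInverse hasFDerivAt_g one_ne_zero, ?_, ?_, ?_⟩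
  · simpa only [g_zero] using contDiff_g.to_localInverse hasFDerivAt_g one_ne_zero
  · simpa only [g_zero] using contDiff_g.localInverse_apply_image hasFDerivAt_g one_ne_zero
  · have right_inverse :=
      (contDiff_g.hasStrictFDerivAt' hasFDerivAt_g one_ne_zero).eventually_right_inverse
    rw [g_zero] at right_inverse
    exact right_inverse

/-- The inverse of the multiplication by `1 + 2 φ(v)` on `H²`; it is `0` if that multiplication is
not invertible. -/
def criticalInv (φ : H2 → H2) (v : H2) : H2 →L[ℝ] H2 :=
  Ring.inverse (1 + (2 : ℝ) • mul (φ v))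

lemma eventually_isUnit_and_norm_criticalInv_lt {φ : H2 → H2} (hφ : ContinuousAt φ 0)
    (φ_zero : φ 0 = 0) : ∀ᶠ v in nhds (0 : H2),
      IsUnit (1 + (2 : ℝ) • mul (φ v)) ∧ ‖criticalInv φ v‖ < 2 := by
  have one_add_zero : (1 : H2 →L[ℝ] H2) + (2 : ℝ) • mul (φ 0) = 1 := by
    rw [φ_zero, map_zero, smul_zero, add_zero]
  have continuousAt_one_add : ContinuousAt (fun v => (1 : H2 →L[ℝ] H2) + (2 : ℝ) • mul (φ v)) 0 :=
    continuousAt_const.add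
      ((mul.continuous.continuousAt.comp hφ).const_smul (2 : ℝ))
  have isUnit_near : ∀ᶠ v in nhds (0 : H2), IsUnit ((1 : H2 →L[ℝ] H2) + (2 : ℝ) • mul (φ v)) :=
    continuousAt_one_add.eventually (by
      simp only [one_add_zero]
      exact Units.nhds (1 : (H2 →L[ℝ] H2)ˣ))
  have inv_near : ∀ᶠ v in nhds (0 : H2), ‖criticalInv φ v‖ < 2 := by
    refine (ContinuousAt.comp (g := Ring.inverse) ?_ continuousAt_one_add).norm.eventually_lt_const
      ?_
    · rw [one_add_zero]
      exact NormedRing.inverse_continuousAt (1 : (H2 →L[ℝ] H2)ˣ)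
    · simp only [Function.comp, one_add_zero, Ring.inverse_one]
      exact ContinuousLinearMap.norm_id_le.trans_lt one_lt_two
  exact isUnit_near.and inv_near

/-- On the ball of radius `ρ` the map `φ` is `C¹`, solves `φ(v)² + φ(v) = v²`, and is so small that
it selects the attracting branch of the critical manifold. -/
structure IsCriticalMap (φ : H2 → H2) (ρ δ : ℝ) : Prop where
  contDiffAt : ∀ v, ‖v‖ < ρ → ContDiffAt ℝ 1 φ v
  eq : ∀ v, ‖v‖ < ρ → mul (φ v) (φ v) + φ v = mul v v
  isUnit : ∀ v, ‖v‖ < ρ → IsUnit (1 + (2 : ℝ) • mul (φ v))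
  norm_le : ∀ v, ‖v‖ < ρ → ‖φ v‖ ≤ δ
  norm_inv_le : ∀ v, ‖v‖ < ρ → ‖criticalInv φ v‖ ≤ 2
  norm_toCont_lt : ∀ v, ‖v‖ < ρ → ‖toCont (φ v)‖ < 1 / 2

lemma exists_criticalMap {δ : ℝ} (hδ : 0 < δ) : ∃ φ, ∃ ρ > 0, IsCriticalMap φ ρ δ := by
  obtain ⟨ψ, contDiff_ψ, ψ_zero, ψ_eq⟩ := exists_quadratic_inverse mul
  have contDiff_sq : ContDiff ℝ 1 fun v : H2 => mul v v := mul.contDiff.clm_apply contDiff_id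
  have sq_zero : mul (0 : H2) 0 = 0 := map_zero _
  set φ : H2 → H2 := fun v => ψ (mul v v)
  have φ_zero : φ 0 = 0 := by simp only [φ, sq_zero, ψ_zero]
  have contDiff_φ : ContDiffAt ℝ 1 φ 0 :=
    ContDiffAt.comp (0 : H2) (g := ψ) (by rwa [sq_zero]) contDiff_sq.contDiffAt
  have norm_near : ∀ᶠ v in nhds (0 : H2), ‖φ v‖ < δ :=
    contDiff_φ.continuousAt.norm.eventually_lt_const (by simpa only [φ_zero, norm_zero] using hδ)
  have toCont_near : ∀ᶠ v in nhds (0 : H2), ‖toContL (φ v)‖ < 1 / 2 :=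
    (toContL.continuous.continuousAt.comp contDiff_φ.continuousAt).norm.eventually_lt_const (by
      simp only [Function.comp, φ_zero, map_zero, norm_zero, one_div, inv_pos, zero_lt_two])
  have eq_near := contDiff_sq.continuous.tendsto' (0 : H2) 0 sq_zero |>.eventually ψ_eq
  obtain ⟨ρ, ρ_pos, near⟩ := Metric.eventually_nhds_iff.mp
    ((contDiff_φ.eventually (by simp)).and (eq_near.and
      ((eventually_isUnit_and_norm_criticalInv_lt contDiff_φ.continuousAt φ_zero).and
        (norm_near.and toCont_near))))
  simp only [dist_zero_right] at near
  exact ⟨φ, ρ, ρ_pos,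
    { contDiffAt := fun v hv => (near hv).1
      eq := fun v hv => (near hv).2.1
      isUnit := fun v hv => (near hv).2.2.1.1
      norm_le := fun v hv => (near hv).2.2.2.1.le
      norm_inv_le := fun v hv => (near hv).2.2.1.2.le
      norm_toCont_lt := fun v hv => (near hv).2.2.2.2 }⟩

namespace IsCriticalMap

variable {φ : H2 → H2} {ρ δ : ℝ} {v : H2}

lemma contDiffAt_inv (h : IsCriticalMap φ ρ δ) (hv : ‖v‖ < ρ) :
    ContDiffAt ℝ 1 (criticalInv φ) v := by
  obtain ⟨U, hU⟩ := h.isUnit v hv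
  refine ContDiffAt.comp v (g := Ring.inverse) ?_
    (contDiffAt_const.add ((mul.contDiff.contDiffAt.comp v (h.contDiffAt v hv)).const_smul (2 : ℝ)))
  rw [← hU]
  exact contDiffAt_ringInverse ℝ U

lemma right_inv (h : IsCriticalMap φ ρ δ) (hv : ‖v‖ < ρ) (w : H2) :
    criticalInv φ v w + (2 : ℝ) • mul (φ v) (criticalInv φ v w) = w :=
  DFunLike.congr_fun (Ring.mul_inverse_cancel _ (h.isUnit v hv)) w

lemma left_inv (h : IsCriticalMap φ ρ δ) (hv : ‖v‖ < ρ) (w : H2) :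
    criticalInv φ v (w + (2 : ℝ) • mul (φ v) w) = w :=
  DFunLike.congr_fun (Ring.inverse_mul_cancel _ (h.isUnit v hv)) w

lemma one_add_two_mul_eq (h : IsCriticalMap φ ρ δ) (hv : ‖v‖ < ρ) (x : Torus) :
    1 + 2 * toCont (φ v) x = 2 * √(1 / 4 + toCont v x ^ 2) := by
  have quadratic_eq : toCont (φ v) x * toCont (φ v) x + toCont (φ v) x = toCont v x * toCont v x :=
    congrArg (fun u => toCont u x) (h.eq v hv)
  have lower : -(1 / 2) < toCont (φ v) x :=
    (abs_lt.mp (((toCont (φ v)).norm_coe_le_norm x).trans_lt (h.norm_toCont_lt v hv))).1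
  have sqrt_eq : √(1 / 4 + toCont v x ^ 2) = 1 / 2 + toCont (φ v) x := by
    rw [Real.sqrt_eq_iff_mul_self_eq (by positivity) (by linarith)]
    linarith
  rw [sqrt_eq]
  ring

lemma mem_criticalManifold (h : IsCriticalMap φ ρ δ) (hv : ‖v‖ < ρ) :
    (φ v, v) ∈ criticalManifold := fun x => by
  linarith [h.one_add_two_mul_eq hv x]

lemma eq_of_mem_criticalManifold (h : IsCriticalMap φ ρ δ) {u : H2} (hv : ‖v‖ < ρ)
    (hu : (u, v) ∈ criticalManifold) : u = φ v :=
  toCont_injective (ContinuousMap.ext fun x => (hu x).trans (h.mem_criticalManifold hv x).symm)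

lemma toCont_inv_apply (h : IsCriticalMap φ ρ δ) (hv : ‖v‖ < ρ) (w : H2) (x : Torus) :
    toCont (criticalInv φ v w) x = toCont w x / (2 * √(1 / 4 + toCont v x ^ 2)) := by
  have inv_eq : toCont (criticalInv φ v w) x +
      2 * (toCont (φ v) x * toCont (criticalInv φ v w) x) = toCont w x :=
    congrArg (fun u => toCont u x) (h.right_inv hv w)
  have sqrt_pos : 0 < √(1 / 4 + toCont v x ^ 2) := Real.sqrt_pos.mpr (by positivity)
  rw [eq_div_iff (mul_pos two_pos sqrt_pos).ne', ← h.one_add_two_mul_eq hv x]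
  linarith

lemma hasFDerivAt (h : IsCriticalMap φ ρ δ) (hv : ‖v‖ < ρ) : HasFDerivAt φ (fderiv ℝ φ v) v :=
  ((h.contDiffAt v hv).differentiableAt one_ne_zero).hasFDerivAt

lemma fderiv_apply (h : IsCriticalMap φ ρ δ) (hv : ‖v‖ < ρ) (ξ : H2) :
    fderiv ℝ φ v ξ = (2 : ℝ) • criticalInv φ v (mul v ξ) := by
  have quadratic_eq : (fun u => mul (φ u) (φ u) + φ u) =ᶠ[nhds v] fun u => mul u u := by
    filter_upwards [Metric.isOpen_ball.mem_nhds (mem_ball_zero_iff.mpr hv)] with u hu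
    exact h.eq u (mem_ball_zero_iff.mp hu)
  have deriv_eq := (((mul.hasFDerivAt.comp v (h.hasFDerivAt hv)).clm_apply
    (h.hasFDerivAt hv)).add (h.hasFDerivAt hv)).unique
      (((mul.hasFDerivAt (x := v)).clm_apply (hasFDerivAt_id v)).congr_of_eventuallyEq quadratic_eq)
  have linearized : mul (φ v) (fderiv ℝ φ v ξ) + mul (fderiv ℝ φ v ξ) (φ v) + fderiv ℝ φ v ξ =
      mul v ξ + mul ξ v := DFunLike.congr_fun deriv_eq ξ
  rw [mul_swap _ (φ v), mul_swap ξ v, ← two_smul ℝ, ← two_smul ℝ, add_comm] at linearized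
  rw [← map_smul, ← linearized, h.left_inv hv]

end IsCriticalMap

/-! ### The Laplacian along the critical manifold -/

lemma two_pi_I_mul_div_two_pi (k : ℤ) :
    2 * Real.pi * Complex.I * k / ((2 * Real.pi : ℝ) : ℂ) = Complex.I * k := by
  have : (Real.pi : ℂ) ≠ 0 := Complex.ofReal_ne_zero.mpr Real.pi_ne_zero
  push_cast
  field_simp

lemma coeff_of_hasDerivAt {f f' : C(Torus, ℝ)}
    (h : ∀ x : ℝ, HasDerivAt (fun y : ℝ => f (y : Torus)) (f' (x : Torus)) x) (k : ℤ) :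
    coeff f' k = Complex.I * k * coeff f k := by
  rw [← two_pi_I_mul_div_two_pi, ← fourierCoeff_toComplex, ← fourierCoeff_toComplex]
  exact fourierCoeff_of_hasDerivAt (fun x => (h x).ofReal_comp) k

section SlowModes

variable {k₀ : ℕ}

lemma toCont_slow_eq_sum (v : slowSpace k₀) (x : Torus) :
    ((toCont (v : H2) x : ℝ) : ℂ) =
      ∑ k ∈ Finset.Icc (-(k₀ : ℤ)) k₀, coeff (toCont (v : H2)) k * fourier k x := by
  refine ((ContinuousMap.evalCLM ℂ x).hasSum (hasSum_coeff_smul_fourier (v : H2))).unique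
    (hasSum_sum_of_ne_finset_zero (f := fun k => coeff (toCont (v : H2)) k * fourier k x)
      fun k hk => ?_)
  rw [coeff_eq_zero_of_slow v, zero_mul]
  exact not_le.mp fun hle => hk (Finset.mem_Icc.mpr (abs_le.mp hle))

lemma hasDerivAt_toCont_slow (v : slowSpace k₀) (x : ℝ) :
    HasDerivAt (fun y : ℝ => toCont (v : H2) (y : Torus))
      (toCont (slowDeriv k₀ v : H2) (x : Torus)) x := by
  have complex_deriv : HasDerivAt (fun y : ℝ => ((toCont (v : H2) (y : Torus) : ℝ) : ℂ))
      ((toCont (slowDeriv k₀ v : H2) (x : Torus) : ℝ) : ℂ) x := by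
    simp_rw [toCont_slow_eq_sum]
    refine HasDerivAt.fun_sum fun k _ =>
      ((hasDerivAt_fourier (2 * Real.pi) k x).const_mul (coeff (toCont (v : H2)) k)).congr_deriv ?_
    rw [two_pi_I_mul_div_two_pi, coeff_slowDeriv]
    ring
  exact Complex.reCLM.hasFDerivAt.comp_hasDerivAt x complex_deriv

lemma hasDerivAt_sqrt_quarter_add_sq {f : ℝ → ℝ} {f' x : ℝ} (hf : HasDerivAt f f' x) :
    HasDerivAt (fun y => √(1 / 4 + f y ^ 2)) (f x * f' / √(1 / 4 + f x ^ 2)) x := by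
  refine (((hf.pow 2).const_add (1 / 4)).sqrt
    (show (0 : ℝ) < 1 / 4 + f x ^ 2 by positivity).ne').congr_deriv ?_
  have : 0 < √(1 / 4 + f x ^ 2) := Real.sqrt_pos.mpr (by positivity)
  simp only [Pi.pow_apply]
  field_simp
  ring

lemma hasDerivAt_mul_div_sqrt_quarter_add_sq {f f' : ℝ → ℝ} {f'' x : ℝ}
    (hf : HasDerivAt f (f' x) x) (hf' : HasDerivAt f' f'' x) :
    HasDerivAt (fun y => f y * f' y / √(1 / 4 + f y ^ 2))
      (f x * f'' / √(1 / 4 + f x ^ 2) + f' x ^ 2 / (4 * √(1 / 4 + f x ^ 2) ^ 3)) x := by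
  have sqrt_pos : 0 < √(1 / 4 + f x ^ 2) := Real.sqrt_pos.mpr (by positivity)
  refine ((hf.mul hf').div (hasDerivAt_sqrt_quarter_add_sq hf) sqrt_pos.ne').congr_deriv ?_
  have sq_eq : f x ^ 2 = √(1 / 4 + f x ^ 2) ^ 2 - 1 / 4 := by
    rw [Real.sq_sqrt (by positivity)]
    ring
  set q := √(1 / 4 + f x ^ 2)
  simp only [Pi.mul_apply]
  field_simp
  rw [sq_eq]
  ring

/-- The remainder `φ''(v) v_x²` on the slow modes. -/
def remainder (φ : H2 → H2) (v : slowSpace k₀) : H2 :=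
  (2 : ℝ) • criticalInv φ v (criticalInv φ v (criticalInv φ v
    (mul (slowDeriv k₀ v : H2) (slowDeriv k₀ v : H2))))

namespace IsCriticalMap

variable {φ : H2 → H2} {ρ δ : ℝ} {v : slowSpace k₀}

lemma hasDerivAt_toCont (h : IsCriticalMap φ ρ δ) (hv : ‖v‖ < ρ) (x : ℝ) :
    HasDerivAt (fun y : ℝ => toCont (φ v) (y : Torus))
      (toCont (fderiv ℝ φ v (slowDeriv k₀ v)) (x : Torus)) x := by
  have toCont_φ (y : ℝ) : toCont (φ v) (y : Torus) = -(1 / 2) + √(1 / 4 + toCont v y ^ 2) :=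
    h.mem_criticalManifold (v := v) hv y
  simp only [toCont_φ]
  refine ((hasDerivAt_sqrt_quarter_add_sq (hasDerivAt_toCont_slow v x)).const_add _).congr_deriv ?_
  rw [h.fderiv_apply (v := v) hv, map_smul, ContinuousMap.smul_apply, smul_eq_mul,
    h.toCont_inv_apply (v := v) hv, mul_div_assoc', mul_div_mul_left _ _ two_ne_zero]
  rfl

lemma hasDerivAt_toCont_fderiv (h : IsCriticalMap φ ρ δ) (hv : ‖v‖ < ρ) (x : ℝ) :
    HasDerivAt (fun y : ℝ => toCont (fderiv ℝ φ v (slowDeriv k₀ v)) (y : Torus))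
      (toCont (fderiv ℝ φ v (slowLap k₀ v) + remainder φ v) (x : Torus)) x := by
  have toCont_fderiv (w : H2) (y : ℝ) : toCont (fderiv ℝ φ v w) (y : Torus) =
      toCont v y * toCont w y / √(1 / 4 + toCont v y ^ 2) := by
    rw [h.fderiv_apply (v := v) hv, map_smul, ContinuousMap.smul_apply, smul_eq_mul,
      h.toCont_inv_apply (v := v) hv, mul_div_assoc', mul_div_mul_left _ _ two_ne_zero]
    rfl
  have toCont_remainder : toCont (remainder φ v) (x : Torus) =
      toCont (slowDeriv k₀ v : H2) x ^ 2 / (4 * √(1 / 4 + toCont v x ^ 2) ^ 3) := by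
    rw [remainder, map_smul, ContinuousMap.smul_apply, smul_eq_mul,
      h.toCont_inv_apply (v := v) hv, h.toCont_inv_apply (v := v) hv,
      h.toCont_inv_apply (v := v) hv, toCont_mul, ContinuousMap.mul_apply]
    field_simp
    ring
  simp only [toCont_fderiv]
  refine (hasDerivAt_mul_div_sqrt_quarter_add_sq (hasDerivAt_toCont_slow v x)
    (hasDerivAt_toCont_slow (slowDeriv k₀ v) x)).congr_deriv ?_
  rw [map_add, ContinuousMap.add_apply, toCont_fderiv, toCont_remainder]
  rfl

lemma lap_eq (h : IsCriticalMap φ ρ δ) (hv : ‖v‖ < ρ) :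
    lap (φ v) = embL2 (fderiv ℝ φ v (slowLap k₀ v) + remainder φ v) := by
  apply coeffL2.injective
  ext k
  rw [coeffL2_lap, coeffL2_embL2, coeff_of_hasDerivAt (h.hasDerivAt_toCont_fderiv hv),
    coeff_of_hasDerivAt (h.hasDerivAt_toCont hv)]
  linear_combination (-(k : ℂ) ^ 2 * coeff (toCont (φ v)) k) * Complex.I_mul_I

lemma norm_remainder_le (h : IsCriticalMap φ ρ δ) (hv : ‖v‖ < ρ) :
    ‖remainder φ v‖ ≤ 64 * derivConst * k₀ * ‖v‖ ^ 2 := by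
  have norm_inv (w : H2) : ‖criticalInv φ v w‖ ≤ 2 * ‖w‖ :=
    (criticalInv φ v).le_of_opNorm_le (h.norm_inv_le v hv) w
  set w := mul (slowDeriv k₀ v : H2) (slowDeriv k₀ v : H2)
  calc ‖remainder φ v‖ = 2 * ‖criticalInv φ v (criticalInv φ v (criticalInv φ v w))‖ := by
        rw [remainder, norm_smul, Real.norm_two]
    _ ≤ 16 * ‖w‖ := by
        linarith [norm_inv (criticalInv φ v (criticalInv φ v w)), norm_inv (criticalInv φ v w),
          norm_inv w]
    _ ≤ 64 * derivConst * k₀ * ‖v‖ ^ 2 := by linarith [norm_mul_slowDeriv_le v]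

lemma contDiffAt_remainder (h : IsCriticalMap φ ρ δ) (hv : ‖v‖ < ρ) :
    ContDiffAt ℝ 1 (remainder φ : slowSpace k₀ → H2) v := by
  have contDiff_inv : ContDiffAt ℝ 1 (fun v : slowSpace k₀ => criticalInv φ (v : H2)) v :=
    (h.contDiffAt_inv (v := v) hv).comp v (slowSpace k₀).subtypeL.contDiff.contDiffAt
  have contDiff_deriv : ContDiffAt ℝ 1 (fun v : slowSpace k₀ => (slowDeriv k₀ v : H2)) v :=
    ((slowSpace k₀).subtypeL.comp (slowDeriv k₀)).contDiff.contDiffAt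
  exact (contDiff_inv.clm_apply (contDiff_inv.clm_apply (contDiff_inv.clm_apply
    ((mul.contDiff.contDiffAt.comp v contDiff_deriv).clm_apply contDiff_deriv)))).const_smul (2 : ℝ)

end IsCriticalMap

end SlowModes

/-! ### The fast equation -/

lemma inner_L2_eq (f g : L2) :
    inner ℝ f g = (inner ℂ (coeffL2 f) (coeffL2 g) : ℂ).re := by
  have real_polarization :=
    real_inner_eq_norm_add_mul_self_sub_norm_mul_self_sub_norm_mul_self_div_two f g
  have complex_polarization :=
    re_inner_eq_norm_add_mul_self_sub_norm_mul_self_sub_norm_mul_self_div_two (𝕜 := ℂ)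
      (coeffL2 f) (coeffL2 g)
  rw [← map_add, LinearIsometry.norm_map, LinearIsometry.norm_map, LinearIsometry.norm_map]
    at complex_polarization
  exact real_polarization.trans complex_polarization.symm

lemma hasSum_inner_L2 (f g : L2) :
    HasSum (fun k => (inner ℂ (coeffL2 f k) (coeffL2 g k) : ℂ).re) (inner ℝ f g) := by
  rw [inner_L2_eq]
  exact Complex.reCLM.hasSum (lp.hasSum_inner (𝕜 := ℂ) (coeffL2 f) (coeffL2 g))

lemma inner_lap_symm (u w : H2) : inner ℝ (lap u) (embL2 w) = inner ℝ (embL2 u) (lap w) := by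
  refine (hasSum_inner_L2 _ _).unique ?_
  convert hasSum_inner_L2 (embL2 u) (lap w) using 1
  funext k
  rw [coeffL2_lap, coeffL2_embL2, coeffL2_lap, coeffL2_embL2, RCLike.inner_apply,
    RCLike.inner_apply]
  simp only [map_mul, map_neg, map_pow, map_intCast]
  congr 1
  ring

lemma inner_lap_nonpos (u : H2) : inner ℝ (lap u) (embL2 u) ≤ 0 := by
  refine (hasSum_inner_L2 _ _).nonpos fun k => ?_
  have mode_eq : inner ℂ (coeffL2 (lap u) k) (coeffL2 (embL2 u) k) =
      ((-(k : ℝ) ^ 2 * Complex.normSq (coeff (toCont u) k) : ℝ) : ℂ) := by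
    rw [coeffL2_lap, coeffL2_embL2, RCLike.inner_apply]
    simp only [map_mul, map_neg, map_pow, map_intCast]
    push_cast
    rw [← Complex.mul_conj]
    ring
  rw [mode_eq, Complex.ofReal_re]
  exact mul_nonpos_of_nonpos_of_nonneg (neg_nonpos.mpr (sq_nonneg _)) (Complex.normSq_nonneg _)

lemma norm_toL2_mul_le (p f : C(Torus, ℝ)) : ‖toL2 (p * f)‖ ≤ ‖p‖ * ‖toL2 f‖ := by
  refine Lp.norm_le_mul_norm_of_ae_le_mul ?_
  filter_upwards [ContinuousMap.coeFn_toLp (𝕜 := ℝ) (p := 2) haar f,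
    ContinuousMap.coeFn_toLp (𝕜 := ℝ) (p := 2) haar (p * f)] with x hf hpf
  rw [toL2, toL2, hf, hpf, ContinuousMap.mul_apply, norm_mul]
  exact mul_le_mul_of_nonneg_right (p.norm_coe_le_norm x) (norm_nonneg _)

/-- The `L²` class of the reaction term `ε⁻¹ (v² - u (u + 1))` of the fast equation. -/
def reaction (ε : ℝ) (u v : H2) : L2 :=
  ε⁻¹ • toL2 (toCont v ^ 2 - toCont u * (toCont u + 1))

/-- `u` solves the fast equation `∂ₜu = Δu + ε⁻¹ (v² - u (u + 1))` on `[a, b]` for the given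
`v`. -/
structure SolvesFast (ε a b : ℝ) (u v : ℝ → H2) : Prop where
  continuousOn : ContinuousOn u (Icc a b)
  eq : ∀ t ∈ Icc a b,
    HasDerivWithinAt (fun s => embL2 (u s)) (lap (u t) + reaction ε (u t) (v t)) (Icc a b) t

lemma reaction_sub (ε : ℝ) (u₁ u₂ v : H2) : reaction ε u₁ v - reaction ε u₂ v =
    toL2 (-(ε⁻¹ • (1 + toCont u₁ + toCont u₂)) * toCont (u₁ - u₂)) := by
  change ε⁻¹ • toL2L _ - ε⁻¹ • toL2L _ = toL2L _
  rw [← map_smul, ← map_smul, ← map_sub, ← smul_sub, neg_mul, smul_mul_assoc, ← smul_neg,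
    map_sub toCont]
  congr 2
  ring

namespace SolvesFast

variable {ε a b : ℝ} {u u₁ u₂ v w : ℝ → H2}

lemma mono (h : SolvesFast ε a b u v) {c d : ℝ} (hac : a ≤ c) (hdb : d ≤ b) :
    SolvesFast ε c d u v where
  continuousOn := h.continuousOn.mono (Icc_subset_Icc hac hdb)
  eq t ht := (h.eq t (Icc_subset_Icc hac hdb ht)).mono (Icc_subset_Icc hac hdb)

lemma congr_right (h : SolvesFast ε a b u v) (hvw : ∀ t ∈ Icc a b, v t = w t) :
    SolvesFast ε a b u w where
  continuousOn := h.continuousOn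
  eq t ht := hvw t ht ▸ h.eq t ht

lemma exists_isPerturbedFlow (h₁ : SolvesFast ε a b u₁ v) (h₂ : SolvesFast ε a b u₂ v) :
    ∃ g M, IsPerturbedFlow (fun t => embL2 (u₁ t - u₂ t)) (fun t => lap (u₁ t - u₂ t)) g a b M := by
  obtain ⟨M, hM⟩ := isCompact_Icc.exists_bound_of_continuousOn
    (((continuousOn_const (c := 1).add (toContL.continuous.comp_continuousOn h₁.continuousOn)).add
      (toContL.continuous.comp_continuousOn h₂.continuousOn)).const_smul ε⁻¹).neg
  refine ⟨fun t => reaction ε (u₁ t) (v t) - reaction ε (u₂ t) (v t), M, ?_, ?_, ?_, ?_, ?_⟩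
  · intro t ht
    have hdiff := (h₁.eq t ht).fun_sub (h₂.eq t ht)
    simp only [← map_sub embL2] at hdiff
    refine hdiff.congr_deriv ?_
    rw [map_sub]
    abel
  · exact lap.continuous.comp_continuousOn (h₁.continuousOn.sub h₂.continuousOn)
  · exact fun s t => inner_lap_symm _ _
  · exact fun t => inner_lap_nonpos _
  · intro t ht
    simp only [reaction_sub]
    exact (norm_toL2_mul_le _ _).trans (mul_le_mul_of_nonneg_right (hM t ht) (norm_nonneg _))

lemma eqOn_of_left_eq (h₁ : SolvesFast ε a b u₁ v) (h₂ : SolvesFast ε a b u₂ v)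
    (ha : u₁ a = u₂ a) : EqOn u₁ u₂ (Icc a b) := by
  obtain ⟨g, M, h⟩ := h₁.exists_isPerturbedFlow h₂
  intro t ht
  have hzero := h.eq_zero_of_left_eq_zero (by simp [ha]) t ht
  rw [map_sub] at hzero
  exact embL2_injective (sub_eq_zero.mp hzero)

lemma left_eq_of_right_eq (h₁ : SolvesFast ε a b u₁ v) (h₂ : SolvesFast ε a b u₂ v)
    (hab : a ≤ b) (hb : u₁ b = u₂ b) : u₁ a = u₂ a := by
  obtain ⟨g, M, h⟩ := h₁.exists_isPerturbedFlow h₂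
  have hzero := h.left_eq_zero_of_right_eq_zero hab (by simp [hb])
  rw [map_sub] at hzero
  exact embL2_injective (sub_eq_zero.mp hzero)

end SolvesFast

/-! ### The linearised fast equation along the slow flow -/

section SlowFlow

variable {k₀ : ℕ}

/-- The semigroup of `Δ - b` on `H²`. -/
def dampedHeat (b s : ℝ) : H2 →L[ℝ] H2 := Real.exp (-b * s) • heat s

variable (k₀) in
/-- The slow flow backward in time. -/
def backFlow (s : ℝ) : slowSpace k₀ →L[ℝ] slowSpace k₀ := flow k₀ (-s)

lemma isDichotomy_dampedHeat_backFlow {b : ℝ} (hb : (k₀ : ℝ) ^ 2 < b) :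
    IsDichotomy (dampedHeat b) (backFlow k₀) b ((k₀ : ℝ) ^ 2) where
  nonneg := sq_nonneg _
  lt := hb
  continuous_left :=
    ((Real.continuous_exp.comp (continuous_const.mul continuous_fst)).smul continuous_heat :)
  norm_left_le s _ := by
    rw [dampedHeat, norm_smul, Real.norm_of_nonneg (Real.exp_pos _).le]
    exact mul_le_of_le_one_right (Real.exp_pos _).le (norm_heat_le s)
  continuous_right y := (continuous_flow_apply y).comp continuous_neg
  norm_right_le s hs := by
    simpa only [backFlow, abs_neg, abs_of_nonneg hs] using norm_flow_le (k₀ := k₀) (-s)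

lemma coeff_duhamel_flow {b : ℝ} (hb : (k₀ : ℝ) ^ 2 < b) {G : slowSpace k₀ → H2}
    (hG : Continuous G) {M : ℝ} (hM : ∀ y, ‖G y‖ ≤ M) (v : slowSpace k₀) (t : ℝ) (k : ℤ) :
    coeff (toCont (duhamel (dampedHeat b) (backFlow k₀) G (flow k₀ t v))) k =
      ∫ s in Ioi (0 : ℝ),
        Real.exp (-(b + (k : ℝ) ^ 2) * s) • coeffCLM k (G (flow k₀ (t - s) v)) := by
  rw [← coeffCLM_apply, duhamel, ← (coeffCLM k).integral_comp_comm
    ((isDichotomy_dampedHeat_backFlow hb).integrableOn hG hM _)]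
  refine setIntegral_congr_fun measurableSet_Ioi fun s hs => ?_
  have hs : max s 0 = s := max_eq_left (le_of_lt hs)
  simp only [dampedHeat, smul_apply]
  rw [map_smul, coeffCLM_apply, coeff_heat, hs, backFlow, ← flow_add, coeffCLM_apply,
    neg_add_eq_sub, ← Complex.real_smul, smul_smul, ← Real.exp_add]
  congr 2
  ring

theorem hasDerivAt_duhamel_flow {b : ℝ} (hb : (k₀ : ℝ) ^ 2 < b) {G : slowSpace k₀ → H2}
    (hG : Continuous G) {M : ℝ} (hM : ∀ y, ‖G y‖ ≤ M) {D : slowSpace k₀ → H2} (hD : Continuous D)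
    (hDG : ∀ v, D v = duhamel (dampedHeat b) (backFlow k₀) G v) (v : slowSpace k₀) (t : ℝ) :
    HasDerivAt (fun t => embL2 (D (flow k₀ t v)))
      (lap (D (flow k₀ t v)) + embL2 (G (flow k₀ t v) - b • D (flow k₀ t v))) t := by
  have hflow : Continuous fun t => flow k₀ t v := continuous_flow_apply v
  have hDflow : Continuous fun t => D (flow k₀ t v) := hD.comp hflow
  have hGflow : Continuous fun t => G (flow k₀ t v) := hG.comp hflow
  refine hasDerivAt_of_linearIsometry coeffL2 (hasDerivAt_lp_of_forall (g := fun t => coeffL2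
    (lap (D (flow k₀ t v)) + embL2 (G (flow k₀ t v) - b • D (flow k₀ t v)))) ?_ ?_ t)
  · exact coeffL2.continuous.comp ((lap.continuous.comp hDflow).add
      (embL2.continuous.comp (hGflow.sub (hDflow.const_smul b))))
  intro k t
  have hμ : 0 < b + (k : ℝ) ^ 2 := by nlinarith [sq_nonneg (k₀ : ℝ), sq_nonneg (k : ℝ)]
  have hmode (t : ℝ) : coeff (toCont (D (flow k₀ t v))) k = ∫ s in Ioi (0 : ℝ),
      Real.exp (-(b + (k : ℝ) ^ 2) * s) • coeffCLM k (G (flow k₀ (t - s) v)) := by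
    rw [hDG, coeff_duhamel_flow hb hG hM]
  simp only [coeffL2_embL2, hmode]
  refine (hasDerivAt_setIntegral_Ioi_exp_smul (M := ‖coeffCLM k‖ * M) hμ
    ((coeffCLM k).continuous.comp hGflow) (fun t => (coeffCLM k).le_opNorm_of_le (hM _))
    t).congr_deriv ?_
  change -(b + (k : ℝ) ^ 2) • (∫ s in Ioi (0 : ℝ),
    Real.exp (-(b + (k : ℝ) ^ 2) * s) • coeffCLM k (G (flow k₀ (t - s) v))) + _ = _
  rw [← hmode, map_add, lp.coeFn_add, Pi.add_apply, coeffL2_lap, coeffL2_embL2, ← coeffCLM_apply,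
    ← coeffCLM_apply, map_sub, map_smul, Complex.real_smul, Complex.real_smul,
    Function.comp_apply]
  push_cast
  ring

end SlowFlow

section StrictSolutions

variable {k₀ : ℕ} {ε T : ℝ} {u v : ℝ → H2}

lemma eq_flow_of_heat {S : Set ℝ} (hS : Convex ℝ S)
    (h : ∀ t ∈ S, HasDerivWithinAt (fun s => embL2 (v s)) (lap (v t)) S t) (hzero : 0 ∈ S)
    {w : slowSpace k₀} (hw : v 0 = w) : ∀ t ∈ S, v t = flow k₀ t w := fun t ht => by
  refine coeff_injective fun k => ?_
  rw [coeff_flow, coeff_eq_of_heat hS h hzero ht, hw, sub_zero]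

/-! ### Strict solutions -/

lemma IsSolution.heat (h : IsSolution ε T u v) :
    ∀ t ∈ Icc 0 T, HasDerivWithinAt (fun s => embL2 (v s)) (lap (v t)) (Icc 0 T) t := fun t ht => by
  obtain ⟨_, hw, hd⟩ := h.eq_v t ht
  exact isLaplacian_iff.mp hw ▸ hd

lemma IsReducedSolution.heat (h : IsReducedSolution k₀ T u v) :
    ∀ t ∈ Icc 0 T, HasDerivWithinAt (fun s => embL2 (v s)) (lap (v t)) (Icc 0 T) t := fun t ht => by
  obtain ⟨_, hw, hd⟩ := h.eq_v t ht
  exact isLaplacian_iff.mp hw ▸ hd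

lemma IsSolution.solvesFast (h : IsSolution ε T u v) : SolvesFast ε 0 T u v where
  continuousOn := h.continuousOn_u
  eq t ht := by
    obtain ⟨_, hw, hd⟩ := h.eq_u t ht
    exact isLaplacian_iff.mp hw ▸ hd

lemma SolvesFast.isSolution {w : slowSpace k₀} (h : SolvesFast ε 0 T u fun t => flow k₀ t w) :
    IsSolution ε T u fun t => flow k₀ t w where
  continuousOn_u := h.continuousOn
  continuousOn_v := (continuous_subtype_val.comp (continuous_flow_apply w)).continuousOn
  eq_u t ht := ⟨_, isLaplacian_iff.mpr rfl, h.eq t ht⟩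
  eq_v t _ := ⟨_, isLaplacian_iff.mpr rfl, (hasDerivAt_embL2_flow w t).hasDerivWithinAt⟩

/-! ### Slow manifolds -/

/-- `U` parametrises an invariant graph over the ball of radius `σ` of the slow space, at distance
at most `R` from the critical manifold, which over the ball of radius `σ` is the graph of `φ`. -/
structure IsSlowGraph (ε σ R : ℝ) (φ : H2 → H2) (U : slowSpace k₀ → H2) : Prop where
  contDiff : ContDiff ℝ 1 U
  mem_critical : ∀ v : H2, ‖v‖ ≤ σ → (φ v, v) ∈ criticalManifold
  eq_of_mem_critical : ∀ u v : H2, ‖v‖ ≤ σ → (u, v) ∈ criticalManifold → u = φ v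
  norm_sub_le : ∀ v : slowSpace k₀, ‖v‖ ≤ σ → ‖U v - φ v‖ ≤ R
  solvesFast : ∀ (w : slowSpace k₀) (a b : ℝ), ‖flow k₀ a w‖ ≤ σ →
    SolvesFast ε a b (fun t => U (flow k₀ t w)) fun t => flow k₀ t w

/-- The map `h = (h_X, h_F)` of a slow manifold whose fast component `h_F` vanishes, which is the
case here because the slow modes are invariant under the heat equation for `v`. -/
def graphMap (U : slowSpace k₀ → H2) (v : slowSpace k₀) : H2 × fastSpace k₀ := (U v, 0)

lemma graphPoint_graphMap (U : slowSpace k₀ → H2) (v : slowSpace k₀) :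
    graphPoint (graphMap U) v = (U v, (v : H2)) := by
  simp only [graphPoint, graphMap, ZeroMemClass.coe_zero, add_zero]

lemma mem_image_graphPoint_graphMap {U : slowSpace k₀ → H2} {S : Set (slowSpace k₀)}
    {w : slowSpace k₀} {p : H2} :
    (p, (w : H2)) ∈ graphPoint (graphMap U) '' S ↔ w ∈ S ∧ p = U w := by
  simp only [mem_image, graphPoint_graphMap, Prod.mk.injEq, SetLike.coe_eq_coe]
  constructor
  · rintro ⟨w, hw, rfl, rfl⟩
    exact ⟨hw, rfl⟩
  · rintro ⟨hw, rfl⟩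
    exact ⟨w, hw, rfl, rfl⟩

lemma mem_graphManifold_graphMap {U : slowSpace k₀ → H2} {σ : ℝ} {w : slowSpace k₀} {p : H2} :
    (p, (w : H2)) ∈ graphManifold (graphMap U) σ ↔ ‖w‖ ≤ σ ∧ p = U w :=
  mem_image_graphPoint_graphMap.trans (and_congr_left' mem_closedBall_zero_iff)

lemma mem_graphBoundary_graphMap {U : slowSpace k₀ → H2} {σ : ℝ} {w : slowSpace k₀} {p : H2} :
    (p, (w : H2)) ∈ graphBoundary (graphMap U) σ ↔ ‖w‖ = σ ∧ p = U w :=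
  mem_image_graphPoint_graphMap.trans (and_congr_left' mem_sphere_zero_iff_norm)

lemma mem_slowSpace_of_mem_graphManifold {U : slowSpace k₀ → H2} {σ : ℝ} {p q : H2}
    (h : (p, q) ∈ graphManifold (graphMap U) σ) : q ∈ slowSpace k₀ := by
  obtain ⟨w, -, hw⟩ := h
  rw [graphPoint_graphMap, Prod.mk.injEq] at hw
  exact hw.2 ▸ w.2

namespace IsSlowGraph

variable {σ R : ℝ} {φ : H2 → H2} {U : slowSpace k₀ → H2} {w : slowSpace k₀} {s t : ℝ}

lemma mem_graphManifold_of_le (h : IsSlowGraph ε σ R φ U) (hsol : IsSolution ε T u v)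
    (hs : 0 ≤ s) (hst : s ≤ t) (htT : t ≤ T) (hmem : (u s, v s) ∈ graphManifold (graphMap U) σ) :
    (u t, v t) ∈ graphManifold (graphMap U) σ := by
  have hsT : s ∈ Icc 0 T := ⟨hs, hst.trans htT⟩
  obtain ⟨w, hw⟩ := exists_flow_of_heat (convex_Icc 0 T) hsol.heat hsT
    (mem_slowSpace_of_mem_graphManifold hmem)
  rw [hw s hsT, mem_graphManifold_graphMap] at hmem
  rw [hw t ⟨hs.trans hst, htT⟩, mem_graphManifold_graphMap]
  refine ⟨(antitone_norm_flow w hst).trans hmem.1, ?_⟩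
  exact ((hsol.solvesFast.mono hs htT).congr_right fun r hr => hw r ⟨hs.trans hr.1, hr.2.trans htT⟩)
    |>.eqOn_of_left_eq (h.solvesFast w s t hmem.1) hmem.2 (right_mem_Icc.mpr hst)

lemma eq_of_right_eq (h : IsSlowGraph ε σ R φ U) (hsol : IsSolution ε T u v)
    (hw : ∀ r ∈ Icc 0 T, v r = flow k₀ r w) (hs : 0 ≤ s) (hst : s ≤ t) (htT : t ≤ T)
    (hle : ‖flow k₀ s w‖ ≤ σ) (ht : u t = U (flow k₀ t w)) : u s = U (flow k₀ s w) :=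
  ((hsol.solvesFast.mono hs htT).congr_right fun r hr => hw r ⟨hs.trans hr.1, hr.2.trans htT⟩)
    |>.left_eq_of_right_eq (h.solvesFast w s t hle) hst ht

lemma exists_mem_graphBoundary (h : IsSlowGraph ε σ R φ U) (hsol : IsSolution ε T u v)
    (hs : 0 ≤ s) (hst : s ≤ t) (htT : t ≤ T) (hnot : (u s, v s) ∉ graphManifold (graphMap U) σ)
    (hmem : (u t, v t) ∈ graphManifold (graphMap U) σ) :
    ∃ r ∈ Ioc s t, (u r, v r) ∈ graphBoundary (graphMap U) σ := by
  have htT' : t ∈ Icc 0 T := ⟨hs.trans hst, htT⟩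
  obtain ⟨w, hw⟩ := exists_flow_of_heat (convex_Icc 0 T) hsol.heat htT'
    (mem_slowSpace_of_mem_graphManifold hmem)
  rw [hw s ⟨hs, hst.trans htT⟩, mem_graphManifold_graphMap] at hnot
  rw [hw t htT', mem_graphManifold_graphMap] at hmem
  have hlt : σ < ‖flow k₀ s w‖ := not_le.mp fun hle =>
    hnot ⟨hle, h.eq_of_right_eq hsol hw hs hst htT hle hmem.2⟩
  obtain ⟨r, hr, hrσ⟩ : ∃ r ∈ Icc s t, ‖flow k₀ r w‖ = σ := intermediate_value_Icc' hst
    (continuous_flow_apply w).norm.continuousOn ⟨hmem.1, hlt.le⟩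
  have hsr : s < r := hr.1.lt_of_ne (by rintro rfl; exact hlt.ne' hrσ)
  refine ⟨r, ⟨hsr, hr.2⟩, ?_⟩
  rw [hw r ⟨hs.trans hr.1, hr.2.trans htT⟩, mem_graphBoundary_graphMap]
  exact ⟨hrσ, h.eq_of_right_eq hsol hw (hs.trans hr.1) hr.2 htT hrσ.le hmem.2⟩

lemma contDiff_graphMap (h : IsSlowGraph ε σ R φ U) : ContDiff ℝ 1 (graphMap U) :=
  h.contDiff.prodMk contDiff_const

theorem isLocallyInvariant (h : IsSlowGraph ε σ R φ U) :
    IsLocallyInvariant ε (graphManifold (graphMap U) σ) (graphBoundary (graphMap U) σ) :=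
  fun _ _ _ hsol _ _ hs hst htT =>
    ⟨fun hmem hnot => absurd (h.mem_graphManifold_of_le hsol hs hst.le htT hmem) hnot,
      h.exists_mem_graphBoundary hsol hs hst.le htT⟩

theorem hausdorffEDist_le (h : IsSlowGraph ε σ R φ U) :
    Metric.hausdorffEDist (graphManifold (graphMap U) σ) (reducedCritical k₀ σ) ≤
      ENNReal.ofReal R := by
  have hfibre (w : slowSpace k₀) (hw : ‖w‖ ≤ σ) :
      edist (U w, (w : H2)) (φ w, (w : H2)) ≤ ENNReal.ofReal R := by
    rw [edist_dist, Prod.dist_eq, dist_self, dist_eq_norm, max_eq_left (norm_nonneg _)]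
    exact ENNReal.ofReal_le_ofReal (h.norm_sub_le w hw)
  refine Metric.hausdorffEDist_le_of_mem_edist ?_ ?_
  · rintro _ ⟨w, hw, rfl⟩
    have hw : ‖w‖ ≤ σ := mem_closedBall_zero_iff.mp hw
    rw [graphPoint_graphMap]
    exact ⟨(φ w, (w : H2)), ⟨h.mem_critical w hw, w.2, hw⟩, hfibre w hw⟩
  · rintro ⟨p, q⟩ ⟨hcrit, hslow, hq : ‖q‖ ≤ σ⟩
    refine ⟨(U ⟨q, hslow⟩, q), mem_graphManifold_graphMap (w := ⟨q, hslow⟩).mpr ⟨hq, rfl⟩, ?_⟩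
    rw [h.eq_of_mem_critical p q hq hcrit, edist_comm]
    exact hfibre ⟨q, hslow⟩ hq

lemma solvesFast_zero (h : IsSlowGraph ε σ R φ U) (hw : ‖w‖ ≤ σ) (T : ℝ) :
    SolvesFast ε 0 T (fun t => U (flow k₀ t w)) fun t => flow k₀ t w :=
  h.solvesFast w 0 T (by rwa [flow_zero])

theorem exists_solution (h : IsSlowGraph ε σ R φ U) (hw : ‖w‖ ≤ σ) (T : ℝ) :
    ∃ u v : ℝ → H2, IsSolution ε T u v ∧ (u 0, v 0) = graphPoint (graphMap U) w :=
  ⟨_, _, (h.solvesFast_zero hw T).isSolution, by rw [graphPoint_graphMap, flow_zero]⟩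

theorem exists_reducedSolution (h : IsSlowGraph ε σ R φ U) (hw : ‖w‖ ≤ σ) (T : ℝ) :
    ∃ u v : ℝ → H2, IsReducedSolution k₀ T u v ∧ v 0 = w :=
  ⟨fun t => φ (flow k₀ t w), fun t => flow k₀ t w,
    { continuousOn_v := (continuous_subtype_val.comp (continuous_flow_apply w)).continuousOn
      mem_critical := fun _ ht => h.mem_critical _ ((norm_flow_apply_le ht.1 w).trans hw)
      mem_slow := fun t _ => (flow k₀ t w).2
      eq_v := fun t _ =>
        ⟨_, isLaplacian_iff.mpr rfl, (hasDerivAt_embL2_flow w t).hasDerivWithinAt⟩ },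
    congrArg Subtype.val (flow_zero w)⟩

theorem norm_solution_sub_le (h : IsSlowGraph ε σ R φ U) (hw : ‖w‖ ≤ σ)
    {u₀ v₀ : ℝ → H2} (hsol : IsSolution ε T u v) (hinit : (u 0, v 0) = graphPoint (graphMap U) w)
    (hred : IsReducedSolution k₀ T u₀ v₀) (hinit₀ : v₀ 0 = w) (ht : t ∈ Icc 0 T) :
    ‖u t - u₀ t‖ + ‖v t - v₀ t‖ ≤ R := by
  rw [graphPoint_graphMap, Prod.mk.injEq] at hinit
  have hzero : (0 : ℝ) ∈ Icc 0 T := left_mem_Icc.mpr (ht.1.trans ht.2)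
  have hv := eq_flow_of_heat (convex_Icc 0 T) hsol.heat hzero hinit.2
  have hv₀ := eq_flow_of_heat (convex_Icc 0 T) hred.heat hzero hinit₀
  have hle : ‖flow k₀ t w‖ ≤ σ := (norm_flow_apply_le ht.1 w).trans hw
  have hu : u t = U (flow k₀ t w) := (hsol.solvesFast.congr_right hv).eqOn_of_left_eq
    (h.solvesFast_zero hw T) (by rw [flow_zero, hinit.1]) ht
  have hu₀ : u₀ t = φ (flow k₀ t w) :=
    h.eq_of_mem_critical _ _ hle (hv₀ t ht ▸ hred.mem_critical t ht)
  rw [hu, hu₀, hv t ht, hv₀ t ht, sub_self, norm_zero, add_zero]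
  exact h.norm_sub_le _ hle

end IsSlowGraph

end StrictSolutions

/-! ### Existence of the slow manifold -/

namespace IsCriticalMap

variable {k₀ : ℕ} {φ : H2 → H2} {ρ δ ε s t : ℝ}

lemma reaction_add (h : IsCriticalMap φ ρ δ) {v : H2} (hv : ‖v‖ < ρ) (w : H2) :
    reaction ε (φ v + w) v = embL2 (-(ε⁻¹ • ((2 : ℝ) • mul (φ v) w + mul w w)) - ε⁻¹ • w) := by
  have hcrit := congrArg toCont (h.eq v hv)
  rw [map_add, toCont_mul, toCont_mul] at hcrit
  have hreact : toCont v ^ 2 - toCont (φ v + w) * (toCont (φ v + w) + 1) =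
      toCont (-((2 : ℝ) • mul (φ v) w + mul w w) - w) := by
    rw [map_sub, map_neg, map_add, map_add, map_smul, toCont_mul, toCont_mul, two_smul, sq, ← hcrit]
    ring
  rw [reaction, hreact, ← embL2_apply, ← map_smul, smul_sub, smul_neg]

lemma hasDerivAt_embL2_flow (h : IsCriticalMap φ ρ δ) {v : slowSpace k₀}
    (hv : ‖flow k₀ t v‖ < ρ) :
    HasDerivAt (fun t => embL2 (φ (flow k₀ t v)))
      (lap (φ (flow k₀ t v)) - embL2 (remainder φ (flow k₀ t v))) t := by
  rw [h.lap_eq hv, map_add, add_sub_cancel_right]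
  exact embL2.hasFDerivAt.comp_hasDerivAt t
    ((h.hasFDerivAt (v := (flow k₀ t v : H2)) hv).comp_hasDerivAt t (hasDerivAt_flow_coe v t))

lemma hasDerivAt_embL2_graph (h : IsCriticalMap φ ρ δ) {F B W : slowSpace k₀ → H2} (hs : s ≤ ρ)
    (hF : EqOn F (remainder φ) (Metric.ball 0 s)) (hB : EqOn B (fun v => φ v) (Metric.ball 0 s))
    (hε : (k₀ : ℝ) ^ 2 < ε⁻¹)
    (hN : Continuous (alongGraph (quadraticNonlinearity mul F B ε⁻¹) W)) {M : ℝ}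
    (hM : ∀ y, ‖alongGraph (quadraticNonlinearity mul F B ε⁻¹) W y‖ ≤ M) (hW : Continuous W)
    (hWfix : ∀ v, W v = duhamel (dampedHeat ε⁻¹) (backFlow k₀)
      (alongGraph (quadraticNonlinearity mul F B ε⁻¹) W) v)
    {v : slowSpace k₀} (hv : ‖flow k₀ t v‖ < s) :
    HasDerivAt (fun t => embL2 (B (flow k₀ t v) + W (flow k₀ t v)))
      (lap (B (flow k₀ t v) + W (flow k₀ t v)) +
        reaction ε (B (flow k₀ t v) + W (flow k₀ t v)) (flow k₀ t v)) t := by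
  have hderiv := (h.hasDerivAt_embL2_flow (hv.trans_le hs)).add
    (hasDerivAt_duhamel_flow hε hN hM hW hWfix v t)
  have hnear : ∀ᶠ r in nhds t, flow k₀ r v ∈ Metric.ball 0 s :=
    (continuous_flow_apply v).continuousAt.eventually
      (Metric.isOpen_ball.mem_nhds (mem_ball_zero_iff.mpr hv))
  refine (hderiv.congr_of_eventuallyEq (hnear.mono fun r hr => ?_)).congr_deriv ?_
  · simp only [Pi.add_apply, hB hr, map_add]
  · have hmem : flow k₀ t v ∈ Metric.ball 0 s := mem_ball_zero_iff.mpr hv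
    simp only [hB hmem]
    rw [h.reaction_add (v := (flow k₀ t v : H2)) (hv.trans_le hs), alongGraph,
      quadraticNonlinearity, hF hmem, hB hmem, map_add lap, map_sub, map_sub, map_sub, map_neg]
    abel

variable {σ b r θ : ℝ}

lemma exists_isSmallNonlinearity (h : IsCriticalMap φ ρ δ) (hσ : 0 < σ) (hσρ : 3 * σ ≤ ρ)
    (hb : 0 ≤ b) (hr : 0 ≤ r) (hfr : 2 * (576 * derivConst * σ ^ 2 * k₀) ≤ b * r)
    (hsmall : b * (‖mul‖ * (2 * δ + 2 * r)) ≤ (b - (k₀ : ℝ) ^ 2) / 4) :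
    ∃ (F B : slowSpace k₀ → H2) (M : ℝ) (A : NNReal), ContDiff ℝ 1 B ∧
      EqOn F (remainder φ) (Metric.ball 0 (2 * σ)) ∧
      EqOn B (fun v => φ v) (Metric.ball 0 (2 * σ)) ∧
      IsSmallNonlinearity (quadraticNonlinearity mul F B b) b ((k₀ : ℝ) ^ 2) r M A := by
  have hσσ : 2 * σ < 3 * σ := by linarith
  have hball {v : slowSpace k₀} (hv : v ∈ Metric.ball 0 (3 * σ)) : ‖v‖ < ρ :=
    (mem_ball_zero_iff.mp hv).trans_le hσρ
  have hremainder (v : slowSpace k₀) (hv : v ∈ Metric.ball 0 (3 * σ)) :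
      ‖remainder φ v‖ ≤ 576 * derivConst * σ ^ 2 * k₀ := by
    have hdc := derivConst_nonneg
    calc ‖remainder φ v‖ ≤ 64 * derivConst * k₀ * ‖v‖ ^ 2 := h.norm_remainder_le (hball hv)
      _ ≤ 64 * derivConst * k₀ * (3 * σ) ^ 2 := by
          gcongr
          exact (mem_ball_zero_iff.mp hv).le
      _ = 576 * derivConst * σ ^ 2 * k₀ := by ring
  obtain ⟨F, hF, norm_F, ⟨f', hf'⟩, hFeq⟩ := exists_contDiff_eqOn_ball (G := remainder φ)
    (mul_pos two_pos hσ) hσσ (fun v hv => h.contDiffAt_remainder (hball hv)) hremainder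
  obtain ⟨B, hB, norm_B, ⟨β', hβ'⟩, hBeq⟩ := exists_contDiff_eqOn_ball
    (G := fun v : slowSpace k₀ => φ v) (mul_pos two_pos hσ) hσσ
    (fun v hv => (h.contDiffAt v (hball hv)).comp v (slowSpace k₀).subtypeL.contDiff.contDiffAt)
    (fun v hv => h.norm_le v (hball hv))
  exact ⟨F, B, _, _, hB, hFeq, hBeq,
    isSmallNonlinearity_quadratic hF hB norm_F norm_B hf' hβ' (sq_nonneg _) hb hr hfr hsmall⟩

theorem exists_isSlowGraph (h : IsCriticalMap φ ρ δ) (hσ : 0 < σ) (hσρ : 3 * σ ≤ ρ) (hε : 0 < ε)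
    (hθ : 0 < θ) (hk : ε * (k₀ : ℝ) ^ 2 ≤ 1 - θ) (hδ : ‖mul‖ * δ ≤ θ / 16)
    (hσδ : 1152 * derivConst * σ ^ 2 ≤ δ) :
    ∃ U : slowSpace k₀ → H2, IsSlowGraph ε σ (1152 * derivConst * σ ^ 2 * (ε * k₀)) φ U := by
  have hdc := derivConst_nonneg
  set r : ℝ := 1152 * derivConst * σ ^ 2 * (ε * k₀) with hrdef
  have hgap : (k₀ : ℝ) ^ 2 + ε⁻¹ * θ ≤ ε⁻¹ := by
    rw [← le_sub_iff_add_le, ← mul_one_sub, le_inv_mul_iff₀ hε]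
    exact hk
  have hε' : (k₀ : ℝ) ^ 2 < ε⁻¹ := by linarith [mul_pos (inv_pos.mpr hε) hθ]
  have hεk : ε * (k₀ : ℝ) ≤ 1 := by
    have hkk : (k₀ : ℝ) ≤ (k₀ : ℝ) ^ 2 := mod_cast Nat.le_self_pow two_ne_zero k₀
    linarith [mul_le_mul_of_nonneg_left hkk hε.le]
  have hrδ : r ≤ δ := (mul_le_of_le_one_right (by positivity) hεk).trans hσδ
  have hsmall : ε⁻¹ * (‖mul‖ * (2 * δ + 2 * r)) ≤ (ε⁻¹ - (k₀ : ℝ) ^ 2) / 4 := by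
    have hmul : ‖mul‖ * (2 * δ + 2 * r) ≤ θ / 4 := by
      linarith [mul_le_mul_of_nonneg_left hrδ (norm_nonneg mul)]
    linarith [mul_le_mul_of_nonneg_left hmul (inv_pos.mpr hε).le]
  obtain ⟨F, B, M, A, hB, hFeq, hBeq, hN⟩ := h.exists_isSmallNonlinearity (k₀ := k₀) hσ hσρ
    (inv_pos.mpr hε).le (show 0 ≤ r by positivity) (by rw [hrdef]; field_simp; linarith) hsmall
  obtain ⟨W, hW, norm_W, hWfix⟩ := hN.exists_duhamel_fixedPoint
    (isDichotomy_dampedHeat_backFlow hε') (by positivity)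
  refine ⟨fun v => B v + W v, hB.add hW, fun v hv => h.mem_criticalManifold (by linarith),
    fun u v hv => h.eq_of_mem_criticalManifold (by linarith), fun v hv => ?_, fun w a b hw => ?_⟩
  · rw [hBeq (mem_ball_zero_iff.mpr (by linarith)), add_sub_cancel_left]
    exact norm_W v
  · refine ⟨((hB.add hW).continuous.comp (continuous_flow_apply w)).continuousOn, fun t ht => ?_⟩
    have hle : ‖flow k₀ t w‖ < 2 * σ := by linarith [antitone_norm_flow w ht.1]
    exact (h.hasDerivAt_embL2_graph (by linarith) hFeq hBeq hε'
      (hN.continuous_alongGraph hW.continuous) (fun y => hN.norm_le y _ (norm_W y)) hW.continuous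
      hWfix hle).hasDerivWithinAt

end IsCriticalMap

/-- `h` parametrises, over the ball of radius `σ` of the slow space, a locally invariant manifold
of the fast-reaction system whose points and trajectories stay within `R` of their counterparts
for the reduced slow system. -/
structure IsSlowManifold (k₀ : ℕ) (ε σ R : ℝ) (h : slowSpace k₀ → H2 × fastSpace k₀) : Prop where
  contDiff : ContDiff ℝ 1 h
  isLocallyInvariant : IsLocallyInvariant ε (graphManifold h σ) (graphBoundary h σ)
  hausdorffEDist_le :
    Metric.hausdorffEDist (graphManifold h σ) (reducedCritical k₀ σ) ≤ ENNReal.ofReal R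
  exists_solution : ∀ v₀ : slowSpace k₀, ‖v₀‖ ≤ σ → ∀ T : ℝ,
    ∃ u v : ℝ → H2, IsSolution ε T u v ∧ (u 0, v 0) = graphPoint h v₀
  exists_reducedSolution : ∀ v₀ : slowSpace k₀, ‖v₀‖ ≤ σ → ∀ T : ℝ,
    ∃ uζ vζ : ℝ → H2, IsReducedSolution k₀ T uζ vζ ∧ vζ 0 = v₀
  norm_solution_sub_le : ∀ v₀ : slowSpace k₀, ‖v₀‖ ≤ σ → ∀ (T : ℝ) (u v uζ vζ : ℝ → H2),
    IsSolution ε T u v → (u 0, v 0) = graphPoint h v₀ →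
    IsReducedSolution k₀ T uζ vζ → vζ 0 = v₀ →
    ∀ t ∈ Icc 0 T, ‖u t - uζ t‖ + ‖v t - vζ t‖ ≤ R

lemma IsSlowGraph.isSlowManifold {k₀ : ℕ} {ε σ R R' : ℝ} {φ : H2 → H2} {U : slowSpace k₀ → H2}
    (h : IsSlowGraph ε σ R φ U) (hR : R ≤ R') : IsSlowManifold k₀ ε σ R' (graphMap U) where
  contDiff := h.contDiff_graphMap
  isLocallyInvariant := h.isLocallyInvariant
  hausdorffEDist_le := h.hausdorffEDist_le.trans (ENNReal.ofReal_le_ofReal hR)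
  exists_solution _ hv₀ T := h.exists_solution hv₀ T
  exists_reducedSolution _ hv₀ T := h.exists_reducedSolution hv₀ T
  norm_solution_sub_le _ hv₀ _ _ _ _ _ hsol hinit hred hinit₀ _ ht :=
    (h.norm_solution_sub_le hv₀ hsol hinit hred hinit₀ ht).trans hR

/-! ### The spectral gap -/

lemma mul_sq_le_of_inv_mul_le {ζ lam : ℝ} {k : ℕ} (hζ : 0 < ζ) (h : ζ⁻¹ * lam ≤ -(k : ℝ) ^ 2) :
    ζ * (k : ℝ) ^ 2 ≤ -lam := by
  rw [inv_mul_le_iff₀ hζ] at h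
  linarith

lemma mul_le_sqrt_of_mul_sq_le_one {ζ : ℝ} {k : ℝ} (hζ : 0 ≤ ζ) (h : ζ * k ^ 2 ≤ 1) :
    ζ * k ≤ √ζ := by
  refine Real.le_sqrt_of_sq_le ?_
  calc (ζ * k) ^ 2 = ζ * (ζ * k ^ 2) := by ring
    _ ≤ ζ := mul_le_of_le_one_right hζ h

end

end FastReaction

theorem mainTheorem10_general {θ : ℝ} (hθ : 0 < θ) :
    ∃ σ₀ > (0 : ℝ), ∃ C > (0 : ℝ), ∀ σ : ℝ, 0 < σ → σ ≤ σ₀ → ∀ ε : ℝ, 0 < ε →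
    ∀ k₀ : ℕ, ε * (k₀ : ℝ) ^ 2 ≤ 1 - θ → ∃ h : slowSpace k₀ → H2 × fastSpace k₀,
      IsSlowManifold k₀ ε σ (C * σ ^ 2 * (ε * k₀)) h := by
  have hdc := derivConst_nonneg
  set δ : ℝ := θ / (16 * (‖mul‖ + 1)) with hδdef
  have hδ : 0 < δ := by positivity
  have hmulδ : ‖mul‖ * δ ≤ θ / 16 := by
    rw [hδdef, mul_div_assoc', div_le_div_iff₀ (by positivity) (by norm_num)]
    linarith
  obtain ⟨φ, ρ, hρ, hφ⟩ := exists_criticalMap hδ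
  set C : ℝ := 1152 * derivConst + 1
  have hC : 0 < C := by positivity
  refine ⟨min (ρ / 3) √(δ / C), by positivity, C, hC, fun σ hσ hσ₀ ε hε k₀ hk => ?_⟩
  have hσρ : 3 * σ ≤ ρ := by linarith [hσ₀.trans (min_le_left _ _)]
  have hCσ : C * σ ^ 2 ≤ δ := by
    rw [← le_div_iff₀' hC]
    exact (Real.le_sqrt' hσ).mp (hσ₀.trans (min_le_right _ _))
  have hconst : 1152 * derivConst * σ ^ 2 ≤ C * σ ^ 2 := by
    gcongr
    exact le_add_of_nonneg_right zero_le_one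
  obtain ⟨U, hU⟩ := hφ.exists_isSlowGraph hσ hσρ hε hθ hk hmulδ (hconst.trans hCσ)
  exact ⟨_, hU.isSlowManifold (by gcongr)⟩

theorem mainTheorem10 (lam₀ : ℝ) (hlam_lower : -1 < lam₀) (hlam_upper : lam₀ < 0) :
    ∃ σ₀ > (0 : ℝ), ∀ σ : ℝ, 0 < σ → σ ≤ σ₀ →
    ∃ ε₀ > (0 : ℝ), ∃ ζ₀ > (0 : ℝ), ∃ C > (0 : ℝ),
    ∀ ε ζ : ℝ, 0 < ε → ε ≤ ε₀ → 0 < ζ → ζ ≤ ζ₀ → ε * ζ⁻¹ < 1 →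
    ∀ k₀ : ℕ, -((k₀ : ℝ) + 1) ^ 2 < ζ⁻¹ * lam₀ → ζ⁻¹ * lam₀ ≤ -(k₀ : ℝ) ^ 2 →
    ∃ h : slowSpace k₀ → H2 × fastSpace k₀,
      ContDiff ℝ 1 h ∧
      IsLocallyInvariant ε (graphManifold h σ) (graphBoundary h σ) ∧
      Metric.hausdorffEDist (graphManifold h σ) (reducedCritical k₀ σ) ≤
        ENNReal.ofReal (C * (ε + ζ ^ (1 / 2 : ℝ))) ∧
      ∀ v₀ : slowSpace k₀, ‖v₀‖ ≤ σ → ∀ T : ℝ, 0 < T →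
        (∃ u v : ℝ → H2, IsSolution ε T u v ∧ (u 0, v 0) = graphPoint h v₀) ∧
        (∃ uζ vζ : ℝ → H2, IsReducedSolution k₀ T uζ vζ ∧ vζ 0 = v₀) ∧
        ∀ u v uζ vζ : ℝ → H2,
          IsSolution ε T u v → (u 0, v 0) = graphPoint h v₀ →
          IsReducedSolution k₀ T uζ vζ → vζ 0 = v₀ →
          ∀ t ∈ Set.Icc 0 T, ‖u t - uζ t‖ + ‖v t - vζ t‖ ≤ C * (ε + ζ ^ (1 / 2 : ℝ)) := by
  obtain ⟨σ₀, hσ₀, C, hC, hmanifold⟩ := mainTheorem10_general (θ := 1 + lam₀) (by linarith)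
  refine ⟨σ₀, hσ₀, fun σ hσ hσ_le => ⟨1, one_pos, 1, one_pos, C * σ ^ 2, by positivity, ?_⟩⟩
  intro ε ζ hε _ hζ _ hεζ k₀ _ hk
  have hεζ : ε ≤ ζ := ((div_lt_one hζ).mp hεζ).le
  have hk : ζ * (k₀ : ℝ) ^ 2 ≤ -lam₀ := mul_sq_le_of_inv_mul_le hζ hk
  have hεk : ε * k₀ ≤ ε + ζ ^ (1 / 2 : ℝ) := calc
    ε * k₀ ≤ ζ * k₀ := by gcongr
    _ ≤ √ζ := mul_le_sqrt_of_mul_sq_le_one hζ.le (by linarith)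
    _ ≤ ε + ζ ^ (1 / 2 : ℝ) := by
        rw [← Real.sqrt_eq_rpow]
        exact le_add_of_nonneg_left hε.le
  have hR : C * σ ^ 2 * (ε * k₀) ≤ C * σ ^ 2 * (ε + ζ ^ (1 / 2 : ℝ)) := by gcongr
  obtain ⟨h, hh⟩ := hmanifold σ hσ hσ_le ε hε k₀
    (by linarith [mul_le_mul_of_nonneg_right hεζ (sq_nonneg (k₀ : ℝ))])
  exact ⟨h, hh.contDiff, hh.isLocallyInvariant,
    hh.hausdorffEDist_le.trans (ENNReal.ofReal_le_ofReal hR), fun v₀ hv₀ T _ =>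
    ⟨hh.exists_solution v₀ hv₀ T, hh.exists_reducedSolution v₀ hv₀ T,
      fun u v uζ vζ hsol hinit hred hinitζ t ht =>
        (hh.norm_solution_sub_le v₀ hv₀ T u v uζ vζ hsol hinit hred hinitζ t ht).trans hR⟩⟩
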